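/- **Setting.** Let $n\ge 4$, $d\ge 2$, and let $(\mathbf W,S)$ be a Coxeter system of type $D_n$ with $S=\{1,\dots,n\}$ and Coxeter graph $\Gamma$ with edges $\{1,3\}$ and $\{i,i+1\}$ for $2\le i\le n-1$. Let $K_n^D$ be the set of all $\sigma\subseteq S$ (including $\varnothing$) such that the parabolic subgroup $\mathbf W_\sigma=\langle\sigma\rangle$ is finite. For $\sigma\in K_n^D$ let $v_d(\sigma)$ be the multiplicity of the cyclotomic polynomial $\varphi_d$ in the Poincaré polynomial $\mathbf W_\sigma(q)=\sum_{w\in\mathbf W_\sigma}q^{\ell(w)}$. For $0\le g\le n-1$ let $K^D_{n,g}=\{\sigma\in K^D_n : \{n-g+1,\dots,n\}\subseteq\sigma\}$. Write $\tau\lhd\sigma$ if $\tau\subseteq\sigma$ and $|\sigma|=|\tau|+1$, and write $\sigma\veebar v$ for $\sigma\cup\{v\}$ if $v\notin\sigma$ and for $\sigma\setminus\{v\}$ if $v\in\sigma$. A *matching* $\mathcal M$ on a set $K$ of simplices is a set of edges $\sigma\to\tau$ with $\sigma,\tau\in K$, $\tau\lhd\sigma$, such that each simplex lies on at most one edge;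 a simplex on no edge is *critical*. $\mathcal M$ is *acyclic* if there is no non-trivial closed path $\tau_0\lhd\sigma_0\rhd\tau_1\lhd\sigma_1\rhd\dots\lhd\sigma_m\rhd\tau_0$ with all $\sigma_i\to\tau_i$ in $\mathcal M$ and all downward edges $\sigma_i\to\tau_{i+1}$ (with $\tau_{m+1}=\tau_0$) not in $\mathcal M$. It is *$\varphi_d$-weighted* if $v_d(\sigma)=v_d(\tau)$ for all $(\sigma\to\tau)\in\mathcal M$. It is *$\varphi_d$-precise* if it is acyclic, $\varphi_d$-weighted, and $v_d(\sigma)=v_d(\tau)+1$ for all critical $\sigma,\tau$ with $|\sigma|=|\tau|+1$ and $[\sigma:\tau]^{\mathcal M}\ne0$, where $$[\sigma:\tau]^{\mathcal M}=\sum(-1)^m[\sigma:\tau_1][\sigma_1:\tau_1][\sigma_1:\tau_2]\cdots[\sigma_m:\tau_m][\sigma_m:\tau]$$ is the sum over all paths $\sigma\rhd\tau_1\lhd\sigma_1\rhd\dots\rhd\tau_m\lhd\sigma_m\rhd\tau$, $m\ge 0$, with all $\sigma_i\to\tau_i$ in $\mathcal M$ and no downward edge in $\mathcal M$, and $[\sigma:\tau]=\pm1$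 is the simplicial incidence number. **Matching on $K^A_{n,f,g}$**, the set of all $\sigma\subseteq\{1,\dots,n\}$ that contain the first $f$ and the last $g$ vertices ($f,g\ge0$); it is used below after relabeling. - (a) If $f+g\ge n$, the matching is empty. Assume $f+g<n$ from now on. - (b) If $f\ge d$, remove the first $d$ vertices and proceed as in $K^A_{n-d,f-d,g}$. Assume $f\le d-1$ from now on. - (c) If $n\ge d+g$: if $\{1,\dots,d-1\}\subseteq\sigma$, match $\sigma$ with $\sigma\veebar d$; otherwise, if $f+1\in\sigma$, match $\sigma$ with $\sigma\setminus\{f+1\}$; otherwise, if $\{f+2,\dots,d-1\}\not\subseteq\sigma$, match $\sigma$ with $\sigma\cup\{f+1\}$; otherwise ignore the vertices $1,\dots,f+1$, relabel the others as $1,\dots,n-f-1$, and proceed as in $K^A_{n-f-1,d-2-f,g}$. - (d) If $n<d+g$: if $n\equiv -1,0,\dots,f\pmod d$ and $\sigma$ is $\{1,\dots,n\}$ or $\{1,\dots,n\}\setminus\{f+1\}$, then $\sigma$ is critical; otherwise match $\sigma$ with $\sigma\veebar(f+1)$. **Matching on $K^D_n$ for $d$ odd.** If $1\in\sigma$, match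 $\sigma$ with $\sigma\veebar2$. Otherwise relabel $2,\dots,n$ as $1,\dots,n-1$ and proceed as in $K^A_{n-1,0,0}$. **Matching on $K^D_{n,g}$ for $d$ even**, $h=d/2$. The first part that applies to $\sigma$ is used. - (a) If $2\notin\sigma$: relabel $1,3,4,\dots,n$ as $1,\dots,n-1$ and proceed as in $K^A_{n-1,0,g}$. - (b) If $d=2$ and $\{1,2,3,4\}\not\subseteq\sigma$: if $\{1,2,4\}\subseteq\sigma$, match $\sigma$ with $\sigma\veebar5$ if $n-g\ge5$, else $\sigma$ is critical; if $\{1,2,4\}\not\subseteq\sigma$, match $\sigma$ with $\sigma\veebar3$ if $n-g\ge3$, else $\sigma$ is critical. - (c) If $d\ge4$ and $3\notin\sigma$: match $\sigma$ with $\sigma\veebar1$. - (d) If $d=4$ and $4\notin\sigma$: ignore vertex $1$, relabel $5,\dots,n$ as $1,\dots,n-4$ and proceed as in $K^A_{n-4,0,g}$ (the vertices $\le 4$ stay unchanged). - (e) If $d\ge6$ and $4\notin\sigma$: match $\sigma$ with $\sigma\veebar1$. - (f) If $d\ge4$ and $1\notin\sigma$: if $\{2,\dots,h+1\}\subseteq\sigma$,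 relabel $2,\dots,n$ as $1,\dots,n-1$ and proceed as in $K^A_{n-1,\max(h,3),g}$; otherwise match $\sigma$ with $\sigma\cup\{1\}$. - (g) Otherwise $\{1,2,3,4\}\subseteq\sigma$. Let $k$ be the size of the connected component of vertex $1$ in the subgraph of $\Gamma$ induced by $\sigma$, and write $k=qh+r$ with $0<r<h$ if $h\nmid k$, and with $r\in\{0,h\}$ and $q$ even if $h\mid k$. Let $v=qh+1$ if $q$ is even and $v=qh+2$ if $q$ is odd. - (g1) If $v\in\sigma$: match $\sigma$ with $\sigma\setminus\{v\}$ if $v\le n-g$, else $\sigma$ is critical. - (g2) If $v\notin\sigma$: match $\sigma$ with $\sigma\cup\{v\}$, unless one of the following occurs. - (g2.1) $v>n$: $\sigma$ is critical. - (g2.2) $q$ is even and $\{qh+2,\dots,(q+1)h+1\}\subseteq\sigma$: ignore the vertices $\le qh+1$, relabel $qh+2,\dots,n$ as $1,\dots,n-qh-1$ and proceed as in $K^A_{n-qh-1,h,g}$. - (g2.3) $q$ is odd and $\{qh+3,\dots,(q+1)h\}\subseteq\sigma$: ignore the vertices $\le qh+2$, relabel $qh+3,\dots,n$ as $1,\dots,n-qh-2$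 and proceed as in $K^A_{n-qh-2,h-2,g}$. **Lemma.** These rules define matchings, whose critical simplices are exactly the simplices left unmatched by the rules. The matching on $K^D_n$ for $d$ odd, and the matching on $K^D_{n,g}$ for $d$ even and every $0\le g\le n-1$, are acyclic and $\varphi_d$-weighted. The critical simplices $\sigma$ of the matchings on $K_n^D$ (that is, with $g=0$ if $d$ is even) are as follows. For $d$ odd: - if $n\equiv0\pmod d$, there are exactly $2$, and $|\sigma|-v_d(\sigma)=n-2\frac nd$; - if $n\equiv1\pmod d$, there are exactly $2$, and $|\sigma|-v_d(\sigma)=n-2\frac{n-1}d-1$; - otherwise there are none. For $d$ even: - if $n\equiv0\pmod d$, then $|\sigma|-v_d(\sigma)=n-2\frac nd$, and critical simplices arise in the following parts only: (a); (b) for $n=4$ and $d=2$; (d) for $d=4$; (f) for $d\ge6$ or $n=d=4$; (g2.1); (g2.2); (g2.3); - if $n\equiv1\pmod d$, then $|\sigma|-v_d(\sigma)=n-2\frac{n-1}d-1$, and critical simplices arise in part (a) only; - if $d\ge4$ and $n\equiv\frac d2+1\pmod d$, then $|\sigma|-v_d(\sigma)=n-2\frac{n-1}d$, and critical simplices arise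 in the following parts only: (d) for $d=4$; (f) for $d\ge6$; (g2.1); (g2.2); (g2.3); - otherwise there are none. In the first three cases for $d$ even, each listed part other than (g2.2) and (g2.3), under the condition on $n$ and $d$ given with it, does contribute at least one critical simplex. In particular $|\sigma|-v_d(\sigma)$ is constant over the critical simplices of each matching on $K_n^D$, and both matchings on $K^D_n$ are $\varphi_d$-precise. -/

import Mathlib

open Polynomial

namespace PreciseMatching

/-! ### The simplicial complex and the weights of a Coxeter system

The generating set `S` is a finite set of natural numbers, and a simplex is a finite set of
natural numbers contained in `S`. -/

section Weights

variable {S : Finset ℕ} {M : CoxeterMatrix S} {W : Type*} [Group W]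

/-- The standard parabolic subgroup `W_σ`, generated by the simple reflections in `σ`. -/
def parabolic (cs : CoxeterSystem M W) (σ : Finset ℕ) : Subgroup W :=
  Subgroup.closure (cs.simple '' {s | (s : ℕ) ∈ σ})

/-- The simplicial complex `K_W` of all `σ ⊆ S` (the empty set included) such that `W_σ`
is finite. -/
def complexK (cs : CoxeterSystem M W) : Set (Finset ℕ) :=
  {σ | σ ⊆ S ∧ Finite (parabolic cs σ)}

/-- The Poincaré polynomial `W_σ(q) = ∑_{w ∈ W_σ} q ^ ℓ(w)` of a finite standard parabolic
subgroup, `ℓ` being the Coxeter length. -/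
noncomputable def poincare (cs : CoxeterSystem M W) (σ : Finset ℕ) : ℚ[X] :=
  ∑ᶠ w : parabolic cs σ, X ^ cs.length (w : W)

/-- The weight `v_φ(σ)` for `φ = φ_d`: the multiplicity of the `d`-th cyclotomic polynomial in
the Poincaré polynomial of `W_σ`. -/
noncomputable def weight (cs : CoxeterSystem M W) (d : ℕ) (σ : Finset ℕ) : ℕ :=
  multiplicity (cyclotomic d ℚ) (poincare cs σ)

end Weights

/-! ### Matchings on the incidence graph of a set of simplices

An edge `σ → τ` of the incidence graph is a pair `(σ, τ)` with `τ ⋖ σ`, that is, `τ ⊆ σ` and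
`|σ| = |τ| + 1`. -/

/-- `E` is a matching on the incidence graph of `K`: a set of edges such that every simplex is
adjacent to at most one edge in the set. -/
def IsMatching (K : Set (Finset ℕ)) (E : Set (Finset ℕ × Finset ℕ)) : Prop :=
  (∀ e ∈ E, e.1 ∈ K ∧ e.2 ∈ K ∧ e.2 ⋖ e.1) ∧
  ∀ e ∈ E, ∀ e' ∈ E, ∀ ρ : Finset ℕ,
    (e.1 = ρ ∨ e.2 = ρ) → (e'.1 = ρ ∨ e'.2 = ρ) → e = e'

/-- A simplex of `K` is critical if none of its adjacent edges is in the matching. -/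
def IsCritical (K : Set (Finset ℕ)) (E : Set (Finset ℕ × Finset ℕ)) (σ : Finset ℕ) : Prop :=
  σ ∈ K ∧ ∀ e ∈ E, e.1 ≠ σ ∧ e.2 ≠ σ

/-- The portion `τ ◁ σ ▷ τ'` of an alternating path: `σ → τ` is in the matching and the face
`σ → τ'` is not. -/
def AltStep (E : Set (Finset ℕ × Finset ℕ)) (τ τ' : Finset ℕ) : Prop :=
  ∃ σ, (σ, τ) ∈ E ∧ τ' ⋖ σ ∧ (σ, τ') ∉ E

/-- A matching is acyclic if there is no non-trivial alternating cycle
`τ₀ ◁ σ₀ ▷ τ₁ ◁ σ₁ ▷ ⋯ ◁ σₘ ▷ τ₀`. -/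
def IsAcyclic (E : Set (Finset ℕ × Finset ℕ)) : Prop :=
  ∀ τ, ¬ Relation.TransGen (AltStep E) τ τ

/-- A matching is weighted (for the weight function `v`) if matched simplices have the same
weight. -/
def IsWeighted (v : Finset ℕ → ℕ) (E : Set (Finset ℕ × Finset ℕ)) : Prop :=
  ∀ e ∈ E, v e.1 = v e.2

/-- The incidence number `[σ : τ]` for a codimension-one face `τ` of `σ`, with respect to the
natural order of the vertices: `(-1) ^ i` if `τ` is obtained from `σ` by removing a vertex which
has exactly `i` smaller vertices in `σ`. (For `τ ⋖ σ` the outer sum has exactly one term.) -/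
def incidence (σ τ : Finset ℕ) : ℤ :=
  ∑ u ∈ σ \ τ, (-1) ^ (σ.filter (· < u)).card

/-- The list `p = [(σ₁, τ₁), …, (σₘ, τₘ)]` describes an alternating path
`σ ▷ τ₁ ◁ σ₁ ▷ τ₂ ◁ σ₂ ▷ ⋯ ▷ τₘ ◁ σₘ ▷ τ` from `σ` to `τ`: the edges `σᵢ → τᵢ` are in the
matching, and the edges traversed downwards are not. -/
def IsAltPath (E : Set (Finset ℕ × Finset ℕ)) :
    Finset ℕ → List (Finset ℕ × Finset ℕ) → Finset ℕ → Prop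
  | σ, [], τ => τ ⋖ σ ∧ (σ, τ) ∉ E
  | σ, e :: p, τ => (e.2 ⋖ σ ∧ (σ, e.2) ∉ E) ∧ e ∈ E ∧ IsAltPath E e.1 p τ

/-- The contribution `(-1)ᵐ [σ:τ₁][σ₁:τ₁][σ₁:τ₂][σ₂:τ₂] ⋯ [σₘ:τₘ][σₘ:τ]` of an alternating
path. -/
def altPathSign : Finset ℕ → List (Finset ℕ × Finset ℕ) → Finset ℕ → ℤ
  | σ, [], τ => incidence σ τ
  | σ, e :: p, τ => -(incidence σ e.2 * incidence e.1 e.2 * altPathSign e.1 p τ)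

/-- The incidence number `[σ : τ]^E` of the Morse complex: the sum over all alternating paths
from `σ` to `τ`. (For an acyclic matching on a finite set of simplices there are only finitely
many.) -/
noncomputable def morseIncidence (E : Set (Finset ℕ × Finset ℕ)) (σ τ : Finset ℕ) : ℤ :=
  ∑ᶠ p ∈ {p | IsAltPath E σ p τ}, altPathSign σ p τ

/-- A matching is precise (for the weight function `v`) if it is acyclic and weighted, and
`v σ = v τ + 1` for all critical simplices `σ`, `τ` with `|τ| = |σ| - 1` and
`[σ : τ]^E ≠ 0`. -/
def IsPrecise (K : Set (Finset ℕ)) (v : Finset ℕ → ℕ) (E : Set (Finset ℕ × Finset ℕ)) : Prop :=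
  IsMatching K E ∧ IsAcyclic E ∧ IsWeighted v E ∧
  ∀ σ τ, IsCritical K E σ → IsCritical K E τ → σ.card = τ.card + 1 →
    morseIncidence E σ τ ≠ 0 → v σ = v τ + 1

/-! ### Matchings given by a rule

All matchings below are described by a rule which assigns to a simplex `σ` either a vertex `x`,
meaning that `σ` is to be matched with `toggle σ x`, or `none`, meaning that `σ` is declared to
be critical. -/

/-- `σ ⊻ x`: add the vertex `x` to `σ` if it is not there, remove it otherwise. -/
def toggle (σ : Finset ℕ) (x : ℕ) : Finset ℕ :=
  if x ∈ σ then σ.erase x else insert x σ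

/-- The set of all edges that connect some `ρ ∈ K` with the simplex `toggle ρ x` prescribed by
the rule. -/
def edgesOf (K : Set (Finset ℕ)) (rule : Finset ℕ → Option ℕ) : Set (Finset ℕ × Finset ℕ) :=
  {e | (e.1 ∈ K ∧ ∃ x ∈ e.1, rule e.1 = some x ∧ e.2 = toggle e.1 x) ∨
       (e.2 ∈ K ∧ ∃ x ∉ e.2, rule e.2 = some x ∧ e.1 = toggle e.2 x)}

/-- Ignore the vertices `1, …, m` and relabel `m + 1, m + 2, …` as `1, 2, …`. -/
def shift (m : ℕ) (σ : Finset ℕ) : Finset ℕ :=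
  (σ.filter (m < ·)).image (· - m)

/-- The rule of the `φ_d`-matching on the set `K^A_{n,f,g}` of the simplices
`σ ⊆ {1, …, n}` that contain the first `f` and the last `g` vertices. (The condition `d = 0` in the
first line only serves the termination of the recursion.) -/
def ruleA (d n f g : ℕ) (σ : Finset ℕ) : Option ℕ :=
  if _h₀ : n ≤ f + g ∨ d = 0 then none
  else if _h₁ : d ≤ f then
    (ruleA d (n - d) (f - d) g (shift d σ)).map (· + d)
  else if d + g ≤ n then
    if Finset.Icc 1 (d - 1) ⊆ σ then some d
    else if f + 1 ∈ σ then some (f + 1)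
    else if ¬ Finset.Icc (f + 2) (d - 1) ⊆ σ then some (f + 1)
    else (ruleA d (n - f - 1) (d - 2 - f) g (shift (f + 1) σ)).map (· + (f + 1))
  else
    -- the first condition says that `n` is congruent to one of `-1, 0, …, f` modulo `d`
    if (∃ j ∈ Finset.range (f + 2), n + 1 ≡ j [MOD d]) ∧
        (σ = Finset.Icc 1 n ∨ σ = (Finset.Icc 1 n).erase (f + 1)) then none
    else some (f + 1)
termination_by n
decreasing_by all_goals omega

/-! ### Type `D_n` -/

/-- Adjacency in the Coxeter graph of type `D`: the edges are `{1, 3}` and `{i, i + 1}` for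
`i ≥ 2`. -/
def AdjD (i j : ℕ) : Prop :=
  (i = 1 ∧ j = 3) ∨ (2 ≤ i ∧ j = i + 1) ∨ (j = 1 ∧ i = 3) ∨ (2 ≤ j ∧ i = j + 1)

instance (i j : ℕ) : Decidable (AdjD i j) := by
  unfold AdjD; infer_instance

/-- The Coxeter matrix of type `D_n`, with generating set `{1, …, n}`. -/
def typeD (n : ℕ) : CoxeterMatrix (Finset.Icc 1 n) where
  M := Matrix.of fun i j =>
    if (i : ℕ) = (j : ℕ) then 1 else if AdjD i j then 3 else 2
  isSymm := by
    apply Matrix.IsSymm.ext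
    intro i j
    have h : AdjD (j : ℕ) i ↔ AdjD (i : ℕ) j := by unfold AdjD; tauto
    simp only [Matrix.of_apply, h, eq_comm]
  diagonal i := by simp
  off_diagonal i j hij := by
    have h : (i : ℕ) ≠ (j : ℕ) := fun h => hij (Subtype.ext h)
    simp only [Matrix.of_apply, h, if_false]
    split <;> decide

/-- The rule of the `φ_d`-matching on `K^D_n` for `d` odd. -/
def ruleDOdd (d n : ℕ) (σ : Finset ℕ) : Option ℕ :=
  if 1 ∈ σ then some 2
  else (ruleA d (n - 1) 0 0 (shift 1 σ)).map (· + 1)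

/-- The parts of the definition of the `φ_d`-matching for `d` even. The part `g2` is the generic
case of (g2), in which `σ` is matched with `σ ∪ {v}`; its exceptions (g2.1), (g2.2), (g2.3) are
`g21`, `g22`, `g23`. -/
inductive Part
  | a | b | c | d | e | f | g1 | g2 | g21 | g22 | g23

/-- For `{1, 2, 3, 4} ⊆ σ ⊆ {1, …, n}`: the size of the connected component of the vertex `1` in
the subgraph induced by `σ`. This component is the longest initial segment `{1, …, k}` contained
in `σ`. -/
def componentSize (n : ℕ) (σ : Finset ℕ) : ℕ :=
  Nat.findGreatest (fun k => Finset.Icc 1 k ⊆ σ) n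

/-- The number `q` in the decomposition `k = q h + r`, where `h = d / 2`, and where `0 < r < h` if
`h` does not divide `k`, while `r ∈ {0, h}` and `q` is even if `h` divides `k`. -/
def quotD (h k : ℕ) : ℕ :=
  if h ∣ k ∧ Odd (k / h) then k / h - 1 else k / h

/-- The vertex `v = q h + 1` for `q` even, `v = q h + 2` for `q` odd. -/
def vertexD (h k : ℕ) : ℕ :=
  if Even (quotD h k) then quotD h k * h + 1 else quotD h k * h + 2

/-- The part of the definition of the `φ_d`-matching on `K^D_{n,g}` for `d` even which applies to
the simplex `σ`. -/
def partD (d n : ℕ) (σ : Finset ℕ) : Part :=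
  let h := d / 2
  let q := quotD h (componentSize n σ)
  let v := vertexD h (componentSize n σ)
  if 2 ∉ σ then .a
  else if d = 2 ∧ ¬ Finset.Icc 1 4 ⊆ σ then .b
  else if 4 ≤ d ∧ 3 ∉ σ then .c
  else if d = 4 ∧ 4 ∉ σ then .d
  else if 6 ≤ d ∧ 4 ∉ σ then .e
  else if 4 ≤ d ∧ 1 ∉ σ then .f
  else if v ∈ σ then .g1
  else if n < v then .g21
  else if Even q ∧ Finset.Icc (q * h + 2) ((q + 1) * h + 1) ⊆ σ then .g22
  else if Odd q ∧ Finset.Icc (q * h + 3) ((q + 1) * h) ⊆ σ then .g23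
  else .g2

/-- The rule of the `φ_d`-matching on `K^D_{n,g}` for `d` even. In part (a), the vertices
`1, 3, 4, …, n` are relabeled as `1, 2, …, n - 1`. -/
def ruleDEven (d n g : ℕ) (σ : Finset ℕ) : Option ℕ :=
  let h := d / 2
  let q := quotD h (componentSize n σ)
  let v := vertexD h (componentSize n σ)
  match partD d n σ with
  | .a => (ruleA d (n - 1) 0 g (σ.image fun i => if i = 1 then 1 else i - 1)).map
      fun i => if i = 1 then 1 else i + 1
  | .b =>
    if {1, 2, 4} ⊆ σ then (if 5 ≤ n - g then some 5 else none)
    else (if 3 ≤ n - g then some 3 else none)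
  | .c => some 1
  | .d => (ruleA d (n - 4) 0 g (shift 4 σ)).map (· + 4)
  | .e => some 1
  | .f =>
    if Finset.Icc 2 (h + 1) ⊆ σ then
      (ruleA d (n - 1) (max h 3) g (shift 1 σ)).map (· + 1)
    else some 1
  | .g1 => if v ≤ n - g then some v else none
  | .g2 => some v
  | .g21 => none
  | .g22 => (ruleA d (n - q * h - 1) h g (shift (q * h + 1) σ)).map (· + (q * h + 1))
  | .g23 => (ruleA d (n - q * h - 2) (h - 2) g (shift (q * h + 2) σ)).map (· + (q * h + 2))

section TypeD

variable {n : ℕ} {W : Type*} [Group W]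

/-- `K^D_{n,g}`: the simplices of `K^D_n` that contain the last `g` vertices. -/
def complexD (cs : CoxeterSystem (typeD n) W) (g : ℕ) : Set (Finset ℕ) :=
  {σ | σ ∈ complexK cs ∧ Finset.Icc (n - g + 1) n ⊆ σ}

/-- The `φ_d`-matching on `K^D_n` for `d` odd. -/
def matchingDOdd (cs : CoxeterSystem (typeD n) W) (d : ℕ) : Set (Finset ℕ × Finset ℕ) :=
  edgesOf (complexK cs) (ruleDOdd d n)

/-- The `φ_d`-matching on `K^D_{n,g}` for `d` even. -/
def matchingDEven (cs : CoxeterSystem (typeD n) W) (d g : ℕ) : Set (Finset ℕ × Finset ℕ) :=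
  edgesOf (complexD cs g) (ruleDEven d n g)

/-- The quantity `|σ| - v_φ(σ)` for `φ = φ_d`, as a rational number. -/
noncomputable def defect (cs : CoxeterSystem (typeD n) W) (d : ℕ) (σ : Finset ℕ) : ℚ :=
  (σ.card : ℚ) - (weight cs d σ : ℚ)

end TypeD

/-- The parts in which critical simplices arise for `d` even and `n ≡ 0` modulo `d`. -/
def originsZero (n d : ℕ) : Set Part :=
  {p | p = .a ∨ (p = .b ∧ n = 4 ∧ d = 2) ∨ (p = .d ∧ d = 4) ∨
    (p = .f ∧ (6 ≤ d ∨ (n = 4 ∧ d = 4))) ∨ p = .g21 ∨ p = .g22 ∨ p = .g23}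

/-- The parts in which critical simplices arise for `d ≥ 4` even and `n ≡ d / 2 + 1` modulo
`d`. -/
def originsHalf (d : ℕ) : Set Part :=
  {p | (p = .d ∧ d = 4) ∨ (p = .f ∧ 6 ≤ d) ∨ p = .g21 ∨ p = .g22 ∨ p = .g23}

end PreciseMatching

open PreciseMatching

namespace PreciseMatching

/-! ### Toggling a vertex -/

theorem toggle_of_mem {σ : Finset ℕ} {x : ℕ} (h : x ∈ σ) : toggle σ x = σ.erase x := by
  simp [toggle, h]

theorem toggle_of_notMem {σ : Finset ℕ} {x : ℕ} (h : x ∉ σ) : toggle σ x = insert x σ := by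
  simp [toggle, h]

theorem mem_toggle {σ : Finset ℕ} {x y : ℕ} :
    y ∈ toggle σ x ↔ (y = x ∧ x ∉ σ) ∨ (y ≠ x ∧ y ∈ σ) := by
  unfold toggle; split_ifs <;> grind

/-! ### Rules that define acyclic weighted matchings -/

/-- Two consecutive lower ends `τ`, `τ'` on an alternating path of the matching given by `r`. -/
def Step (K : Set (Finset ℕ)) (r : Finset ℕ → Option ℕ) (τ τ' : Finset ℕ) : Prop :=
  τ ∈ K ∧ τ' ∈ K ∧ ∃ x, r τ = some x ∧ x ∉ τ ∧ x ∈ τ' ∧ τ' ⊆ insert x τ ∧ τ'.card = τ.card ∧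
    ∃ y, r τ' = some y ∧ y ∉ τ'

/-- The rule `r` defines an acyclic matching on `K` that respects the weight `w`. -/
structure Tame (K : Set (Finset ℕ)) (r : Finset ℕ → Option ℕ) (w : Finset ℕ → ℕ) : Prop where
  closed : ∀ σ ∈ K, ∀ x, r σ = some x → toggle σ x ∈ K
  rule_eq : ∀ σ ∈ K, ∀ x, r σ = some x → r (toggle σ x) = some x
  weight_eq : ∀ σ ∈ K, ∀ x, r σ = some x → x ∉ σ → w (insert x σ) = w σ
  acyclic : ∀ τ, ¬ Relation.TransGen (Step K r) τ τ

/-! ### Building tame rules from pieces. -/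

namespace Tame

variable {K : Set (Finset ℕ)} {r : Finset ℕ → Option ℕ} {w : Finset ℕ → ℕ}

theorem of_none (h : ∀ σ ∈ K, r σ = none) : Tame K r w where
  closed σ hσ x hx := by simp [h σ hσ] at hx
  rule_eq σ hσ x hx := by simp [h σ hσ] at hx
  weight_eq σ hσ x hx := by simp [h σ hσ] at hx
  acyclic τ hτ := by
    obtain ⟨b, ⟨h1, h2, x, hx, _⟩, _⟩ := Relation.TransGen.head'_iff.1 hτ
    simp [h τ h1] at hx

theorem of_isEmpty (h : ∀ σ, σ ∉ K) : Tame K r w :=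
  of_none fun σ hσ => absurd hσ (h σ)

/-- There are no steps at all: a step into `b` requires `x ∈ b`, while `b`, being again a lower end,
must miss its prescribed vertex, which is also `x`. -/
theorem of_some (x : ℕ) (h : ∀ σ ∈ K, r σ = some x) (hc : ∀ σ ∈ K, toggle σ x ∈ K)
    (hw : ∀ σ ∈ K, x ∉ σ → w (insert x σ) = w σ) : Tame K r w where
  closed σ hσ y hy := by
    have := h σ hσ
    grind
  rule_eq σ hσ y hy := by
    have h1 := h σ hσ
    obtain rfl : x = y := by simpa [h1] using hy
    exact h _ (hc σ hσ)
  weight_eq σ hσ y hy hyσ := by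
    have h1 := h σ hσ
    obtain rfl : x = y := by simpa [h1] using hy
    exact hw σ hσ hyσ
  acyclic τ hτ := by
    obtain ⟨b, ⟨h1, h2, y, hy, _, hyb, _, _, z, hz, hzb⟩, _⟩ := Relation.TransGen.head'_iff.1 hτ
    rw [h τ h1] at hy
    rw [h b h2] at hz
    grind

/-- A chain that weakly decreases `f` but has equal values at its ends is constant along the way, so
each of its links satisfies the finer relation. -/
theorem transGen_of_fiber {α : Type*} {R R' : α → α → Prop} {f : α → ℕ}
    (h1 : ∀ a b, R a b → f b ≤ f a) (h2 : ∀ a b, R a b → f a = f b → R' a b) {a b : α}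
    (h : Relation.TransGen R a b) : f b ≤ f a ∧ (f a = f b → Relation.TransGen R' a b) := by
  induction h with
  | single h => exact ⟨h1 _ _ h, fun e => .single (h2 _ _ h e)⟩
  | tail _ h ih =>
    obtain ⟨ih1, ih2⟩ := ih
    have := h1 _ _ h
    refine ⟨by omega, fun e => .tail (ih2 (by omega)) (h2 _ _ h (by omega))⟩

/-- The patchwork principle. The upper end `insert x a` lies in the fiber of its partner `a`, and
the next lower end is a subset of it, so `f` cannot increase along a step. A cycle therefore stays
inside one fiber, where acyclicity is assumed. -/
theorem of_fiber (f : Finset ℕ → ℕ) (hf : ∀ σ ∈ K, ∀ τ ∈ K, σ ⊆ τ → f σ ≤ f τ)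
    (h : ∀ j, Tame {σ | σ ∈ K ∧ f σ = j} r w) : Tame K r w where
  closed σ hσ x hx := ((h (f σ)).closed σ ⟨hσ, rfl⟩ x hx).1
  rule_eq σ hσ x hx := (h (f σ)).rule_eq σ ⟨hσ, rfl⟩ x hx
  weight_eq σ hσ x hx := (h (f σ)).weight_eq σ ⟨hσ, rfl⟩ x hx
  acyclic τ hτ := by
    have key := transGen_of_fiber (f := f) (R := Step K r)
      (R' := fun a b => Step {σ | σ ∈ K ∧ f σ = f a} r a b) ?_ ?_ hτ
    · have h2 := key.2 rfl
      have : ∀ a b, Relation.TransGen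
          (fun a b => Step {σ | σ ∈ K ∧ f σ = f a} r a b) a b →
          f b = f a ∧ Relation.TransGen (Step {σ | σ ∈ K ∧ f σ = f a} r) a b := by
        intro a b hab
        induction hab with
        | single h => exact ⟨h.2.1.2, .single h⟩
        | tail _ h ih => exact ⟨by rw [h.2.1.2, ih.1], .tail ih.2 (by rw [← ih.1]; exact h)⟩
      exact (h (f τ)).acyclic τ (this _ _ h2).2
    · rintro a b ⟨ha, hb, x, hx, hxa, hxb, hsub, _⟩
      have h1 := (h (f a)).closed a ⟨ha, rfl⟩ x hx
      rw [toggle_of_notMem hxa] at h1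
      have h2 := hf b hb _ h1.1 hsub
      rw [h1.2] at h2
      exact h2
    · rintro a b ⟨ha, hb, hh⟩ hab
      exact ⟨⟨ha, rfl⟩, ⟨hb, hab.symm⟩, hh⟩

/-- The indicator of an upward closed condition is monotone, so this is the patchwork principle with
two fibers. -/
theorem of_split (p : Finset ℕ → Prop) (hp : ∀ σ τ, σ ⊆ τ → p σ → p τ)
    (h1 : Tame {σ | σ ∈ K ∧ p σ} r w) (h0 : Tame {σ | σ ∈ K ∧ ¬ p σ} r w) : Tame K r w := by
  classical
  refine of_fiber (fun σ => if p σ then 1 else 0) ?_ ?_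
  · intro σ _ τ _ hst
    have := hp σ τ hst
    split_ifs <;> simp_all
  · intro j
    by_cases hj1 : j = 1
    · subst hj1
      convert h1 using 4
      simp
    · by_cases hj0 : j = 0
      · subst hj0
        convert h0 using 4
        simp
      · apply of_isEmpty
        rintro σ ⟨_, hσ⟩
        split_ifs at hσ <;> omega

/-- Splitting along the condition that `σ` contains the vertex set `A`. -/
theorem of_split_subset (A : Finset ℕ) (h1 : Tame {σ | σ ∈ K ∧ A ⊆ σ} r w)
    (h0 : Tame {σ | σ ∈ K ∧ ¬ A ⊆ σ} r w) : Tame K r w :=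
  of_split (A ⊆ ·) (fun _ _ h h' => h'.trans h) h1 h0

/-- Splitting along the condition that `σ` contains the vertex `v`. -/
theorem of_split_mem (v : ℕ) (h1 : Tame {σ | σ ∈ K ∧ v ∈ σ} r w)
    (h0 : Tame {σ | σ ∈ K ∧ v ∉ σ} r w) : Tame K r w :=
  of_split (v ∈ ·) (fun _ _ h h' => h h') h1 h0

/-- Transport of a rule along a relabeling `ψ` of the vertices, with inverse `e`. -/
theorem of_relabel {K' : Set (Finset ℕ)} {r' : Finset ℕ → Option ℕ} {w' : Finset ℕ → ℕ}
    (h : Tame K' r' w') (ψ : Finset ℕ → Finset ℕ) (e : ℕ → ℕ) (c₀ c₁ : ℕ)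
    (hK : ∀ σ ∈ K, ψ σ ∈ K') (hr : ∀ σ ∈ K, r σ = (r' (ψ σ)).map e)
    (hψ : ∀ σ τ, σ ⊆ τ → ψ σ ⊆ ψ τ)
    (ht : ∀ σ ∈ K, ∀ x, toggle (ψ σ) x ∈ K' →
      toggle σ (e x) ∈ K ∧ ψ (toggle σ (e x)) = toggle (ψ σ) x ∧ (e x ∈ σ ↔ x ∈ ψ σ))
    (hcard : ∀ σ ∈ K, σ.card = (ψ σ).card + c₀) (hw : ∀ σ ∈ K, w σ = w' (ψ σ) + c₁) :
    Tame K r w := by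
  have key : ∀ σ ∈ K, ∀ x, r σ = some x → ∃ y, r' (ψ σ) = some y ∧ e y = x ∧
      toggle σ x ∈ K ∧ ψ (toggle σ x) = toggle (ψ σ) y ∧ (x ∈ σ ↔ y ∈ ψ σ) := by
    intro σ hσ x hx
    rw [hr σ hσ, Option.map_eq_some_iff] at hx
    obtain ⟨y, hy, rfl⟩ := hx
    obtain ⟨h1, h2, h3⟩ := ht σ hσ y (h.closed _ (hK σ hσ) y hy)
    exact ⟨y, hy, rfl, h1, h2, h3⟩
  refine ⟨?_, ?_, ?_, ?_⟩
  · intro σ hσ x hx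
    obtain ⟨y, hy, hyx, h1, h2, h3⟩ := key σ hσ x hx
    exact h1
  · intro σ hσ x hx
    obtain ⟨y, hy, rfl, h1, h2, h3⟩ := key σ hσ x hx
    rw [hr _ h1, h2, h.rule_eq _ (hK σ hσ) y hy, Option.map_some]
  · intro σ hσ x hx hxσ
    obtain ⟨y, hy, rfl, h1, h2, h3⟩ := key σ hσ x hx
    have hy' : y ∉ ψ σ := fun h => hxσ (h3.2 h)
    rw [toggle_of_notMem hxσ] at h1 h2
    rw [hw _ h1, hw _ hσ, h2, toggle_of_notMem hy', h.weight_eq _ (hK σ hσ) y hy hy']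
  · intro τ hτ
    refine h.acyclic (ψ τ) (Relation.TransGen.lift (p := Step K' r') ψ ?_ _ _ hτ)
    rintro a b ⟨ha, hb, x, hx, hxa, hxb, hsub, hc, z, hz, hzb⟩
    obtain ⟨y, hy, rfl, h1, h2, h3⟩ := key a ha x hx
    obtain ⟨u, hu, rfl, g1, g2, g3⟩ := key b hb z hz
    have hya : y ∉ ψ a := fun h => hxa (h3.2 h)
    rw [toggle_of_notMem hxa, toggle_of_notMem hya] at h2
    have hsub' := h2 ▸ hψ _ _ hsub
    have hc' : (ψ b).card = (ψ a).card := by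
      have := hcard a ha
      have := hcard b hb
      omega
    refine ⟨hK a ha, hK b hb, y, hy, hya, ?_, hsub', hc', u, hu, fun h => hzb (g3.2 h)⟩
    -- If `y` were missing, then `ψ b ⊆ ψ a` with equal cardinalities, so `ψ b = ψ a` and both
    -- prescribe the same vertex. But `e y` lies in `b`, whereas `b` misses the vertex prescribed
    -- for it.
    by_contra hyb
    have hba : ψ b ⊆ ψ a := by
      intro i hi
      have := hsub' hi
      grind
    have := Finset.eq_of_subset_of_card_le hba hc'.ge
    rw [this, hy] at hu
    obtain rfl : y = u := by simpa using hu
    have : ψ (insert (e y) b) = ψ (insert (e y) a) := by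
      rw [toggle_of_notMem hzb, toggle_of_notMem hyb] at g2
      rw [g2, h2, this]
    grind

/-! ### The matching defined by a tame rule -/

/-- Tameness makes the two clauses in the definition of `edgesOf` equivalent: an edge prescribed
from one end is prescribed from the other as well. -/
theorem mem_edgesOf (h : Tame K r w) {σ τ : Finset ℕ} :
    (σ, τ) ∈ edgesOf K r ↔ ∃ x, x ∉ τ ∧ σ = insert x τ ∧ τ ∈ K ∧ σ ∈ K ∧ r σ = some x ∧
      r τ = some x := by
  constructor
  · rintro (⟨hσ, x, hx, hr, h2⟩ | ⟨hτ, x, hx, hr, h2⟩)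
    · dsimp only at *
      have h3 := h.closed _ hσ _ hr
      have h4 := h.rule_eq _ hσ _ hr
      subst h2
      refine ⟨x, ?_, ?_, h3, hσ, hr, h4⟩ <;> rw [toggle_of_mem hx] <;> simp [Finset.insert_erase hx]
    · dsimp only at *
      have h3 := h.closed _ hτ _ hr
      have h4 := h.rule_eq _ hτ _ hr
      subst h2
      exact ⟨x, hx, toggle_of_notMem hx, hτ, h3, h4, hr⟩
  · rintro ⟨x, hx, rfl, hτ, hσ, hr, hr'⟩
    exact Or.inr ⟨hτ, x, hx, hr', (toggle_of_notMem hx).symm⟩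

theorem isMatching (h : Tame K r w) : IsMatching K (edgesOf K r) := by
  constructor
  · rintro ⟨σ, τ⟩ he
    obtain ⟨x, hx, rfl, hτ, hσ, _⟩ := h.mem_edgesOf.1 he
    exact ⟨hσ, hτ, Finset.covBy_insert hx⟩
  · have key : ∀ e ∈ edgesOf K r, ∀ ρ, (e.1 = ρ ∨ e.2 = ρ) → ∃ x, r ρ = some x ∧
        e = (insert x ρ, ρ.erase x) := by
      rintro ⟨σ, τ⟩ he ρ hρ
      obtain ⟨x, hx, rfl, hτ, hσ, h1, h2⟩ := h.mem_edgesOf.1 he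
      refine ⟨x, ?_⟩
      rcases hρ with rfl | rfl <;> simp [*]
    intro e he e' he' ρ hρ hρ'
    obtain ⟨x, hx, rfl⟩ := key e he ρ hρ
    obtain ⟨y, hy, rfl⟩ := key e' he' ρ hρ'
    obtain rfl : x = y := by simpa [hx] using hy
    rfl

theorem isCritical_iff (h : Tame K r w) (σ : Finset ℕ) :
    IsCritical K (edgesOf K r) σ ↔ σ ∈ K ∧ r σ = none := by
  constructor
  · rintro ⟨hσ, hc⟩
    refine ⟨hσ, ?_⟩
    by_contra hne
    obtain ⟨x, hx⟩ := Option.ne_none_iff_exists'.1 hne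
    by_cases hxσ : x ∈ σ
    · exact (hc (σ, toggle σ x) (Or.inl ⟨hσ, x, hxσ, hx, rfl⟩)).1 rfl
    · exact (hc (toggle σ x, σ) (Or.inr ⟨hσ, x, hxσ, hx, rfl⟩)).2 rfl
  · rintro ⟨hσ, hr⟩
    refine ⟨hσ, ?_⟩
    rintro ⟨a, b⟩ he
    obtain ⟨x, hx, rfl, _, _, h1, h2⟩ := h.mem_edgesOf.1 he
    constructor <;> rintro rfl <;> simp_all

theorem isWeighted (h : Tame K r w) : IsWeighted w (edgesOf K r) := by
  rintro ⟨a, b⟩ he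
  obtain ⟨x, hx, rfl, h1, _, _, h2⟩ := h.mem_edgesOf.1 he
  exact h.weight_eq _ h1 _ h2 hx

/-- An `AltStep` does not ask its target to be a lower end of an edge. On a path this holds for
every simplex except possibly the last, because the next step starts there; on a cycle it holds for
the last one too. So a cycle is a chain of `Step`s. -/
theorem isAcyclic (h : Tame K r w) : IsAcyclic (edgesOf K r) := by
  have key : ∀ a b, Relation.TransGen (AltStep (edgesOf K r)) a b →
      (b ∈ K ∧ ∃ y, r b = some y ∧ y ∉ b) → Relation.TransGen (Step K r) a b := by
    intro a b hab
    have step : ∀ a c, AltStep (edgesOf K r) a c → (c ∈ K ∧ ∃ y, r c = some y ∧ y ∉ c) →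
        Step K r a c := by
      rintro a c ⟨σ, h1, h2, h3⟩ ⟨hc, hy⟩
      obtain ⟨x, hx, rfl, ha, hσ, g1, g2⟩ := h.mem_edgesOf.1 h1
      have hcard : (insert x a).card = c.card + 1 :=
        (Nat.covBy_iff_add_one_eq.1 h2.card_finset).symm
      have hcard' : c.card = a.card := by
        rw [Finset.card_insert_of_notMem hx] at hcard
        omega
      refine ⟨ha, hc, x, g2, hx, ?_, h2.1.le, hcard', hy⟩
      -- Without `x` the face `c` would be the matched face `a` itself, but edges traversed
      -- downwards are not in the matching.
      by_contra hxc
      have hca : c ⊆ a := by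
        intro i hi
        have : i ∈ insert x a := h2.1.le hi
        grind
      obtain rfl := Finset.eq_of_subset_of_card_le hca hcard'.ge
      exact h3 h1
    have lower : ∀ a c, AltStep (edgesOf K r) a c → (a ∈ K ∧ ∃ y, r a = some y ∧ y ∉ a) := by
      rintro a c ⟨σ, h1, h2, h3⟩
      obtain ⟨x, hx, rfl, ha, hσ, g1, g2⟩ := h.mem_edgesOf.1 h1
      exact ⟨ha, x, g2, hx⟩
    induction hab with
    | single h' => exact fun hb => .single (step _ _ h' hb)
    | tail _ h' ih => exact fun hb => .tail (ih (lower _ _ h')) (step _ _ h' hb)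
  intro τ hτ
  refine h.acyclic τ (key τ τ hτ ?_)
  obtain ⟨b, ⟨σ, h1, h2, h3⟩, _⟩ := Relation.TransGen.head'_iff.1 hτ
  obtain ⟨x, hx, rfl, ha, hσ, g1, g2⟩ := h.mem_edgesOf.1 h1
  exact ⟨ha, x, g2, hx⟩

/-- The condition on `morseIncidence` is not needed: a constant difference between cardinality and
weight settles every pair of critical simplices in adjacent dimensions. -/
theorem isPrecise (h : Tame K r w) (c : ℚ)
    (hc : ∀ σ, IsCritical K (edgesOf K r) σ → (σ.card : ℚ) - w σ = c) :
    IsPrecise K w (edgesOf K r) := by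
  refine ⟨h.isMatching, h.isAcyclic, h.isWeighted, fun σ τ hσ hτ hcard _ => ?_⟩
  have h1 := hc σ hσ
  have h2 := hc τ hτ
  rw [hcard] at h1
  push_cast at h1
  have : (w σ : ℚ) = w τ + 1 := by linarith
  exact_mod_cast this

end Tame

/-! ### Shifts -/

theorem mem_shift {m i : ℕ} {σ : Finset ℕ} : i ∈ shift m σ ↔ 1 ≤ i ∧ i + m ∈ σ := by
  simp only [shift, Finset.mem_image, Finset.mem_filter]
  constructor
  · rintro ⟨j, ⟨h1, h2⟩, rfl⟩
    rw [Nat.sub_add_cancel h2.le]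
    exact ⟨by omega, h1⟩
  · rintro ⟨h1, h2⟩
    exact ⟨i + m, ⟨h2, by omega⟩, by omega⟩

theorem zero_notMem_shift (m : ℕ) (σ : Finset ℕ) : 0 ∉ shift m σ := by
  simp [mem_shift]

theorem shift_shift (m k : ℕ) (σ : Finset ℕ) : shift k (shift m σ) = shift (m + k) σ := by
  ext i
  simp only [mem_shift]
  rw [show i + (m + k) = i + k + m by ring]
  exact ⟨fun h => ⟨h.1, h.2.2⟩, fun h => ⟨h.1, by omega, h.2⟩⟩

theorem shift_mono {m : ℕ} {σ τ : Finset ℕ} (h : σ ⊆ τ) : shift m σ ⊆ shift m τ := by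
  intro i hi
  rw [mem_shift] at hi ⊢
  exact ⟨hi.1, h hi.2⟩

theorem Icc_subset_shift {m a b : ℕ} {σ : Finset ℕ} (ha : 1 ≤ a) :
    Finset.Icc a b ⊆ shift m σ ↔ Finset.Icc (a + m) (b + m) ⊆ σ := by
  constructor
  · intro h i hi
    rw [Finset.mem_Icc] at hi
    have := h (Finset.mem_Icc.2 (show a ≤ i - m ∧ i - m ≤ b by omega))
    rw [mem_shift, Nat.sub_add_cancel (by omega)] at this
    exact this.2
  · intro h i hi
    rw [Finset.mem_Icc] at hi
    rw [mem_shift]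
    exact ⟨by omega, h (Finset.mem_Icc.2 (by omega))⟩

theorem shift_toggle {m x : ℕ} {σ : Finset ℕ} (hx : 1 ≤ x) :
    shift m (toggle σ (x + m)) = toggle (shift m σ) x := by
  ext i
  simp only [mem_shift, mem_toggle]
  grind

theorem shift_insert_of_le {m x : ℕ} {σ : Finset ℕ} (hx : x ≤ m) :
    shift m (insert x σ) = shift m σ := by
  ext i
  simp only [mem_shift, Finset.mem_insert]
  grind

theorem filter_le_toggle {m x : ℕ} {σ : Finset ℕ} (hx : m < x) :
    (toggle σ x).filter (· ≤ m) = σ.filter (· ≤ m) := by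
  ext i
  simp only [Finset.mem_filter, mem_toggle]
  grind

theorem card_eq_card_shift_add (m : ℕ) (σ : Finset ℕ) :
    σ.card = (shift m σ).card + (σ.filter (· ≤ m)).card := by
  have h1 : (shift m σ).card = (σ.filter (m < ·)).card := by
    unfold shift
    apply Finset.card_image_of_injOn
    intro a ha b hb hab
    simp only [Finset.coe_filter, Set.mem_ofPred_eq] at ha hb hab
    omega
  rw [h1, add_comm, ← Finset.card_filter_add_card_filter_not (s := σ) (p := (· ≤ m))]
  simp

/-- Take the union of `P` with `τ` translated by `m`. This lifts critical simplices found in a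
recursive call. -/
theorem exists_shift_eq (m : ℕ) {P τ : Finset ℕ} (hP : P ⊆ Finset.Icc 1 m) (hτ : 0 ∉ τ) :
    ∃ σ : Finset ℕ, 0 ∉ σ ∧ σ.filter (· ≤ m) = P ∧ shift m σ = τ := by
  have hP' : ∀ i ∈ P, 1 ≤ i ∧ i ≤ m := fun i hi => Finset.mem_Icc.1 (hP hi)
  have hτ' : ∀ i ∈ τ, 1 ≤ i := fun i hi => Nat.one_le_iff_ne_zero.2 fun h => hτ (h ▸ hi)
  refine ⟨P ∪ τ.image (· + m), ?_, ?_, ?_⟩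
  · simp only [Finset.mem_union, Finset.mem_image, not_or]
    grind
  · ext i
    simp only [Finset.mem_filter, Finset.mem_union, Finset.mem_image]
    grind
  · ext i
    simp only [mem_shift, Finset.mem_union, Finset.mem_image]
    grind

/-- The form in which recursive calls occur: the part of `σ` up to `m` is frozen to `P`, so passing
to the shift changes cardinalities by `|P|` and weights by a constant. -/
theorem Tame.of_shift {K K' : Set (Finset ℕ)} {r r' : Finset ℕ → Option ℕ}
    {w w' : Finset ℕ → ℕ} (h : Tame K' r' w') (m : ℕ) (P : Finset ℕ) (c : ℕ)
    (hK' : ∀ σ ∈ K', 0 ∉ σ) (hK : ∀ σ, σ ∈ K ↔ σ.filter (· ≤ m) = P ∧ shift m σ ∈ K')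
    (hr : ∀ σ ∈ K, r σ = (r' (shift m σ)).map (· + m))
    (hw : ∀ σ ∈ K, w σ = w' (shift m σ) + c) : Tame K r w := by
  refine h.of_relabel (shift m) (· + m) P.card c (fun σ hσ => ((hK σ).1 hσ).2) hr
    (fun _ _ => shift_mono) ?_ ?_ hw
  · intro σ hσ x hx
    -- Toggling the label `0` would create a simplex containing `0`, and `K'` has none.
    have hx1 : 1 ≤ x := by
      by_contra h0
      obtain rfl : x = 0 := by omega
      have h1 := hK' _ hx
      have h2 := hK' _ ((hK σ).1 hσ).2
      rw [mem_toggle] at h1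
      simp_all
    refine ⟨?_, shift_toggle hx1, ?_⟩
    · rw [hK, shift_toggle hx1, filter_le_toggle (by omega)]
      exact ⟨((hK σ).1 hσ).1, hx⟩
    · rw [mem_shift]; simp [hx1]
  · intro σ hσ
    rw [card_eq_card_shift_add m σ, ((hK σ).1 hσ).1]

/-! ### The weight of type `A` -/

/-- The last vertex before `i` (or the vertex `i` itself) that is missing in `σ`. -/
def gap (σ : Finset ℕ) (i : ℕ) : ℕ := Nat.findGreatest (· ∉ σ) i

/-- The multiplicity of `φ_d` in the Poincaré polynomial of the parabolic subgroup generated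
by `σ` in a Coxeter group of type `A`. -/
def weightA (d : ℕ) (σ : Finset ℕ) : ℕ := (σ.filter fun i => d ∣ i - gap σ i + 1).card

theorem gap_le (σ : Finset ℕ) (i : ℕ) : gap σ i ≤ i := Nat.findGreatest_le i

theorem gap_notMem {σ : Finset ℕ} (h0 : 0 ∉ σ) (i : ℕ) : gap σ i ∉ σ := by
  have := (Nat.findGreatest_eq_iff (P := (· ∉ σ)) (k := i) (m := gap σ i)).1 rfl
  -- `0` is also the default value of `Nat.findGreatest`; that it is missing from `σ` comes from
  -- `h0`.
  by_cases h : gap σ i = 0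
  · rwa [h]
  · exact this.2.1 h

theorem mem_of_gap_lt {σ : Finset ℕ} {i j : ℕ} (h : gap σ i < j) (hj : j ≤ i) : j ∈ σ := by
  have := (Nat.findGreatest_eq_iff (P := (· ∉ σ)) (k := i) (m := gap σ i)).1 rfl
  exact not_not.1 (this.2.2 h hj)

theorem gap_eq {σ : Finset ℕ} {i j : ℕ} (hj : j ≤ i) (hjσ : j ∉ σ)
    (h : ∀ t, j < t → t ≤ i → t ∈ σ) : gap σ i = j :=
  Nat.findGreatest_eq_iff.2 ⟨hj, fun _ => hjσ, fun _ h1 h2 => not_not.2 (h _ h1 h2)⟩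

theorem le_gap {σ : Finset ℕ} {i j : ℕ} (hj : j ≤ i) (hjσ : j ∉ σ) : j ≤ gap σ i :=
  Nat.le_findGreatest hj hjσ

theorem gap_shift {σ : Finset ℕ} {m i : ℕ} (h0 : 0 ∉ σ) (hm : m ∉ σ) :
    gap (shift m σ) i = gap σ (i + m) - m := by
  have h1 := le_gap (σ := σ) (i := i + m) (j := m) (by omega) hm
  have h2 := gap_le σ (i + m)
  apply gap_eq
  · omega
  · rw [mem_shift, Nat.sub_add_cancel h1]
    exact fun h => gap_notMem h0 _ h.2
  · intro t ht1 ht2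
    rw [mem_shift]
    exact ⟨by omega, mem_of_gap_lt (by omega) (by omega : t + m ≤ i + m)⟩

theorem exists_run {σ : Finset ℕ} (m : ℕ) (h : Finset.Icc 1 m ⊆ σ) :
    ∃ k, m ≤ k ∧ Finset.Icc 1 k ⊆ σ ∧ k + 1 ∉ σ := by
  have hex : ∃ k, k + 1 ∉ σ := by
    obtain ⟨x, hx⟩ := Infinite.exists_notMem_finset (insert 0 σ)
    simp only [Finset.mem_insert, not_or] at hx
    exact ⟨x - 1, by rw [Nat.sub_add_cancel (by omega)]; exact hx.2⟩
  classical
  refine ⟨Nat.find hex, ?_, ?_, Nat.find_spec hex⟩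
  · by_contra hlt
    push Not at hlt
    exact Nat.find_spec hex (h (Finset.mem_Icc.2 (by omega)))
  · intro i hi
    rw [Finset.mem_Icc] at hi
    have := Nat.find_min hex (m := i - 1) (by omega)
    rw [Nat.sub_add_cancel hi.1] at this
    exact not_not.1 this

/-- A missing vertex `m` separates the runs: for `i > m` the gap before `i` is at least `m`, so
nothing below `m` influences the contribution of `i`. -/
theorem card_filter_gap_shift {σ : Finset ℕ} {m : ℕ} (d : ℕ) (h0 : 0 ∉ σ) (hm : m ∉ σ) :
    (σ.filter fun i => m < i ∧ d ∣ i - gap σ i + 1).card = weightA d (shift m σ) := by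
  unfold weightA
  symm
  apply Finset.card_nbij' (· + m) (· - m)
  · intro i hi
    simp only [Finset.coe_filter, Set.mem_ofPred_eq, mem_shift] at hi ⊢
    rw [gap_shift h0 hm] at hi
    have h1 := le_gap (σ := σ) (i := i + m) (j := m) (by omega) hm
    have h2 := gap_le σ (i + m)
    rw [show i - (gap σ (i + m) - m) = i + m - gap σ (i + m) by omega] at hi
    exact ⟨hi.1.2, by omega, hi.2⟩
  · intro i hi
    simp only [Finset.coe_filter, Set.mem_ofPred_eq, mem_shift] at hi ⊢
    rw [gap_shift h0 hm, Nat.sub_add_cancel hi.2.1.le]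
    have h1 := le_gap (σ := σ) (i := i) (j := m) (by omega) hm
    have h2 := gap_le σ i
    rw [show i - m - (gap σ i - m) = i - gap σ i by omega]
    exact ⟨⟨by omega, hi.1⟩, hi.2.2⟩
  · intro i _; simp
  · intro i hi
    simp only [Finset.coe_filter, Set.mem_ofPred_eq] at hi ⊢
    omega

theorem card_filter_dvd_add_one {d : ℕ} (hd : 2 ≤ d) (k : ℕ) :
    ((Finset.Icc 1 k).filter fun i => d ∣ i + 1).card = (k + 1) / d := by
  rw [← Nat.Ioc_filter_dvd_card_eq_div]
  apply Finset.card_nbij' (· + 1) (· - 1)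
  · intro i hi
    simp only [Finset.coe_filter, Set.mem_ofPred_eq, Finset.mem_Icc, Finset.mem_Ioc] at hi ⊢
    exact ⟨by omega, hi.2⟩
  · intro i hi
    simp only [Finset.coe_filter, Set.mem_ofPred_eq, Finset.mem_Icc, Finset.mem_Ioc] at hi ⊢
    have := Nat.le_of_dvd hi.1.1 hi.2
    rw [Nat.sub_add_cancel hi.1.1]
    exact ⟨by omega, hi.2⟩
  · intro i _; simp
  · intro i hi
    simp only [Finset.coe_filter, Set.mem_ofPred_eq, Finset.mem_Ioc] at hi ⊢
    omega

/-- The run `1, …, k` is a component of type `A_k`, with Poincaré polynomial `[2][3]⋯[k+1]`; exactly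
`⌊(k+1)/d⌋` of these factors are divisible by `φ_d`. -/
theorem weightA_eq_of_run {d : ℕ} (hd : 2 ≤ d) {σ : Finset ℕ} (h0 : 0 ∉ σ) {k : ℕ}
    (hk : Finset.Icc 1 k ⊆ σ) (hk' : k + 1 ∉ σ) :
    weightA d σ = (k + 1) / d + weightA d (shift (k + 1) σ) := by
  rw [← card_filter_gap_shift d h0 hk', ← card_filter_dvd_add_one hd, weightA,
    ← Finset.card_filter_add_card_filter_not (p := (· < k + 1)), Finset.filter_filter,
    Finset.filter_filter]
  congr 2
  · ext i
    simp only [Finset.mem_filter, Finset.mem_Icc]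
    have key : 1 ≤ i → i ≤ k → gap σ i = 0 := fun h1 h2 => gap_eq (by omega) h0
      fun t ht1 ht2 => hk (Finset.mem_Icc.2 (by omega))
    constructor
    · rintro ⟨h1, h2, h3⟩
      have : 1 ≤ i := Nat.one_le_iff_ne_zero.2 fun h => h0 (h ▸ h1)
      rw [key this (by omega)] at h2
      exact ⟨by omega, h2⟩
    · rintro ⟨⟨h1, h2⟩, h3⟩
      rw [key h1 h2]
      exact ⟨hk (Finset.mem_Icc.2 ⟨h1, h2⟩), h3, by omega⟩
  · ext i
    simp only [Finset.mem_filter]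
    constructor
    · rintro ⟨h1, h2, h3⟩
      have : i ≠ k + 1 := fun h => hk' (h ▸ h1)
      exact ⟨h1, by omega, h2⟩
    · rintro ⟨h1, h2, h3⟩
      exact ⟨h1, h3, by omega⟩

/-- Shortening an initial run by `d` vertices lowers `⌊(k+1)/d⌋` by one. This is the constant weight
change in part (b) of the type `A` rule. -/
theorem weightA_eq_of_Icc_subset {d : ℕ} (hd : 2 ≤ d) {σ : Finset ℕ} (h0 : 0 ∉ σ)
    (h : Finset.Icc 1 d ⊆ σ) : weightA d σ = weightA d (shift d σ) + 1 := by
  obtain ⟨k, h1, h2, h3⟩ := exists_run d h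
  rw [weightA_eq_of_run hd h0 h2 h3, weightA_eq_of_run (k := k - d) hd (zero_notMem_shift d σ),
    shift_shift, show d + (k - d + 1) = k + 1 by omega, show k + 1 = k - d + 1 + d by omega,
    Nat.add_div_right _ (by omega)]
  · ring
  · rw [Icc_subset_shift le_rfl, Nat.sub_add_cancel h1]
    exact (Finset.Icc_subset_Icc_left (by omega)).trans h2
  · rw [mem_shift, show k - d + 1 + d = k + 1 by omega]
    exact fun h => h3 h.2

/-- Adding a vertex which merges two intervals into an interval of less than `d - 1` vertices does
not change the weight. -/
theorem weightA_insert_of_short {d : ℕ} (hd : 2 ≤ d) {σ : Finset ℕ} (h0 : 0 ∉ σ) {f j : ℕ}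
    (hf : Finset.Icc 1 f ⊆ σ) (hf' : f + 1 ∉ σ) (hj : f + 1 < j) (hjd : j < d) (hjσ : j ∉ σ) :
    weightA d (insert (f + 1) σ) = weightA d σ := by
  have h1 : Finset.Icc 1 (f + 1) ⊆ insert (f + 1) σ := by
    intro i hi
    rw [Finset.mem_Icc] at hi
    rw [Finset.mem_insert]
    by_cases h : i = f + 1
    · exact Or.inl h
    · exact Or.inr (hf (Finset.mem_Icc.2 (by omega)))
  obtain ⟨k, h2, h3, h4⟩ := exists_run (f + 1) h1
  have hkj : k + 1 ≤ j := by
    by_contra hlt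
    have := h3 (Finset.mem_Icc.2 (show 1 ≤ j ∧ j ≤ k by omega))
    rw [Finset.mem_insert] at this
    rcases this with h | h
    · omega
    · exact hjσ h
  rw [weightA_eq_of_run hd (by simp [h0]) h3 h4, weightA_eq_of_run hd h0 hf hf',
    weightA_eq_of_run (k := k - (f + 1)) hd (zero_notMem_shift _ σ),
    shift_shift, show f + 1 + (k - (f + 1) + 1) = k + 1 by omega, shift_insert_of_le (by omega),
    Nat.div_eq_of_lt (by omega), Nat.div_eq_of_lt (by omega), Nat.div_eq_of_lt (by omega)]
  · ring
  · rw [Icc_subset_shift le_rfl, Nat.sub_add_cancel h2]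
    intro i hi
    rw [Finset.mem_Icc] at hi
    have := h3 (Finset.mem_Icc.2 (show 1 ≤ i ∧ i ≤ k by omega))
    rw [Finset.mem_insert] at this
    rcases this with h | h
    · omega
    · exact h
  · rw [mem_shift, show k - (f + 1) + 1 + (f + 1) = k + 1 by omega]
    exact fun h => h4 (Finset.mem_insert_of_mem h.2)

/-- Without `d`, the run of `d - 1` vertices contributes one. With `d`, the first `d` vertices
contribute one and can be cut off. Both times what remains is the part beyond `d`. -/
theorem weightA_insert_of_Icc_subset {d : ℕ} (hd : 2 ≤ d) {σ : Finset ℕ} (h0 : 0 ∉ σ)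
    (h : Finset.Icc 1 (d - 1) ⊆ σ) (hdσ : d ∉ σ) : weightA d (insert d σ) = weightA d σ := by
  rw [weightA_eq_of_Icc_subset (σ := insert d σ) hd, weightA_eq_of_run (k := d - 1) hd h0 h,
    Nat.sub_add_cancel (by omega), Nat.div_self (by omega), shift_insert_of_le le_rfl, add_comm]
  · rwa [Nat.sub_add_cancel (by omega)]
  · simp only [Finset.mem_insert, not_or]
    exact ⟨by omega, h0⟩
  · intro i hi
    rw [Finset.mem_Icc] at hi
    rw [Finset.mem_insert]
    by_cases h' : i = d
    · exact Or.inl h'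
    · exact Or.inr (h (Finset.mem_Icc.2 (by omega)))

theorem weightA_empty (d : ℕ) : weightA d ∅ = 0 := by simp [weightA]

theorem weightA_Icc {d : ℕ} (hd : 2 ≤ d) (n : ℕ) : weightA d (Finset.Icc 1 n) = (n + 1) / d := by
  rw [weightA_eq_of_run hd (by simp) (Finset.Subset.refl _) (by simp)]
  have : shift (n + 1) (Finset.Icc 1 n) = ∅ := by
    ext i
    simp only [mem_shift, Finset.mem_Icc, Finset.notMem_empty, iff_false]
    omega
  rw [this, weightA_empty, add_zero]

theorem weightA_Icc_erase {d : ℕ} (hd : 2 ≤ d) {n f : ℕ} (hf : f < n) :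
    weightA d ((Finset.Icc 1 n).erase (f + 1)) = (f + 1) / d + (n - f) / d := by
  rw [weightA_eq_of_run (k := f) hd (by simp)]
  · have : shift (f + 1) ((Finset.Icc 1 n).erase (f + 1)) = Finset.Icc 1 (n - f - 1) := by
      ext i
      simp only [mem_shift, Finset.mem_Icc, Finset.mem_erase]
      omega
    rw [this, weightA_Icc hd, show n - f - 1 + 1 = n - f by omega]
  · intro i hi
    simp only [Finset.mem_Icc, Finset.mem_erase] at hi ⊢
    omega
  · simp

/-! ### The matching on `K^A_{n,f,g}` -/

/-- `K^A_{n,f,g}`: the subsets of `{1, …, n}` that contain the first `f` and the last `g`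
vertices. -/
def complexA (n f g : ℕ) : Set (Finset ℕ) :=
  {σ | σ ⊆ Finset.Icc 1 n ∧ Finset.Icc 1 f ⊆ σ ∧ Finset.Icc (n - g + 1) n ⊆ σ}

theorem zero_notMem_of_subset_Icc {σ : Finset ℕ} {n : ℕ} (h : σ ⊆ Finset.Icc 1 n) : 0 ∉ σ :=
  fun h0 => by simpa using h h0

/-- The right-hand side leaves the vertices up to `m` free, except for the upper bound `n`. The
assumption on `m + g` ensures that the prescribed last `g` vertices survive the shift. -/
theorem shift_mem_complexA_iff {n m f g : ℕ} (hm : m + g ≤ n) {σ : Finset ℕ} :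
    shift m σ ∈ complexA (n - m) f g ↔ (∀ i ∈ σ, i ≤ n) ∧ Finset.Icc (1 + m) (f + m) ⊆ σ ∧
      Finset.Icc (n - g + 1) n ⊆ σ := by
  have e1 : n - m - g + 1 + m = n - g + 1 := by omega
  have e2 : n - m + m = n := by omega
  unfold complexA
  rw [Set.mem_ofPred_eq, Icc_subset_shift le_rfl, Icc_subset_shift (by omega), e1, e2]
  refine and_congr_left fun _ => ⟨fun h i hi => ?_, fun h i hi => ?_⟩
  · by_contra hlt
    have := Finset.mem_Icc.1 (h (mem_shift.2 (⟨by omega, by rwa [Nat.sub_add_cancel (by omega)]⟩ :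
      1 ≤ i - m ∧ i - m + m ∈ σ)))
    omega
  · rw [mem_shift] at hi
    have := h _ hi.2
    rw [Finset.mem_Icc]
    omega

theorem filter_le_eq_iff {m : ℕ} {σ P : Finset ℕ} (hP : ∀ i ∈ P, i ≤ m) :
    σ.filter (· ≤ m) = P ↔ ∀ i ≤ m, i ∈ σ ↔ i ∈ P := by
  constructor
  · rintro rfl i hi
    simp [hi]
  · intro h
    ext i
    rw [Finset.mem_filter]
    constructor
    · rintro ⟨h1, h2⟩
      exact (h i h2).1 h1
    · intro hi
      exact ⟨(h i (hP i hi)).2 hi, hP i hi⟩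

section ruleA

variable {d n f g : ℕ} {σ : Finset ℕ}

theorem ruleA_of_le (h : n ≤ f + g) : ruleA d n f g σ = none := by
  rw [ruleA, dif_pos (Or.inl h)]

theorem ruleA_of_le_left (hd : 2 ≤ d) (h : f + g < n) (hf : d ≤ f) :
    ruleA d n f g σ = (ruleA d (n - d) (f - d) g (shift d σ)).map (· + d) := by
  rw [ruleA, dif_neg (by omega), dif_pos hf]

theorem ruleA_of_add_le (hd : 2 ≤ d) (h : f + g < n) (hf : f < d) (hn : d + g ≤ n) :
    ruleA d n f g σ =
      if Finset.Icc 1 (d - 1) ⊆ σ then some d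
      else if f + 1 ∈ σ then some (f + 1)
      else if ¬ Finset.Icc (f + 2) (d - 1) ⊆ σ then some (f + 1)
      else (ruleA d (n - f - 1) (d - 2 - f) g (shift (f + 1) σ)).map (· + (f + 1)) := by
  rw [ruleA, dif_neg (by omega), dif_neg (by omega), if_pos hn]

theorem ruleA_of_lt_add (hd : 2 ≤ d) (h : f + g < n) (hf : f < d) (hn : n < d + g) :
    ruleA d n f g σ =
      if (∃ j ∈ Finset.range (f + 2), n + 1 ≡ j [MOD d]) ∧
        (σ = Finset.Icc 1 n ∨ σ = (Finset.Icc 1 n).erase (f + 1)) then none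
      else some (f + 1) := by
  rw [ruleA, dif_neg (by omega), dif_neg (by omega), if_neg (by omega)]

end ruleA

/-- If no number from `n - f + 1` to `n + 1` is divisible by `d`, then removing the vertex `f + 1`
from the full simplex does not change the weight. -/
theorem weightA_Icc_erase_eq {d n f : ℕ} (hd : 2 ≤ d) (hf : f < n) (hfd : f + 1 < d)
    (h : ¬ ∃ j ∈ Finset.range (f + 2), n + 1 ≡ j [MOD d]) :
    weightA d ((Finset.Icc 1 n).erase (f + 1)) = weightA d (Finset.Icc 1 n) := by
  rw [weightA_Icc_erase hd hf, weightA_Icc hd, Nat.div_eq_of_lt hfd, zero_add]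
  -- The residue of `n + 1` exceeds `f + 1`, so subtracting `f + 1` from `n + 1` does not change the
  -- quotient by `d`.
  have h1 : f + 2 ≤ (n + 1) % d := by
    by_contra hlt
    exact h ⟨(n + 1) % d, Finset.mem_range.2 (by omega), (Nat.mod_modEq _ _).symm⟩
  have h2 := Nat.div_add_mod (n + 1) d
  have h3 := Nat.mod_lt (n + 1) (show d > 0 by omega)
  symm
  rw [Nat.div_eq_iff (by omega)]
  have : (n - f) / d = (n + 1) / d := by
    rw [Nat.div_eq_iff (by omega), mul_comm]
    omega
  rw [this, mul_comm]
  omega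

/-- The domain is cut by containment of vertex sets until the rule on each piece is a fixed vertex,
`none`, or a shifted recursive call. In part (c) the condition on `{f+2, …, d-1}` is tested before
`f + 1 ∈ σ`, so that both members of each pair matched along `f + 1` stay in the same piece. -/
theorem tame_ruleA {d : ℕ} (hd : 2 ≤ d) (n f g : ℕ) :
    Tame (complexA n f g) (ruleA d n f g) (weightA d) := by
  induction n using Nat.strong_induction_on generalizing f g with
  | _ n ih =>
  by_cases h : n ≤ f + g
  · exact .of_none fun σ _ => ruleA_of_le h
  push Not at h
  by_cases hfd : d ≤ f
  · refine (ih (n - d) (by omega) (f - d) g).of_shift d (Finset.Icc 1 d) 1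
      (fun σ hσ => zero_notMem_of_subset_Icc hσ.1) ?_ (fun σ _ => ruleA_of_le_left hd h hfd) ?_
    · intro σ
      rw [shift_mem_complexA_iff (by omega), filter_le_eq_iff (by simp),
        Nat.sub_add_cancel hfd]
      unfold complexA
      simp only [Finset.subset_iff, Finset.mem_Icc, Set.mem_ofPred_eq]
      grind
    · intro σ hσ
      exact weightA_eq_of_Icc_subset hd (zero_notMem_of_subset_Icc hσ.1)
        ((Finset.Icc_subset_Icc_right hfd).trans hσ.2.1)
  push Not at hfd
  by_cases hn : d + g ≤ n
  · apply Tame.of_split_subset (Finset.Icc 1 (d - 1))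
    · apply Tame.of_some d
      · rintro σ ⟨hσ, h1⟩
        rw [ruleA_of_add_le hd h hfd hn, if_pos h1]
      · rintro σ ⟨hσ, h1⟩
        unfold complexA at hσ ⊢
        simp only [Finset.subset_iff, Finset.mem_Icc, Set.mem_ofPred_eq, mem_toggle] at hσ h1 ⊢
        grind
      · rintro σ ⟨hσ, h1⟩ h2
        exact weightA_insert_of_Icc_subset hd (zero_notMem_of_subset_Icc hσ.1) h1 h2
    by_cases hfd' : f = d - 1
    · apply Tame.of_isEmpty
      rintro σ ⟨hσ, h1⟩
      exact h1 (hfd' ▸ hσ.2.1)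
    apply Tame.of_split_subset (Finset.Icc (f + 2) (d - 1))
    · apply Tame.of_split_mem (f + 1)
      -- With `f + 1` and `{f+2, …, d-1}` present, the simplex would contain all of `{1, …, d-1}`.
      · apply Tame.of_isEmpty
        rintro σ ⟨⟨⟨hσ, h1⟩, h2⟩, h3⟩
        apply h1
        unfold complexA at hσ
        simp only [Finset.subset_iff, Finset.mem_Icc, Set.mem_ofPred_eq] at hσ h2 ⊢
        grind
      · refine (ih (n - (f + 1)) (by omega) (d - 2 - f) g).of_shift (f + 1) (Finset.Icc 1 f) 0
          (fun σ hσ => zero_notMem_of_subset_Icc hσ.1) ?_ ?_ ?_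
        · intro σ
          rw [shift_mem_complexA_iff (by omega), filter_le_eq_iff (by simp; omega)]
          unfold complexA
          simp only [Finset.subset_iff, Finset.mem_Icc, Set.mem_ofPred_eq]
          constructor
          · grind
          · rintro ⟨h1, h2, h3, h4⟩
            have h5 : f + 1 ∉ σ := fun h => by simpa using (h1 (f + 1) le_rfl).1 h
            refine ⟨⟨⟨⟨?_, ?_, ?_⟩, fun h => h5 (h (by omega))⟩, ?_⟩, h5⟩ <;> grind
        · rintro σ ⟨⟨⟨hσ, h1⟩, h2⟩, h3⟩
          rw [ruleA_of_add_le hd h hfd hn, if_neg h1, if_neg h3, if_neg (not_not.2 h2),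
            Nat.sub_sub]
        · rintro σ ⟨⟨⟨hσ, h1⟩, h2⟩, h3⟩
          -- The frozen part is a run of `f < d - 1` vertices, of weight zero.
          rw [weightA_eq_of_run hd (zero_notMem_of_subset_Icc hσ.1) hσ.2.1 h3,
            Nat.div_eq_of_lt (by omega), zero_add, add_zero]
    · apply Tame.of_some (f + 1)
      · rintro σ ⟨⟨hσ, h1⟩, h2⟩
        rw [ruleA_of_add_le hd h hfd hn, if_neg h1, if_pos h2, ite_self]
      · rintro σ ⟨⟨hσ, h1⟩, h2⟩
        unfold complexA at hσ ⊢
        simp only [Finset.subset_iff, Finset.mem_Icc, Set.mem_ofPred_eq, mem_toggle] at hσ h1 h2 ⊢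
        grind
      · rintro σ ⟨⟨hσ, h1⟩, h2⟩ h3
        obtain ⟨j, hj, hjσ⟩ := Finset.not_subset.1 h2
        rw [Finset.mem_Icc] at hj
        exact weightA_insert_of_short hd (zero_notMem_of_subset_Icc hσ.1) hσ.2.1 h3
          (by omega) (by omega) hjσ
  push Not at hn
  apply Tame.of_split_subset (Finset.Icc (f + 2) n)
  -- Only the vertex `f + 1` is still free on this piece, so it has at most two members.
  · have key : ∀ σ ∈ {σ | σ ∈ complexA n f g ∧ Finset.Icc (f + 2) n ⊆ σ},
        (σ = Finset.Icc 1 n ∨ σ = (Finset.Icc 1 n).erase (f + 1)) := by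
      rintro σ ⟨hσ, h1⟩
      unfold complexA at hσ
      simp only [Finset.subset_iff, Finset.mem_Icc, Set.mem_ofPred_eq] at hσ h1
      by_cases h2 : f + 1 ∈ σ
      · left; ext i; simp only [Finset.mem_Icc]; grind
      · right; ext i; simp only [Finset.mem_Icc, Finset.mem_erase]; grind
    by_cases hj : ∃ j ∈ Finset.range (f + 2), n + 1 ≡ j [MOD d]
    · apply Tame.of_none
      intro σ hσ
      rw [ruleA_of_lt_add hd h hfd hn, if_pos ⟨hj, key σ hσ⟩]
    · apply Tame.of_some (f + 1)
      · intro σ hσ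
        rw [ruleA_of_lt_add hd h hfd hn, if_neg (fun h => hj h.1)]
      · rintro σ ⟨hσ, h1⟩
        unfold complexA at hσ ⊢
        simp only [Finset.subset_iff, Finset.mem_Icc, Set.mem_ofPred_eq, mem_toggle] at hσ h1 ⊢
        grind
      · intro σ hσ h1
        have hσ' : σ = (Finset.Icc 1 n).erase (f + 1) := by
          rcases key σ hσ with rfl | h
          · simp at h1; omega
          · exact h
        rw [hσ', weightA_Icc_erase_eq hd (by omega) (by omega) hj, Finset.insert_erase]
        simp; omega
  · apply Tame.of_some (f + 1)
    · rintro σ ⟨hσ, h1⟩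
      rw [ruleA_of_lt_add hd h hfd hn, if_neg]
      rintro ⟨-, rfl | rfl⟩ <;> apply h1 <;> intro i hi <;>
        simp only [Finset.mem_Icc, Finset.mem_erase] at hi ⊢ <;> omega
    · rintro σ ⟨hσ, h1⟩
      unfold complexA at hσ ⊢
      simp only [Finset.subset_iff, Finset.mem_Icc, Set.mem_ofPred_eq, mem_toggle] at hσ h1 ⊢
      grind
    · rintro σ ⟨hσ, h1⟩ h3
      obtain ⟨j, hj, hjσ⟩ := Finset.not_subset.1 h1
      rw [Finset.mem_Icc] at hj
      -- The missing vertex satisfies `j ≤ n - g < d`, so the run created by adding `f + 1` is too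
      -- short to carry weight.
      have : ¬ (n - g + 1 ≤ j) := fun h => hjσ (hσ.2.2 (Finset.mem_Icc.2 ⟨h, hj.2⟩))
      exact weightA_insert_of_short hd (zero_notMem_of_subset_Icc hσ.1) hσ.2.1 h3
        (by omega) (by omega) hjσ

/-! ### The critical simplices of the matching on `K^A_{n,f,0}` -/

/-- An unmatched simplex survives the recursion `(n, f) ↦ (n - f - 1, d - 2 - f)`. It turns `n = md
+ f` into `n' + 1 = md`, and `n + 1 = md` into `n' = (m-1)d + f'`. Each step discards `f` vertices
and no weight, and `f + f' = d - 2` produces the term `m(d - 2)`. -/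
theorem card_eq_of_ruleA_eq_none {d : ℕ} (hd : 2 ≤ d) {n f : ℕ} {σ : Finset ℕ} (hf : f < d)
    (hσ : σ ∈ complexA n f 0) (h : ruleA d n f 0 σ = none) :
    (∃ m, n = m * d + f ∧ f + 1 < d ∧ σ.card = weightA d σ + m * (d - 2) + f) ∨
      ∃ m, n + 1 = m * d ∧ σ.card = weightA d σ + m * (d - 2) := by
  induction n using Nat.strong_induction_on generalizing f σ with
  | _ n ih =>
  have h0 : 0 ∉ σ := zero_notMem_of_subset_Icc hσ.1
  have hfn : f ≤ n := by
    by_contra hlt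
    have := Finset.mem_Icc.1 (hσ.1 (hσ.2.1 (Finset.mem_Icc.2 (show 1 ≤ f ∧ f ≤ f by omega))))
    omega
  by_cases hnf : n = f
  · subst hnf
    obtain rfl : σ = Finset.Icc 1 n := Finset.Subset.antisymm hσ.1 hσ.2.1
    rw [weightA_Icc hd, Nat.card_Icc]
    by_cases hfd : n + 1 = d
    · right
      refine ⟨1, by omega, ?_⟩
      rw [hfd, Nat.div_self (by omega)]
      omega
    · left
      refine ⟨0, by omega, by omega, ?_⟩
      rw [Nat.div_eq_of_lt (by omega)]
      omega
  by_cases hn : d + 0 ≤ n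
  · rw [ruleA_of_add_le hd (by omega) hf hn] at h
    split_ifs at h with h1 h2 h3
    have hfd : f + 1 ≠ d := by
      rintro rfl
      exact h1 hσ.2.1
    have hmem : shift (f + 1) σ ∈ complexA (n - (f + 1)) (d - 2 - f) 0 := by
      rw [shift_mem_complexA_iff (by omega)]
      refine ⟨fun i hi => (Finset.mem_Icc.1 (hσ.1 hi)).2, ?_, by simp⟩
      convert h3 using 2 <;> omega
    have hfil : (σ.filter (· ≤ f + 1)) = Finset.Icc 1 f := by
      rw [filter_le_eq_iff (by simp; omega)]
      have hσ2 := hσ.2.1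
      simp only [Finset.subset_iff, Finset.mem_Icc] at hσ2 ⊢
      grind
    have hw : weightA d σ = weightA d (shift (f + 1) σ) := by
      rw [weightA_eq_of_run hd h0 hσ.2.1 h2, Nat.div_eq_of_lt (by omega), zero_add]
    have hc := card_eq_card_shift_add (f + 1) σ
    rw [hfil, Nat.card_Icc] at hc
    rw [Option.map_eq_none_iff, Nat.sub_sub] at h
    rcases ih _ (by omega) (by omega) hmem h with ⟨m, hm, _, hcard⟩ | ⟨m, hm, hcard⟩
    · right
      refine ⟨m + 1, ?_, ?_⟩
      · rw [add_mul]; omega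
      · rw [add_mul]; omega
    · left
      exact ⟨m, by omega, by omega, by omega⟩
  · rw [ruleA_of_lt_add hd (by omega) hf (by omega)] at h
    split_ifs at h with h1
    obtain ⟨⟨j, hj, hmod⟩, h2⟩ := h1
    rw [Finset.mem_range] at hj
    -- Otherwise `n + 1` and `j` are both below `d`, so the congruence is an equality, contradicting
    -- `j ≤ f + 1 ≤ n`.
    have hn1 : n + 1 = d := by
      by_contra hne
      have hlt : n + 1 < d := by omega
      have hjd : j < d := by omega
      have := Nat.ModEq.eq_of_lt_of_lt hmod hlt hjd
      omega
    right
    refine ⟨1, by omega, ?_⟩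
    rcases h2 with rfl | rfl
    · rw [weightA_Icc hd, Nat.card_Icc, hn1, Nat.div_self (by omega)]
      omega
    · rw [weightA_Icc_erase hd (by omega), Finset.card_erase_of_mem (by simp; omega), Nat.card_Icc,
        Nat.div_eq_of_lt (by omega), Nat.div_eq_of_lt (by omega)]
      omega

theorem eq_of_shift_eq {m : ℕ} {P σ σ' : Finset ℕ} (h : ∀ i ≤ m, i ∈ σ ↔ i ∈ P)
    (h' : ∀ i ≤ m, i ∈ σ' ↔ i ∈ P) (hs : shift m σ = shift m σ') : σ = σ' := by
  ext i
  by_cases hi : i ≤ m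
  · rw [h i hi, h' i hi]
  · have := Finset.ext_iff.1 hs (i - m)
    rw [mem_shift, mem_shift, Nat.sub_add_cancel (by omega)] at this
    have h1 : 1 ≤ i - m := by omega
    simpa [h1] using this

/-- With the part up to `m` frozen, `shift m` is a bijection on sets of positive labels, so "exactly
two" passes from the recursive call to the original problem. -/
theorem exists_two_of_shift {m : ℕ} {P : Finset ℕ} (hP : P ⊆ Finset.Icc 1 m)
    {p p' : Finset ℕ → Prop} (h : ∃ τ₁ τ₂, τ₁ ≠ τ₂ ∧ ∀ τ, p' τ ↔ τ = τ₁ ∨ τ = τ₂)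
    (h0 : ∀ τ, p' τ → 0 ∉ τ)
    (hp : ∀ σ, p σ ↔ (∀ i ≤ m, i ∈ σ ↔ i ∈ P) ∧ p' (shift m σ)) :
    ∃ σ₁ σ₂, σ₁ ≠ σ₂ ∧ ∀ σ, p σ ↔ σ = σ₁ ∨ σ = σ₂ := by
  obtain ⟨τ₁, τ₂, hne, hτ⟩ := h
  have hlift : ∀ τ, p' τ → ∃ σ : Finset ℕ, (∀ i ≤ m, i ∈ σ ↔ i ∈ P) ∧ shift m σ = τ := by
    intro τ h
    obtain ⟨σ, _, h1, h2⟩ := exists_shift_eq m hP (h0 τ h)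
    exact ⟨σ, (filter_le_eq_iff fun i hi => (Finset.mem_Icc.1 (hP hi)).2).1 h1, h2⟩
  obtain ⟨σ₁, h11, h12⟩ := hlift τ₁ ((hτ _).2 (Or.inl rfl))
  obtain ⟨σ₂, h21, h22⟩ := hlift τ₂ ((hτ _).2 (Or.inr rfl))
  refine ⟨σ₁, σ₂, ?_, fun σ => ?_⟩
  · rintro rfl
    exact hne (h12.symm.trans h22)
  · rw [hp, hτ]
    constructor
    · rintro ⟨h1, h2 | h2⟩
      · exact Or.inl (eq_of_shift_eq h1 h11 (h2.trans h12.symm))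
      · exact Or.inr (eq_of_shift_eq h1 h21 (h2.trans h22.symm))
    · rintro (rfl | rfl)
      · exact ⟨h11, Or.inl h12⟩
      · exact ⟨h21, Or.inr h22⟩

/-- The recursion alternates between the two congruences until `n < d`. Then `n + 1 = d`, and the
two unmatched simplices are the full one and the one without `f + 1`. -/
theorem exists_two_ruleA_eq_none {d : ℕ} (hd : 2 ≤ d) {n f : ℕ} (hf : f + 1 < d) (hfn : f < n)
    (hn : (∃ m, n = m * d + f) ∨ ∃ m, n + 1 = m * d) :
    ∃ σ₁ σ₂, σ₁ ≠ σ₂ ∧ ∀ σ, σ ∈ complexA n f 0 ∧ ruleA d n f 0 σ = none ↔ σ = σ₁ ∨ σ = σ₂ := by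
  induction n using Nat.strong_induction_on generalizing f with
  | _ n ih =>
  by_cases hnd : n < d
  · refine ⟨Finset.Icc 1 n, (Finset.Icc 1 n).erase (f + 1), ?_, fun σ => ?_⟩
    · intro h
      have : f + 1 ∈ Finset.Icc 1 n := Finset.mem_Icc.2 (by omega)
      rw [h] at this
      simp at this
    have hdvd : ∃ j ∈ Finset.range (f + 2), n + 1 ≡ j [MOD d] := by
      -- Of the admissible residues of `n + 1` only `0` occurs here: `n = md + f` is impossible for
      -- `f < n < d`.
      refine ⟨0, by simp, ?_⟩
      rw [Nat.modEq_zero_iff_dvd]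
      rcases hn with ⟨m, hm⟩ | ⟨m, hm⟩
      · rcases Nat.eq_zero_or_pos m with rfl | hm0
        · omega
        · have := Nat.le_mul_of_pos_left d hm0
          omega
      · exact ⟨m, by rw [hm, mul_comm]⟩
    rw [ruleA_of_lt_add hd (by omega) (by omega) (by omega)]
    constructor
    · rintro ⟨hσ, h⟩
      split_ifs at h with h1
      exact h1.2
    · intro h
      rw [if_pos ⟨hdvd, h⟩]
      refine ⟨?_, rfl⟩
      unfold complexA
      simp only [Finset.subset_iff, Set.mem_ofPred_eq]
      rcases h with rfl | rfl <;> simp only [Finset.mem_Icc, Finset.mem_erase] <;> grind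
  · obtain ⟨τ₁, τ₂, hne, hτ⟩ := ih (n - (f + 1)) (by omega) (f := d - 2 - f) (by omega)
      (by
        rcases hn with ⟨m, hm⟩ | ⟨m, hm⟩
        · omega
        · by_contra hlt
          have hm1 : m < 2 := by
            by_contra h2
            have := Nat.mul_le_mul_right d (show 2 ≤ m by omega)
            omega
          interval_cases m <;> omega) (by
      rcases hn with ⟨m, hm⟩ | ⟨m, hm⟩
      · exact Or.inr ⟨m, by omega⟩
      · rcases Nat.exists_eq_succ_of_ne_zero (show m ≠ 0 by rintro rfl; omega) with ⟨k, rfl⟩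
        rw [Nat.succ_mul] at hm
        exact Or.inl ⟨k, by omega⟩)
    have key : ∀ σ, (σ ∈ complexA n f 0 ∧ ruleA d n f 0 σ = none) ↔
        (∀ i ≤ f + 1, i ∈ σ ↔ i ∈ Finset.Icc 1 f) ∧ (shift (f + 1) σ ∈
          complexA (n - (f + 1)) (d - 2 - f) 0 ∧
          ruleA d (n - (f + 1)) (d - 2 - f) 0 (shift (f + 1) σ) = none) := by
      intro σ
      rw [ruleA_of_add_le hd (by omega) (by omega) (by omega), shift_mem_complexA_iff (by omega),
        Nat.sub_sub, show d - 2 - f + (f + 1) = d - 1 by omega,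
        show 1 + (f + 1) = f + 2 by omega]
      unfold complexA
      constructor
      · rintro ⟨⟨h1, h2, h3⟩, h4⟩
        split_ifs at h4 with g1 g2 g3
        rw [Option.map_eq_none_iff] at h4
        refine ⟨?_, ⟨fun i hi => (Finset.mem_Icc.1 (h1 hi)).2, g3, h3⟩, h4⟩
        simp only [Finset.subset_iff, Finset.mem_Icc] at h1 h2 ⊢
        grind
      · rintro ⟨h1, ⟨h2, h3, h4⟩, h5⟩
        have g2 : f + 1 ∉ σ := fun h => by simpa using (h1 _ le_rfl).1 h
        have g1 : ¬ Finset.Icc 1 (d - 1) ⊆ σ := fun h => g2 (h (Finset.mem_Icc.2 (by omega)))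
        rw [if_neg g1, if_neg g2, if_neg (not_not.2 h3), h5]
        simp only [Finset.subset_iff, Finset.mem_Icc, Set.mem_ofPred_eq] at *
        refine ⟨⟨?_, ?_, ?_⟩, rfl⟩ <;> grind
    exact exists_two_of_shift (Finset.Icc_subset_Icc_right (by omega)) ⟨τ₁, τ₂, hne, hτ⟩
      (fun τ h => zero_notMem_of_subset_Icc h.1.1) key

/-- As soon as the vertex `d` exists, it matches everything that contains `{1, …, d-1}`. For `d = 4`
this restricts the critical simplices of part (f) to `n = 4`. -/
theorem eq_of_ruleA_eq_none_of_pred {d : ℕ} (hd : 2 ≤ d) {n : ℕ} {σ : Finset ℕ}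
    (hσ : σ ∈ complexA n (d - 1) 0) (h : ruleA d n (d - 1) 0 σ = none) : n ≤ d - 1 := by
  by_contra hlt
  rw [ruleA_of_add_le hd (by omega) (by omega) (by omega), if_pos hσ.2.1] at h
  cases h

theorem exists_ruleA_eq_none {d : ℕ} (hd : 2 ≤ d) {n f : ℕ} (hf : f + 1 < d) (hfn : f ≤ n)
    (hn : (∃ m, n = m * d + f) ∨ ∃ m, n + 1 = m * d) :
    ∃ σ ∈ complexA n f 0, ruleA d n f 0 σ = none := by
  rcases hfn.eq_or_lt with rfl | hfn
  · exact ⟨Finset.Icc 1 f, ⟨le_rfl, le_rfl, by simp⟩, ruleA_of_le (by omega)⟩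
  · obtain ⟨σ, _, _, h⟩ := exists_two_ruleA_eq_none hd hf hfn hn
    exact ⟨σ, (h σ).2 (Or.inl rfl)⟩

/-! ### The weight of type `D` -/

/-- The relabeling of the vertices `1, 3, 4, …` as `1, 2, 3, …`. -/
def relabel (σ : Finset ℕ) : Finset ℕ := σ.image fun i => if i = 1 then 1 else i - 1

theorem mem_relabel {σ : Finset ℕ} (h0 : 0 ∉ σ) (h2 : 2 ∉ σ) {i : ℕ} :
    i ∈ relabel σ ↔ (i = 1 ∧ 1 ∈ σ) ∨ (2 ≤ i ∧ i + 1 ∈ σ) := by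
  simp only [relabel, Finset.mem_image]
  constructor
  · rintro ⟨j, hj, rfl⟩
    have h0' : j ≠ 0 := fun h => h0 (h ▸ hj)
    have h2' : j ≠ 2 := fun h => h2 (h ▸ hj)
    split_ifs with h1
    · subst h1; exact Or.inl ⟨rfl, hj⟩
    · exact Or.inr ⟨by omega, by rwa [Nat.sub_add_cancel (by omega)]⟩
  · rintro (⟨rfl, h⟩ | ⟨h, h'⟩)
    · exact ⟨1, h, by simp⟩
    · exact ⟨i + 1, h', by simp; omega⟩

theorem relabel_mono {σ τ : Finset ℕ} (h : σ ⊆ τ) : relabel σ ⊆ relabel τ :=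
  Finset.image_subset_image h

theorem card_relabel {σ : Finset ℕ} (h0 : 0 ∉ σ) (h2 : 2 ∉ σ) :
    (relabel σ).card = σ.card := by
  apply Finset.card_image_of_injOn
  intro a ha b hb hab
  have h1 : a ≠ 0 := fun h => h0 (h ▸ ha)
  have h3 : a ≠ 2 := fun h => h2 (h ▸ ha)
  have h4 : b ≠ 0 := fun h => h0 (h ▸ hb)
  have h5 : b ≠ 2 := fun h => h2 (h ▸ hb)
  dsimp only at hab
  split_ifs at hab <;> omega

theorem shift_relabel {σ : Finset ℕ} (h0 : 0 ∉ σ) (h2 : 2 ∉ σ) {m : ℕ} (hm : 1 ≤ m) :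
    shift m (relabel σ) = shift (m + 1) σ := by
  ext i
  simp only [mem_shift, mem_relabel h0 h2]
  grind

theorem exists_relabel_eq {τ : Finset ℕ} (h : 0 ∉ τ) :
    ∃ σ : Finset ℕ, 0 ∉ σ ∧ 2 ∉ σ ∧ relabel σ = τ := by
  have h' : ∀ i ∈ τ, 1 ≤ i := fun i hi => Nat.one_le_iff_ne_zero.2 fun h0 => h (h0 ▸ hi)
  have h0 : 0 ∉ τ.image (fun i => if i = 1 then 1 else i + 1) := by
    simp only [Finset.mem_image]; grind
  have h2 : 2 ∉ τ.image (fun i => if i = 1 then 1 else i + 1) := by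
    simp only [Finset.mem_image]; grind
  refine ⟨_, h0, h2, ?_⟩
  ext i
  rw [mem_relabel h0 h2]
  simp only [Finset.mem_image]
  grind

/-- The multiplicity of `φ_d` in the Poincaré polynomial of type `D_k`. -/
def weightDComp (d k : ℕ) : ℕ :=
  ((Finset.Icc 1 (k - 1)).filter fun i => d ∣ 2 * i).card + if d ∣ k then 1 else 0

/-- The properties of the weight function of type `D_n` on which the proof depends. -/
structure IsWeightD (n d : ℕ) (w : Finset ℕ → ℕ) : Prop where
  eq_shift : ∀ σ ⊆ Finset.Icc 1 n, 1 ∉ σ → w σ = weightA d (shift 1 σ)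
  eq_relabel : ∀ σ ⊆ Finset.Icc 1 n, 2 ∉ σ → w σ = weightA d (relabel σ)
  eq_add : ∀ σ ⊆ Finset.Icc 1 n, ∀ k, 2 ≤ k → Finset.Icc 1 k ⊆ σ → k + 1 ∉ σ →
    w σ = weightDComp d k + weightA d (shift (k + 1) σ)

theorem card_filter_dvd_Icc (d k : ℕ) : ((Finset.Icc 1 k).filter fun i => d ∣ i).card = k / d := by
  rw [← Nat.Ioc_filter_dvd_card_eq_div]
  rfl

/-- The degrees of `D_k` are `2, 4, …, 2(k-1)` and `k`. For odd `d` the factor `2` is irrelevant, so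
the multiples of `d` in `{1, …, k}` are counted. -/
theorem weightDComp_of_odd {d k : ℕ} (hd : Odd d) (hk : 1 ≤ k) : weightDComp d k = k / d := by
  have h : ∀ i, d ∣ 2 * i ↔ d ∣ i := fun i =>
    (Nat.coprime_two_right.2 hd).dvd_mul_left
  obtain ⟨k, rfl⟩ : ∃ l, k = l + 1 := ⟨k - 1, by omega⟩
  simp only [weightDComp, h]
  rw [card_filter_dvd_Icc, Nat.add_sub_cancel, Nat.succ_div]

theorem weightDComp_two_mul {h k : ℕ} :
    weightDComp (2 * h) k = (k - 1) / h + if 2 * h ∣ k then 1 else 0 := by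
  have h' : ∀ i, 2 * h ∣ 2 * i ↔ h ∣ i := fun i => Nat.mul_dvd_mul_iff_left (by norm_num)
  simp only [weightDComp, h']
  rw [card_filter_dvd_Icc]

/-! ### The matching on `K^D_n` for odd `d` -/

/-- Adding the vertex `2` turns a component of type `A_{k-1}` into one of type `D_k`; for odd `d`
both have weight `⌊k/d⌋`. -/
theorem weightD_insert_two {n d : ℕ} (hd : 2 ≤ d) (hodd : Odd d) {w : Finset ℕ → ℕ}
    (hw : IsWeightD n d w) (hn : 2 ≤ n) {σ : Finset ℕ} (hσ : σ ⊆ Finset.Icc 1 n) (h1 : 1 ∈ σ)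
    (h2 : 2 ∉ σ) : w (insert 2 σ) = w σ := by
  have h0 := zero_notMem_of_subset_Icc hσ
  obtain ⟨k, hk, hk1, hk2⟩ := exists_run (σ := insert 2 σ) 2 (by
    intro i hi
    rw [Finset.mem_Icc] at hi
    have : i = 1 ∨ i = 2 := by omega
    rcases this with rfl | rfl <;> simp [h1])
  rw [hw.eq_add _ (Finset.insert_subset (Finset.mem_Icc.2 (by omega)) hσ) k hk hk1 hk2,
    hw.eq_relabel σ hσ h2, weightDComp_of_odd hodd (by omega),
    weightA_eq_of_run (σ := relabel σ) (k := k - 1) hd, Nat.sub_add_cancel (by omega),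
    shift_relabel h0 h2 (by omega), shift_insert_of_le (by omega)]
  · simp [mem_relabel h0 h2]
  · intro i hi
    rw [Finset.mem_Icc] at hi
    rw [mem_relabel h0 h2]
    by_cases hi1 : i = 1
    · exact Or.inl ⟨hi1, h1⟩
    · have := hk1 (Finset.mem_Icc.2 (show 1 ≤ i + 1 ∧ i + 1 ≤ k by omega))
      rw [Finset.mem_insert] at this
      exact Or.inr ⟨by omega, by rcases this with h | h; omega; exact h⟩
  · rw [Nat.sub_add_cancel (by omega), mem_relabel h0 h2]
    rw [Finset.mem_insert] at hk2
    grind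

theorem tame_ruleDOdd {n d : ℕ} (hd : 2 ≤ d) (hodd : Odd d) (hn : 4 ≤ n) {w : Finset ℕ → ℕ}
    (hw : IsWeightD n d w) : Tame (complexA n 0 0) (ruleDOdd d n) w := by
  apply Tame.of_split_mem 1
  · apply Tame.of_some 2
    · rintro σ ⟨hσ, h1⟩
      rw [ruleDOdd, if_pos h1]
    · rintro σ ⟨hσ, h1⟩
      unfold complexA at hσ ⊢
      simp only [Finset.subset_iff, Finset.mem_Icc, Set.mem_ofPred_eq, mem_toggle] at hσ h1 ⊢
      grind
    · rintro σ ⟨hσ, h1⟩ h2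
      exact weightD_insert_two hd hodd hw (by omega) hσ.1 h1 h2
  · refine (tame_ruleA hd (n - 1) 0 0).of_shift 1 ∅ 0
      (fun σ hσ => zero_notMem_of_subset_Icc hσ.1) ?_ ?_ ?_
    · intro σ
      rw [shift_mem_complexA_iff (by omega), filter_le_eq_iff (by simp)]
      unfold complexA
      simp only [Finset.subset_iff, Finset.mem_Icc, Set.mem_ofPred_eq]
      constructor
      · rintro ⟨⟨h1, h2, h3⟩, h4⟩
        refine ⟨?_, ?_, ?_, h3⟩ <;> grind
      · rintro ⟨h1, h2, h3, h4⟩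
        refine ⟨⟨?_, ?_, ?_⟩, ?_⟩ <;> grind
    · rintro σ ⟨hσ, h1⟩
      rw [ruleDOdd, if_neg h1]
    · rintro σ ⟨hσ, h1⟩
      rw [hw.eq_shift σ hσ.1 h1, add_zero]

/-! ### The decomposition of the size of the component of the vertex `1` -/

theorem le_componentSize_iff {n k : ℕ} {σ : Finset ℕ} (hσ : σ ⊆ Finset.Icc 1 n) :
    k ≤ componentSize n σ ↔ Finset.Icc 1 k ⊆ σ := by
  have hspec : Finset.Icc 1 (componentSize n σ) ⊆ σ :=
    Nat.findGreatest_spec (P := fun k => Finset.Icc 1 k ⊆ σ) (Nat.zero_le n) (by simp)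
  constructor
  · exact fun h => (Finset.Icc_subset_Icc_right h).trans hspec
  · intro h
    rcases Nat.eq_zero_or_pos k with rfl | hk
    · exact Nat.zero_le _
    · refine Nat.le_findGreatest ?_ h
      exact (Finset.mem_Icc.1 (hσ (h (Finset.mem_Icc.2 ⟨hk, le_rfl⟩)))).2

/-- The convention for multiples of `h` makes the ranges of `k` closed intervals `[qh, (q+1)h]` for
even `q` and open ones for odd `q`; together these partition the natural numbers. -/
theorem quotD_eq_of_even {h k q : ℕ} (hh : 1 ≤ h) (hq : Even q) (h1 : q * h ≤ k)
    (h2 : k ≤ (q + 1) * h) : quotD h k = q := by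
  unfold quotD
  rcases h2.eq_or_lt with rfl | h2
  · rw [Nat.mul_div_cancel _ (by omega), if_pos ⟨Dvd.intro_left _ rfl, hq.add_one⟩]
    simp
  · have : k / h = q := Nat.div_eq_of_lt_le h1 h2
    rw [this, if_neg]
    exact fun h => (Nat.not_odd_iff_even.2 hq) h.2

theorem quotD_eq_of_odd {h k q : ℕ} (h1 : q * h + 1 ≤ k)
    (h2 : k < (q + 1) * h) : quotD h k = q := by
  unfold quotD
  have : k / h = q := Nat.div_eq_of_lt_le (by omega) h2
  rw [this, if_neg]
  rintro ⟨⟨c, rfl⟩, -⟩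
  have hh : 0 < h := by
    rcases Nat.eq_zero_or_pos h with rfl | h0
    · simp at h1
    · exact h0
  rw [Nat.mul_div_cancel_left _ hh] at this
  subst this
  rw [mul_comm] at h1
  omega

theorem quotD_spec {h k : ℕ} (hh : 1 ≤ h) :
    quotD h k * h ≤ k ∧ k ≤ (quotD h k + 1) * h := by
  have h1 := Nat.div_add_mod k h
  have h2 := Nat.mod_lt k (show h > 0 by omega)
  unfold quotD at *
  split_ifs at * with hc
  · have h3 : 1 ≤ k / h := hc.2.pos
    rw [Nat.sub_add_cancel h3, Nat.div_mul_cancel hc.1]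
    exact ⟨by rw [Nat.sub_mul, Nat.div_mul_cancel hc.1]; omega, le_rfl⟩
  · rw [add_mul, mul_comm]
    omega

theorem quotD_spec_odd {h k : ℕ} (hh : 1 ≤ h) (hq : Odd (quotD h k)) :
    quotD h k * h + 1 ≤ k ∧ k < (quotD h k + 1) * h := by
  have h1 := Nat.div_add_mod k h
  have h2 := Nat.mod_lt k (show h > 0 by omega)
  unfold quotD at *
  split_ifs at * with hc
  · exfalso
    have h3 : 1 ≤ k / h := hc.2.pos
    have := hc.2
    rw [Nat.odd_iff] at hq this
    omega
  · rw [add_mul, mul_comm (k / h)]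
    have : k % h ≠ 0 := fun h0 => hc ⟨Nat.dvd_of_mod_eq_zero h0, hq⟩
    omega

/-- Monotonicity is what allows part (g) to be decomposed along `q` by `Tame.of_fiber`. -/
theorem quotD_mono {h k k' : ℕ} (hk : k ≤ k') : quotD h k ≤ quotD h k' := by
  have h1 : k / h ≤ k' / h := Nat.div_le_div_right hk
  unfold quotD
  split_ifs with h2 h3 h3
  · exact Nat.sub_le_sub_right h1 1
  · exact (Nat.sub_le _ _).trans h1
  -- Only the larger argument is corrected by `-1`. With equal quotients, `k'` would be the multiple
  -- of `h` below `k`, hence `k = k'`, and both would be corrected.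
  · rcases h1.eq_or_lt with h4 | h4
    · exfalso
      have h5 := Nat.div_mul_cancel h3.1
      have h6 := Nat.div_mul_le_self k h
      rw [h4, h5] at h6
      obtain rfl : k = k' := by omega
      exact h2 h3
    · exact Nat.le_sub_one_of_lt h4
  · exact h1

/-! ### The parts of the rule for even `d` -/

section parts

variable {d n g : ℕ} {σ : Finset ℕ}

theorem partD_eq_a (h : 2 ∉ σ) : partD d n σ = .a := by
  simp [partD, h]

theorem partD_eq_b (hd : d = 2) (h2 : 2 ∈ σ) (h : ¬ Finset.Icc 1 4 ⊆ σ) : partD d n σ = .b := by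
  simp [partD, h, hd, h2]

theorem partD_eq_c (hd : 4 ≤ d) (h2 : 2 ∈ σ) (h : 3 ∉ σ) : partD d n σ = .c := by
  simp [partD, h, hd, h2, show d ≠ 2 by omega]

theorem partD_eq_d (hd : d = 4) (h2 : 2 ∈ σ) (h3 : 3 ∈ σ) (h : 4 ∉ σ) : partD d n σ = .d := by
  simp [partD, h, hd, h2, h3]

theorem partD_eq_e (hd : 6 ≤ d) (h2 : 2 ∈ σ) (h3 : 3 ∈ σ) (h : 4 ∉ σ) : partD d n σ = .e := by
  simp [partD, h, hd, h2, h3, show d ≠ 2 by omega, show d ≠ 4 by omega]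

theorem partD_eq_f (hd : 4 ≤ d) (h2 : 2 ∈ σ) (h3 : 3 ∈ σ) (h4 : 4 ∈ σ) (h : 1 ∉ σ) :
    partD d n σ = .f := by
  simp [partD, h, hd, h2, h3, h4, show d ≠ 2 by omega]

/-- The part (g) of the definition. -/
theorem partD_of_Icc_subset (h : Finset.Icc 1 4 ⊆ σ) :
    partD d n σ =
      if vertexD (d / 2) (componentSize n σ) ∈ σ then .g1
      else if n < vertexD (d / 2) (componentSize n σ) then .g21
      else if Even (quotD (d / 2) (componentSize n σ)) ∧
        Finset.Icc (quotD (d / 2) (componentSize n σ) * (d / 2) + 2)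
          ((quotD (d / 2) (componentSize n σ) + 1) * (d / 2) + 1) ⊆ σ then .g22
      else if Odd (quotD (d / 2) (componentSize n σ)) ∧
        Finset.Icc (quotD (d / 2) (componentSize n σ) * (d / 2) + 3)
          ((quotD (d / 2) (componentSize n σ) + 1) * (d / 2)) ⊆ σ then .g23
      else .g2 := by
  have h1 : 1 ∈ σ := h (by simp)
  have h2 : 2 ∈ σ := h (by simp)
  have h3 : 3 ∈ σ := h (by simp)
  have h4 : 4 ∈ σ := h (by simp)
  simp only [partD, h, h1, h2, h3, h4, not_true, and_false, if_false]

theorem ruleDEven_of_a (h : partD d n σ = .a) : ruleDEven d n g σ =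
    (ruleA d (n - 1) 0 g (relabel σ)).map fun i => if i = 1 then 1 else i + 1 := by
  simp only [ruleDEven, h]; rfl

theorem ruleDEven_of_b (h : partD d n σ = .b) : ruleDEven d n g σ =
    if {1, 2, 4} ⊆ σ then (if 5 ≤ n - g then some 5 else none)
    else (if 3 ≤ n - g then some 3 else none) := by
  simp only [ruleDEven, h]

theorem ruleDEven_of_c (h : partD d n σ = .c) : ruleDEven d n g σ = some 1 := by
  simp only [ruleDEven, h]

theorem ruleDEven_of_d (h : partD d n σ = .d) : ruleDEven d n g σ =
    (ruleA d (n - 4) 0 g (shift 4 σ)).map (· + 4) := by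
  simp only [ruleDEven, h]

theorem ruleDEven_of_e (h : partD d n σ = .e) : ruleDEven d n g σ = some 1 := by
  simp only [ruleDEven, h]

theorem ruleDEven_of_f (h : partD d n σ = .f) : ruleDEven d n g σ =
    if Finset.Icc 2 (d / 2 + 1) ⊆ σ then
      (ruleA d (n - 1) (max (d / 2) 3) g (shift 1 σ)).map (· + 1)
    else some 1 := by
  simp only [ruleDEven, h]

theorem ruleDEven_of_g1 (h : partD d n σ = .g1) : ruleDEven d n g σ =
    if vertexD (d / 2) (componentSize n σ) ≤ n - g
    then some (vertexD (d / 2) (componentSize n σ)) else none := by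
  simp only [ruleDEven, h]

theorem ruleDEven_of_g2 (h : partD d n σ = .g2) : ruleDEven d n g σ =
    some (vertexD (d / 2) (componentSize n σ)) := by
  simp only [ruleDEven, h]

theorem ruleDEven_of_g21 (h : partD d n σ = .g21) : ruleDEven d n g σ = none := by
  simp only [ruleDEven, h]

theorem ruleDEven_of_g22 (h : partD d n σ = .g22) {q : ℕ}
    (hq : quotD (d / 2) (componentSize n σ) = q) : ruleDEven d n g σ =
    (ruleA d (n - (q * (d / 2) + 1)) (d / 2) g (shift (q * (d / 2) + 1) σ)).map
      (· + (q * (d / 2) + 1)) := by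
  subst hq
  simp only [ruleDEven, h, Nat.sub_sub]

theorem ruleDEven_of_g23 (h : partD d n σ = .g23) {q : ℕ}
    (hq : quotD (d / 2) (componentSize n σ) = q) : ruleDEven d n g σ =
    (ruleA d (n - (q * (d / 2) + 2)) (d / 2 - 2) g (shift (q * (d / 2) + 2) σ)).map
      (· + (q * (d / 2) + 2)) := by
  subst hq
  simp only [ruleDEven, h, Nat.sub_sub]

end parts

/-! ### Insertions that preserve the weight for even `d`. -/

section weights

variable {n h : ℕ} {w : Finset ℕ → ℕ} {σ : Finset ℕ}

/-- If `σ ∪ {1}` does not contain `{1, …, h + 1}`, then the vertex `1` does not contribute to the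
weight. -/
theorem weightD_insert_one (hw : IsWeightD n (2 * h) w) (hn : 2 ≤ n)
    (hσ : σ ⊆ Finset.Icc 1 n) (h1 : 1 ∉ σ) (h2 : 2 ∈ σ) {j : ℕ} (hj : 3 ≤ j) (hjh : j ≤ h + 1)
    (hjσ : j ∉ σ) : w (insert 1 σ) = w σ := by
  obtain ⟨k, hk, hk1, hk2⟩ := exists_run (σ := insert 1 σ) 2 (by
    intro i hi
    rw [Finset.mem_Icc] at hi
    have : i = 1 ∨ i = 2 := by omega
    rcases this with rfl | rfl <;> simp [h2])
  rw [Finset.mem_insert, not_or] at hk2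
  have hkj : k + 1 ≤ j := by
    by_contra hlt
    have := hk1 (Finset.mem_Icc.2 (show 1 ≤ j ∧ j ≤ k by omega))
    rw [Finset.mem_insert] at this
    rcases this with h | h
    · omega
    · exact hjσ h
  rw [hw.eq_add _ (Finset.insert_subset (Finset.mem_Icc.2 (by omega)) hσ) k hk hk1
      (by simp only [Finset.mem_insert, not_or]; exact hk2),
    hw.eq_shift σ hσ h1, weightDComp_two_mul, shift_insert_of_le (by omega),
    weightA_eq_of_run (σ := shift 1 σ) (k := k - 1) (by omega) (zero_notMem_shift 1 σ),
    Nat.sub_add_cancel (by omega), shift_shift, add_comm 1 k, Nat.div_eq_of_lt (by omega),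
    Nat.div_eq_of_lt (by omega), if_neg]
  · exact fun hdvd => by have := Nat.le_of_dvd (by omega) hdvd; omega
  · rw [Icc_subset_shift le_rfl, Nat.sub_add_cancel (by omega)]
    intro i hi
    rw [Finset.mem_Icc] at hi
    have := hk1 (Finset.mem_Icc.2 (show 1 ≤ i ∧ i ≤ k by omega))
    rw [Finset.mem_insert] at this
    rcases this with h | h
    · omega
    · exact h
  · rw [mem_shift, Nat.sub_add_cancel (by omega)]
    exact fun h => hk2.2 h.2

/-- For `0 < r ≤ h` the quotient of `k - 1` by `h` is `q`, and `2h ∤ k`. For `r = 0` the quotient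
drops to `q - 1`, but the degree `k`, now a multiple of `2h`, makes up for it. So the weight is
constant on the closed range of an even `q`. -/
theorem weightDComp_even {q r : ℕ} (hh : 1 ≤ h) (hq : Even q) (hq0 : 1 ≤ q) (hr : r ≤ h) :
    weightDComp (2 * h) (q * h + r) = q := by
  rw [weightDComp_two_mul]
  obtain ⟨c, rfl⟩ := even_iff_two_dvd.1 hq
  rcases Nat.eq_zero_or_pos r with rfl | hr0
  · have : 2 * c * h = 2 * h * c := by ring
    rw [add_zero, if_pos (this ▸ Nat.dvd_mul_right _ _)]
    have h1 : (2 * c * h - 1) / h = 2 * c - 1 := by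
      apply Nat.div_eq_of_lt_le
      · rw [Nat.sub_mul]; omega
      · rw [Nat.sub_add_cancel hq0]
        have := Nat.le_mul_of_pos_left h hq0
        omega
    omega
  · rw [if_neg]
    · apply Nat.div_eq_of_lt_le
      · omega
      · rw [add_mul]; omega
    · intro hdvd
      have h1 : 2 * h ∣ 2 * c * h := ⟨c, by ring⟩
      have := Nat.le_of_dvd hr0 ((Nat.dvd_add_right h1).1 hdvd)
      omega

/-- For odd `q` an endpoint `k = qh` would lose the extra degree, since `2h ∤ qh`; this is why `r =
0` and `r = h` are excluded here. -/
theorem weightDComp_odd {q r : ℕ} (hr0 : 1 ≤ r) (hr : r < h) :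
    weightDComp (2 * h) (q * h + r) = q := by
  rw [weightDComp_two_mul, if_neg]
  · apply Nat.div_eq_of_lt_le
    · omega
    · rw [add_mul]; omega
  · intro hdvd
    have h1 : h ∣ q * h := Nat.dvd_mul_left _ _
    have := Nat.le_of_dvd hr0 ((Nat.dvd_add_right h1).1 ((Nat.dvd_mul_left h 2).trans hdvd))
    omega

/-- Adding the vertex `v` after an initial segment does not change the weight if it does not
change the weight of the component of the vertex `1`. -/
theorem weightD_insert (hw : IsWeightD n (2 * h) w) (hh : 1 ≤ h) {q a v c b : ℕ}
    (hσ : σ ⊆ Finset.Icc 1 n) (hv : 3 ≤ v) (hva : v = a + 1) (hcv : c = v + 1) (hvn : v ≤ n)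
    (h1 : Finset.Icc 1 a ⊆ σ)
    (hvσ : v ∉ σ)
    (hb : ¬ Finset.Icc c b ⊆ σ) (hvb : b ≤ v + h)
    (hc : ∀ k, a ≤ k → k < b → weightDComp (2 * h) k = q) :
    w (insert v σ) = w σ := by
  obtain ⟨j, hj, hjσ⟩ := Finset.not_subset.1 hb
  rw [Finset.mem_Icc] at hj
  obtain ⟨k, hk, hk1, hk2⟩ := exists_run (σ := insert v σ) v (by
    intro i hi
    rw [Finset.mem_Icc] at hi
    rw [Finset.mem_insert]
    by_cases hiv : i = v
    · exact Or.inl hiv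
    · exact Or.inr (h1 (Finset.mem_Icc.2 (by omega))))
  -- The run between `v` and the missing vertex `j` has fewer than `h` vertices, so as a separate
  -- component of type `A` it carries no weight before it is merged.
  have hkj : k + 1 ≤ j := by
    by_contra hlt
    have := hk1 (Finset.mem_Icc.2 (show 1 ≤ j ∧ j ≤ k by omega))
    rw [Finset.mem_insert] at this
    rcases this with h | h
    · omega
    · exact hjσ h
  rw [hw.eq_add _ (Finset.insert_subset (Finset.mem_Icc.2 (by omega)) hσ) k (by omega) hk1 hk2,
    hw.eq_add _ hσ a (by omega) h1 (by rwa [← hva]),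
    hc k (by omega) (by omega), hc a le_rfl (by omega), ← hva,
    shift_insert_of_le (by omega),
    weightA_eq_of_run (σ := shift v σ) (k := k - v) (by omega) (zero_notMem_shift v σ),
    shift_shift, show v + (k - v + 1) = k + 1 by omega, Nat.div_eq_of_lt (by omega), zero_add]
  · rw [Icc_subset_shift le_rfl, Nat.sub_add_cancel (by omega)]
    intro i hi
    rw [Finset.mem_Icc] at hi
    have := hk1 (Finset.mem_Icc.2 (show 1 ≤ i ∧ i ≤ k by omega))
    rw [Finset.mem_insert] at this
    rcases this with h | h
    · omega
    · exact h
  · rw [mem_shift, show k - v + 1 + v = k + 1 by omega]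
    exact fun h => hk2 (Finset.mem_insert_of_mem h.2)

/-- If `1 ∈ σ`, then `4 ∉ σ` and the component grows from `D_2` to `D_3`, both of weight two for
`φ_2`. If `1 ∉ σ`, this is the type `A` insertion of the second vertex after the first, for `d = 2`.
-/
theorem weightD_insert_three (hw : IsWeightD n 2 w) (hσ : σ ⊆ Finset.Icc 1 n) (hn : 3 ≤ n)
    (h2 : 2 ∈ σ) (h124 : ¬ ({1, 2, 4} : Finset ℕ) ⊆ σ) (h3 : 3 ∉ σ) :
    w (insert 3 σ) = w σ := by
  have hσ' : insert 3 σ ⊆ Finset.Icc 1 n :=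
    Finset.insert_subset (Finset.mem_Icc.2 (by omega)) hσ
  by_cases h1 : 1 ∈ σ
  · have h4 : 4 ∉ σ := fun h4 => h124 (by
      simp only [Finset.insert_subset_iff, Finset.singleton_subset_iff]; exact ⟨h1, h2, h4⟩)
    have e1 : Finset.Icc 1 2 ⊆ σ := by
      intro i hi
      rw [Finset.mem_Icc] at hi
      have : i = 1 ∨ i = 2 := by omega
      rcases this with rfl | rfl <;> assumption
    have e2 : Finset.Icc 1 3 ⊆ insert 3 σ := by
      intro i hi
      rw [Finset.mem_Icc] at hi
      have : i = 1 ∨ i = 2 ∨ i = 3 := by omega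
      rcases this with rfl | rfl | rfl <;> simp [*]
    rw [hw.eq_add _ hσ' 3 (by omega) e2 (by simp [h4]), hw.eq_add _ hσ 2 le_rfl e1 h3,
      weightA_eq_of_run (k := 0) (σ := shift 3 σ) le_rfl (zero_notMem_shift 3 σ) (by simp)
        (by simp [mem_shift, h4]), shift_shift, shift_insert_of_le (by omega)]
    have c3 : weightDComp 2 3 = 2 := by decide
    have c2 : weightDComp 2 2 = 2 := by decide
    rw [c2, c3]
    simp
  · rw [hw.eq_shift _ hσ' (by simp [h1]), hw.eq_shift _ hσ h1]
    have e : shift 1 (insert 3 σ) = insert 2 (shift 1 σ) := by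
      have := shift_toggle (m := 1) (x := 2) (σ := σ) (by omega)
      rwa [toggle_of_notMem h3, toggle_of_notMem (by simp [mem_shift, h3])] at this
    rw [e]
    apply weightA_insert_of_Icc_subset le_rfl (zero_notMem_shift 1 σ)
    · simp [mem_shift, h2]
    · simp [mem_shift, h3]

/-- The missing vertex `3` isolates the component `D_2`. Beyond it, `4` and `5` become the first and
second vertices of a type `A` diagram. -/
theorem weightD_insert_five (hw : IsWeightD n 2 w) (hσ : σ ⊆ Finset.Icc 1 n) (hn : 5 ≤ n)
    (h124 : ({1, 2, 4} : Finset ℕ) ⊆ σ) (h3 : 3 ∉ σ) (h5 : 5 ∉ σ) :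
    w (insert 5 σ) = w σ := by
  have hσ' : insert 5 σ ⊆ Finset.Icc 1 n :=
    Finset.insert_subset (Finset.mem_Icc.2 (by omega)) hσ
  have h4 : 4 ∈ σ := h124 (by simp)
  have e1 : Finset.Icc 1 2 ⊆ σ := by
    intro i hi
    rw [Finset.mem_Icc] at hi
    have : i = 1 ∨ i = 2 := by omega
    rcases this with rfl | rfl <;> exact h124 (by simp)
  rw [hw.eq_add _ hσ' 2 le_rfl (e1.trans (Finset.subset_insert _ _)) (by simp [h3]),
    hw.eq_add _ hσ 2 le_rfl e1 h3]
  have e : shift 3 (insert 5 σ) = insert 2 (shift 3 σ) := by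
    have := shift_toggle (m := 3) (x := 2) (σ := σ) (by omega)
    rwa [toggle_of_notMem h5, toggle_of_notMem (by simp [mem_shift, h5])] at this
  rw [e]
  congr 1
  apply weightA_insert_of_Icc_subset le_rfl (zero_notMem_shift _ σ)
  · simp [mem_shift, h4]
  · simp [mem_shift, h5]

end weights

/-! ### Part (g) of the matching for even `d` -/

section partG

variable {n h g q : ℕ} {w : Finset ℕ → ℕ} {σ : Finset ℕ}

/-- The simplices for which the component of the vertex `1` has size between `a` and `b - 1`. -/
def initialSegment (n g a b : ℕ) : Set (Finset ℕ) :=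
  {σ | σ ∈ complexA n 0 g ∧ Finset.Icc 1 a ⊆ σ ∧ ¬ Finset.Icc 1 b ⊆ σ}

theorem quotD_of_mem_even (hh : 1 ≤ h) (hq : Even q)
    (hσ : σ ∈ initialSegment n g (q * h) ((q + 1) * h + 1)) :
    quotD (2 * h / 2) (componentSize n σ) = q ∧
      vertexD (2 * h / 2) (componentSize n σ) = q * h + 1 := by
  have h1 := (le_componentSize_iff hσ.1.1).2 hσ.2.1
  have h2 := mt (le_componentSize_iff hσ.1.1).1 hσ.2.2
  rw [Nat.mul_div_cancel_left _ (by norm_num)]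
  have h3 := quotD_eq_of_even hh hq h1 (by omega)
  rw [vertexD, h3, if_pos hq]
  exact ⟨rfl, rfl⟩

theorem quotD_of_mem_odd (hq : Odd q)
    (hσ : σ ∈ initialSegment n g (q * h + 1) ((q + 1) * h)) :
    quotD (2 * h / 2) (componentSize n σ) = q ∧
      vertexD (2 * h / 2) (componentSize n σ) = q * h + 2 := by
  have h1 := (le_componentSize_iff hσ.1.1).2 hσ.2.1
  have h2 := mt (le_componentSize_iff hσ.1.1).1 hσ.2.2
  rw [Nat.mul_div_cancel_left _ (by norm_num)]
  have h3 := quotD_eq_of_odd h1 (by omega)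
  rw [vertexD, h3, if_neg (Nat.not_even_iff_odd.2 hq)]
  exact ⟨rfl, rfl⟩

theorem partD_of_mem_even (hh : 1 ≤ h) (hq : Even q) (h4 : 4 ≤ q * h)
    (hσ : σ ∈ initialSegment n g (q * h) ((q + 1) * h + 1)) : partD (2 * h) n σ =
      if q * h + 1 ∈ σ then .g1 else if n < q * h + 1 then .g21
      else if Finset.Icc (q * h + 2) ((q + 1) * h + 1) ⊆ σ then .g22 else .g2 := by
  obtain ⟨h1, h2⟩ := quotD_of_mem_even hh hq hσ
  rw [partD_of_Icc_subset ((Finset.Icc_subset_Icc_right h4).trans hσ.2.1), h1, h2,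
    Nat.mul_div_cancel_left _ (by norm_num)]
  simp [hq, Nat.not_odd_iff_even.2 hq]

theorem partD_of_mem_odd (hq : Odd q) (h4 : 4 ≤ q * h + 1)
    (hσ : σ ∈ initialSegment n g (q * h + 1) ((q + 1) * h)) : partD (2 * h) n σ =
      if q * h + 2 ∈ σ then .g1 else if n < q * h + 2 then .g21
      else if Finset.Icc (q * h + 3) ((q + 1) * h) ⊆ σ then .g23 else .g2 := by
  obtain ⟨h1, h2⟩ := quotD_of_mem_odd hq hσ
  rw [partD_of_Icc_subset ((Finset.Icc_subset_Icc_right h4).trans hσ.2.1), h1, h2,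
    Nat.mul_div_cancel_left _ (by norm_num)]
  simp [hq, Nat.not_even_iff_odd.2 hq]

/-- The domain of the generic case of part (g), in which `σ` is matched along `v`. -/
theorem tame_initialSegment_generic {a v c b : ℕ} {r : Finset ℕ → Option ℕ} (hv : 5 ≤ v)
    (hva : v = a + 1) (hc : c = v + 1) (hvb : v < b)
    (hr1 : ∀ σ ∈ initialSegment n g a b, v ∈ σ → r σ = if v ≤ n - g then some v else none)
    (hr2 : ∀ σ ∈ initialSegment n g a b, ¬ Finset.Icc c b ⊆ σ → v ∉ σ → v ≤ n →
      r σ = some v)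
    (hr3 : ∀ σ ∈ initialSegment n g a b, v ∉ σ → n < v → r σ = none)
    (hins : ∀ σ ∈ initialSegment n g a b, v ≤ n → v ∉ σ → ¬ Finset.Icc c b ⊆ σ →
      w (insert v σ) = w σ) :
    Tame {σ | σ ∈ initialSegment n g a b ∧ ¬ Finset.Icc c b ⊆ σ} r w := by
  by_cases hvn : n < v
  · apply Tame.of_none
    rintro σ ⟨hσ, h1⟩
    exact hr3 σ hσ (fun h => by have := Finset.mem_Icc.1 (hσ.1.1 h); omega) hvn
  by_cases hvg : v ≤ n - g
  · apply Tame.of_some v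
    · rintro σ ⟨hσ, h1⟩
      by_cases hvσ : v ∈ σ
      · rw [hr1 σ hσ hvσ, if_pos hvg]
      · exact hr2 σ hσ h1 hvσ (by omega)
    · rintro σ ⟨hσ, h1⟩
      unfold initialSegment complexA at hσ ⊢
      simp only [Finset.subset_iff, Finset.mem_Icc, Set.mem_ofPred_eq, mem_toggle] at hσ h1 ⊢
      grind
    · rintro σ ⟨hσ, h1⟩ hvσ
      exact hins σ hσ (by omega) hvσ h1
  -- Here `n - g < v ≤ n`: every simplex is forced to contain `v` and cannot lose it.
  · apply Tame.of_none
    rintro σ ⟨hσ, h1⟩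
    rw [hr1 σ hσ (hσ.1.2.2 (Finset.mem_Icc.2 (by omega))), if_neg hvg]

/-- The domain of the recursive cases of part (g). -/
theorem tame_initialSegment_recursive {d a v c b q f : ℕ} {r : Finset ℕ → Option ℕ} (hd : 2 ≤ d)
    (hv : 5 ≤ v)
    (hva : v = a + 1) (hc : c = v + 1) (hvn : v ≤ n) (hvb : v ≤ b)
    (hr : ∀ σ ∈ initialSegment n g a b, v ∉ σ → Finset.Icc c b ⊆ σ →
      r σ = (ruleA d (n - v) f g (shift v σ)).map (· + v))
    (hf : f + v = b) (hw : IsWeightD n d w) (hq : weightDComp d a = q) :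
    Tame {σ | σ ∈ initialSegment n g a b ∧ Finset.Icc c b ⊆ σ} r w := by
  -- With `v` present, the initial segment would reach `b`, which `initialSegment` excludes.
  have hvσ : ∀ σ ∈ {σ | σ ∈ initialSegment n g a b ∧ Finset.Icc c b ⊆ σ}, v ∉ σ := by
    rintro σ ⟨⟨hσ, h1, h2⟩, h3⟩ h4
    apply h2
    simp only [Finset.subset_iff, Finset.mem_Icc] at *
    grind
  by_cases hvg : v + g ≤ n
  · refine (tame_ruleA hd (n - v) f g).of_shift v (Finset.Icc 1 a) q
      (fun σ hσ => zero_notMem_of_subset_Icc hσ.1) ?_ ?_ ?_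
    · intro σ
      have hvσ := hvσ σ
      rw [shift_mem_complexA_iff (by omega), filter_le_eq_iff (by simp; omega)]
      unfold initialSegment complexA at *
      simp only [Finset.subset_iff, Finset.mem_Icc, Set.mem_ofPred_eq] at *
      constructor
      · grind
      · rintro ⟨h1, h2, h3, h4⟩
        have h5 : v ∉ σ := fun h => by have := (h1 v le_rfl).1 h; omega
        refine ⟨⟨⟨?_, ?_, ?_⟩, ?_, fun h => h5 (h (by omega))⟩, ?_⟩ <;> grind
    · rintro σ hσ
      exact hr σ hσ.1 (hvσ σ hσ) hσ.2
    · intro σ hσ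
      have := hw.eq_add σ hσ.1.1.1 a (by omega) hσ.1.2.1
        (by rw [← hva]; exact hvσ σ hσ)
      rw [← hva, hq] at this
      rw [this, add_comm]
  · apply Tame.of_isEmpty
    intro σ hσ
    exact hvσ σ hσ (hσ.1.1.2.2 (Finset.mem_Icc.2 (by omega)))

/-- Component sizes run from `qh` to `(q+1)h`, all of weight `q`. If the next `h` vertices after `v`
are not all present, adding `v` cannot leave this range; if they are all present, adding it would,
and part (g2.2) recurses instead. -/
theorem tame_initialSegment_even (hw : IsWeightD n (2 * h) w) (hh : 1 ≤ h) (hq : Even q)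
    (h4 : 4 ≤ q * h) :
    Tame (initialSegment n g (q * h) ((q + 1) * h + 1)) (ruleDEven (2 * h) n g) w := by
  have hq1 : 1 ≤ q := by
    by_contra h0
    obtain rfl : q = 0 := by omega
    omega
  have hb : (q + 1) * h + 1 = q * h + 1 + h := by ring
  have hd2 : 2 * h / 2 = h := Nat.mul_div_cancel_left _ (by norm_num)
  apply Tame.of_split_subset (Finset.Icc (q * h + 2) ((q + 1) * h + 1))
  · by_cases hvn : q * h + 1 ≤ n
    · refine tame_initialSegment_recursive (v := q * h + 1) (f := h) (q := q) (by omega) (by omega)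
        rfl rfl hvn (by omega) ?_ (by omega) hw ?_
      · intro σ hσ h1 h2
        have hp := partD_of_mem_even hh hq h4 hσ
        rw [if_neg h1, if_neg (by omega), if_pos h2] at hp
        rw [ruleDEven_of_g22 hp (quotD_of_mem_even hh hq hσ).1, hd2]
      · exact weightDComp_even hh hq hq1 (Nat.zero_le h)
    · apply Tame.of_isEmpty
      rintro σ ⟨hσ, h1⟩
      have := Finset.mem_Icc.1 (hσ.1.1 (h1 (Finset.mem_Icc.2 ⟨le_rfl, by omega⟩)))
      omega
  · refine tame_initialSegment_generic (v := q * h + 1) (by omega) rfl rfl (by omega) ?_ ?_ ?_ ?_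
    · intro σ hσ h1
      have hp := partD_of_mem_even hh hq h4 hσ
      rw [if_pos h1] at hp
      rw [ruleDEven_of_g1 hp, (quotD_of_mem_even hh hq hσ).2]
    · intro σ hσ h1 h2 h3
      have hp := partD_of_mem_even hh hq h4 hσ
      rw [if_neg h2, if_neg (by omega), if_neg h1] at hp
      rw [ruleDEven_of_g2 hp, (quotD_of_mem_even hh hq hσ).2]
    · intro σ hσ h1 h2
      have hp := partD_of_mem_even hh hq h4 hσ
      rw [if_neg h1, if_pos h2] at hp
      rw [ruleDEven_of_g21 hp]
    · intro σ hσ h1 h2 h3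
      refine weightD_insert (q := q) hw hh hσ.1.1 (by omega) rfl rfl h1 hσ.2.1 h2 h3 (by omega) ?_
      intro k hk1 hk2
      have := weightDComp_even hh hq hq1 (r := k - q * h) (by omega)
      rwa [Nat.add_sub_cancel' (by omega)] at this

theorem tame_initialSegment_odd (hw : IsWeightD n (2 * h) w) (hq : Odd q)
    (h4 : 4 ≤ q * h + 1) :
    Tame (initialSegment n g (q * h + 1) ((q + 1) * h)) (ruleDEven (2 * h) n g) w := by
  have hb : (q + 1) * h = q * h + h := by ring
  -- An odd `q` has an empty open range when `h ≤ 1`.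
  by_cases hh : h < 2
  · apply Tame.of_isEmpty
    rintro σ ⟨_, h1, h2⟩
    exact h2 ((Finset.Icc_subset_Icc_right (by omega)).trans h1)
  have hd2 : 2 * h / 2 = h := Nat.mul_div_cancel_left _ (by norm_num)
  have hcomp : ∀ k, q * h + 1 ≤ k → k < (q + 1) * h → weightDComp (2 * h) k = q := by
    intro k hk1 hk2
    have := weightDComp_odd (h := h) (q := q) (r := k - q * h) (by omega) (by omega)
    rwa [Nat.add_sub_cancel' (by omega)] at this
  by_cases hvn : n < q * h + 2
  · apply Tame.of_none
    intro σ hσ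
    have hp := partD_of_mem_odd hq h4 hσ
    rw [if_neg (fun h => by have := Finset.mem_Icc.1 (hσ.1.1 h); omega), if_pos hvn] at hp
    rw [ruleDEven_of_g21 hp]
  apply Tame.of_split_subset (Finset.Icc (q * h + 3) ((q + 1) * h))
  · refine tame_initialSegment_recursive (v := q * h + 2) (f := h - 2) (q := q) (by omega)
      (by omega) rfl rfl (by omega) (by omega) ?_ (by omega) hw ?_
    · intro σ hσ h1 h2
      have hp := partD_of_mem_odd hq h4 hσ
      rw [if_neg h1, if_neg hvn, if_pos h2] at hp
      rw [ruleDEven_of_g23 hp (quotD_of_mem_odd hq hσ).1, hd2]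
    · exact hcomp _ (by omega) (by omega)
  -- For `h = 2` the set tested in (g2.3) is empty, so the recursive case takes everything.
  · by_cases hh2 : h = 2
    · apply Tame.of_isEmpty
      rintro σ ⟨hσ, h1⟩
      apply h1
      rw [Finset.Icc_eq_empty (by omega)]
      exact Finset.empty_subset _
    refine tame_initialSegment_generic (v := q * h + 2) (by omega) rfl rfl (by omega) ?_ ?_ ?_ ?_
    · intro σ hσ h1
      have hp := partD_of_mem_odd hq h4 hσ
      rw [if_pos h1] at hp
      rw [ruleDEven_of_g1 hp, (quotD_of_mem_odd hq hσ).2]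
    · intro σ hσ h1 h2 h3
      have hp := partD_of_mem_odd hq h4 hσ
      rw [if_neg h2, if_neg (by omega), if_neg h1] at hp
      rw [ruleDEven_of_g2 hp, (quotD_of_mem_odd hq hσ).2]
    · intro σ hσ h1 h2
      omega
    · intro σ hσ h1 h2 h3
      exact weightD_insert (q := q) hw (by omega) hσ.1.1 (by omega) rfl rfl h1 hσ.2.1 h2 h3 (by omega) hcomp

/-- The fibers of the function `q` on the domain of part (g). -/
theorem mem_initialSegment_of_quotD (hh : 1 ≤ h) (hσ : σ ∈ complexA n 0 g)
    (h4 : Finset.Icc 1 4 ⊆ σ) (hh1 : Finset.Icc 1 (h + 1) ⊆ σ)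
    (hq : quotD h (componentSize n σ) = q) :
    (Even q ∧ 4 ≤ q * h ∧ h + 1 ≤ q * h ∧ σ ∈ initialSegment n g (q * h) ((q + 1) * h + 1)) ∨
      (Odd q ∧ 4 ≤ q * h + 1 ∧ h + 1 ≤ q * h + 1 ∧
        σ ∈ initialSegment n g (q * h + 1) ((q + 1) * h)) := by
  have g4 := (le_componentSize_iff hσ.1).2 h4
  have gh := (le_componentSize_iff hσ.1).2 hh1
  rcases Nat.even_or_odd q with he | ho
  · left
    obtain ⟨h1, h2⟩ := quotD_spec (k := componentSize n σ) hh
    rw [hq] at h1 h2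
    -- `q = 0` would bound the component by `h`, but it has at least `h + 1` vertices.
    have hq2 : 2 ≤ q := by
      by_contra hlt
      have : q = 0 := by
        rcases he with ⟨c, rfl⟩
        omega
      subst this
      omega
    have hqh : h + 1 ≤ q * h := by nlinarith
    refine ⟨he, ?_, hqh, hσ, (le_componentSize_iff hσ.1).1 h1,
      mt (le_componentSize_iff hσ.1).2 (by omega)⟩
    -- For `h = 1`, size at least `4` gives `q ≥ 3`, and parity gives `q ≥ 4`; for `h ≥ 2`, `q ≥ 2`
    -- suffices.
    by_contra hlt
    have hh1 : h = 1 ∨ 2 ≤ h := by omega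
    rcases hh1 with rfl | hh2
    · rcases he with ⟨c, rfl⟩
      omega
    · nlinarith
  · right
    obtain ⟨h1, h2⟩ := quotD_spec_odd hh (hq ▸ ho)
    rw [hq] at h1 h2
    have hqh : h ≤ q * h := Nat.le_mul_of_pos_left h ho.pos
    refine ⟨ho, ?_, by omega, hσ, (le_componentSize_iff hσ.1).1 h1,
      mt (le_componentSize_iff hσ.1).2 (by omega)⟩
    by_contra hlt
    have hb : (q + 1) * h = q * h + h := by ring
    have hh3 : h = 1 ∨ h = 2 ∨ h = 3 := by omega
    rcases hh3 with rfl | rfl | rfl <;> omega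

theorem tame_partG (hw : IsWeightD n (2 * h) w) (hh : 1 ≤ h) :
    Tame {σ | σ ∈ complexA n 0 g ∧ Finset.Icc 1 4 ⊆ σ ∧ Finset.Icc 1 (h + 1) ⊆ σ}
      (ruleDEven (2 * h) n g) w := by
  apply Tame.of_fiber (fun σ => quotD h (componentSize n σ))
  · rintro σ ⟨hσ, _⟩ τ ⟨hτ, _⟩ hst
    exact quotD_mono ((le_componentSize_iff hτ.1).2
      (((le_componentSize_iff hσ.1).1 le_rfl).trans hst))
  · intro q
    have hd2 : 2 * h / 2 = h := Nat.mul_div_cancel_left _ (by norm_num)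
    by_cases he : Even q ∧ 4 ≤ q * h ∧ h + 1 ≤ q * h
    · obtain ⟨he, h4, h5⟩ := he
      convert tame_initialSegment_even (g := g) hw hh he h4 using 1
      ext σ
      constructor
      · rintro ⟨⟨h1, h2, h3⟩, hq⟩
        rcases mem_initialSegment_of_quotD hh h1 h2 h3 hq with ⟨_, _, _, h⟩ | ⟨h, _⟩
        · exact h
        · exact absurd he (Nat.not_even_iff_odd.2 h)
      · intro hσ
        refine ⟨⟨hσ.1, (Finset.Icc_subset_Icc_right h4).trans hσ.2.1,
          (Finset.Icc_subset_Icc_right h5).trans hσ.2.1⟩, ?_⟩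
        have := (quotD_of_mem_even hh he hσ).1
        rwa [hd2] at this
    · by_cases ho : Odd q ∧ 4 ≤ q * h + 1 ∧ h + 1 ≤ q * h + 1
      · obtain ⟨ho, h4, h5⟩ := ho
        convert tame_initialSegment_odd (g := g) hw ho h4 using 1
        ext σ
        constructor
        · rintro ⟨⟨h1, h2, h3⟩, hq⟩
          rcases mem_initialSegment_of_quotD hh h1 h2 h3 hq with ⟨h, _⟩ | ⟨_, _, _, h⟩
          · exact absurd h (Nat.not_even_iff_odd.2 ho)
          · exact h
        · intro hσ
          refine ⟨⟨hσ.1, (Finset.Icc_subset_Icc_right h4).trans hσ.2.1,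
            (Finset.Icc_subset_Icc_right h5).trans hσ.2.1⟩, ?_⟩
          have := (quotD_of_mem_odd ho hσ).1
          rwa [hd2] at this
      · apply Tame.of_isEmpty
        rintro σ ⟨⟨h1, h2, h3⟩, hq⟩
        rcases mem_initialSegment_of_quotD hh h1 h2 h3 hq with h | h
        · exact he ⟨h.1, h.2.1, h.2.2.1⟩
        · exact ho ⟨h.1, h.2.1, h.2.2.1⟩

end partG

/-! ### The matching on `K^D_{n,g}` for even `d` -/

section even

variable {n h g : ℕ} {w : Finset ℕ → ℕ} {σ : Finset ℕ}

theorem Icc_one_four_subset (h1 : 1 ∈ σ) (h2 : 2 ∈ σ) (h3 : 3 ∈ σ) (h4 : 4 ∈ σ) :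
    Finset.Icc 1 4 ⊆ σ := by
  intro i hi
  rw [Finset.mem_Icc] at hi
  have : i = 1 ∨ i = 2 ∨ i = 3 ∨ i = 4 := by omega
  rcases this with rfl | rfl | rfl | rfl <;> assumption

/-- Without the vertex `2`, the remaining diagram `1, 3, 4, …` is of type `A_{n-1}`. The vertex `2`
can be missing only if it is not among the prescribed last `g`. -/
theorem tame_partA {d : ℕ} (hd : 2 ≤ d) (hw : IsWeightD n d w) (hn : 4 ≤ n) :
    Tame {σ | σ ∈ complexA n 0 g ∧ 2 ∉ σ} (ruleDEven d n g) w := by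
  by_cases hg : g + 2 ≤ n
  · have h0 : ∀ σ ∈ {σ | σ ∈ complexA n 0 g ∧ 2 ∉ σ}, 0 ∉ σ :=
      fun σ hσ => zero_notMem_of_subset_Icc hσ.1.1
    refine (tame_ruleA hd (n - 1) 0 g).of_relabel relabel (fun i => if i = 1 then 1 else i + 1) 0 0
      ?_ ?_ (fun _ _ => relabel_mono) ?_ ?_ ?_
    · intro σ hσ
      have h0 := h0 σ hσ
      obtain ⟨h1, h2⟩ := hσ
      unfold complexA at h1 ⊢
      simp only [Finset.subset_iff, Finset.mem_Icc, Set.mem_ofPred_eq, mem_relabel h0 h2] at h1 ⊢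
      refine ⟨?_, ?_, ?_⟩ <;> grind
    · rintro σ ⟨hσ, h2⟩
      rw [ruleDEven_of_a (partD_eq_a h2)]
    · intro σ hσ x hx
      have h0 := h0 σ hσ
      obtain ⟨h1, h2⟩ := hσ
      have hx1 : 1 ≤ x ∧ x ≤ n - 1 := by
        by_contra hlt
        have h3 : x ∉ relabel σ := by
          have := h1.1
          simp only [Finset.subset_iff, Finset.mem_Icc] at this
          rw [mem_relabel h0 h2]
          grind
        rw [toggle_of_notMem h3] at hx
        have := Finset.mem_Icc.1 (hx.1 (Finset.mem_insert_self _ _))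
        exact hlt this
      have h0' : 0 ∉ toggle σ (if x = 1 then 1 else x + 1) := by
        rw [mem_toggle]; grind
      have h2' : 2 ∉ toggle σ (if x = 1 then 1 else x + 1) := by
        rw [mem_toggle]; grind
      refine ⟨⟨?_, h2'⟩, ?_, ?_⟩
      · unfold complexA at h1 hx ⊢
        simp only [Finset.subset_iff, Finset.mem_Icc, Set.mem_ofPred_eq, mem_toggle,
          mem_relabel h0 h2] at h1 hx ⊢
        obtain ⟨g1, g2, g3⟩ := h1
        obtain ⟨k1, k2, k3⟩ := hx
        refine ⟨?_, ?_, ?_⟩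
        · grind
        · grind
        · intro i hi
          have := k3 (x := i - 1)
          have := g3 hi
          grind
      · ext i
        rw [mem_relabel h0' h2']
        simp only [mem_toggle, mem_relabel h0 h2]
        grind
      · rw [mem_relabel h0 h2]; grind
    · intro σ hσ
      rw [card_relabel (h0 σ hσ) hσ.2, add_zero]
    · rintro σ ⟨hσ, h2⟩
      rw [hw.eq_relabel σ hσ.1 h2, add_zero]
  · apply Tame.of_isEmpty
    rintro σ ⟨hσ, h2⟩
    exact h2 (hσ.2.2 (Finset.mem_Icc.2 (by omega)))

theorem tame_partB (hw : IsWeightD n 2 w) (hn : 4 ≤ n) :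
    Tame {σ | (σ ∈ complexA n 0 g ∧ 2 ∈ σ) ∧ ¬ Finset.Icc 1 4 ⊆ σ} (ruleDEven 2 n g) w := by
  have hr : ∀ σ ∈ {σ | (σ ∈ complexA n 0 g ∧ 2 ∈ σ) ∧ ¬ Finset.Icc 1 4 ⊆ σ}, _ :=
    fun σ hσ => ruleDEven_of_b (g := g) (partD_eq_b (d := 2) (n := n) rfl hσ.1.2 hσ.2)
  apply Tame.of_split_subset {1, 2, 4}
  · by_cases hg : 5 ≤ n - g
    · apply Tame.of_some 5
      · rintro σ ⟨hσ, h1⟩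
        rw [hr σ hσ, if_pos h1, if_pos hg]
      · rintro σ ⟨⟨⟨hσ, h2⟩, h3⟩, h1⟩
        unfold complexA at hσ ⊢
        simp only [Finset.subset_iff, Finset.mem_Icc, Set.mem_ofPred_eq, mem_toggle,
          Finset.mem_insert, Finset.mem_singleton] at hσ h1 h2 h3 ⊢
        refine ⟨⟨⟨⟨?_, ?_, ?_⟩, ?_⟩, ?_⟩, ?_⟩
        · grind
        · grind
        · grind
        · grind
        · intro hall
          apply h3
          intro i hi
          have := hall hi
          grind
        · grind
      · rintro σ ⟨⟨⟨hσ, h2⟩, h3⟩, h1⟩ h5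
        refine weightD_insert_five hw hσ.1 (by omega) h1 (fun h => h3 ?_) h5
        exact Icc_one_four_subset (h1 (by simp)) h2 h (h1 (by simp))
    · apply Tame.of_none
      rintro σ ⟨hσ, h1⟩
      rw [hr σ hσ, if_pos h1, if_neg hg]
  · by_cases hg : 3 ≤ n - g
    · apply Tame.of_some 3
      · rintro σ ⟨hσ, h1⟩
        rw [hr σ hσ, if_neg h1, if_pos hg]
      · rintro σ ⟨⟨⟨hσ, h2⟩, h3⟩, h1⟩
        have h1' : ¬ ({1, 2, 4} : Finset ℕ) ⊆ toggle σ 3 := by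
          intro hs
          apply h1
          intro i hi
          have h4 := hs hi
          rw [mem_toggle] at h4
          simp only [Finset.mem_insert, Finset.mem_singleton] at hi
          grind
        refine ⟨⟨⟨?_, ?_⟩, fun h => h1' (subset_trans ?_ h)⟩, h1'⟩
        · unfold complexA at hσ ⊢
          simp only [Finset.subset_iff, Finset.mem_Icc, Set.mem_ofPred_eq, mem_toggle] at hσ ⊢
          grind
        · rw [mem_toggle]; simp [h2]
        · decide
      · rintro σ ⟨⟨⟨hσ, h2⟩, h3⟩, h1⟩ h4
        exact weightD_insert_three hw hσ.1 (by omega) h2 h1 h4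
    · apply Tame.of_none
      rintro σ ⟨hσ, h1⟩
      rw [hr σ hσ, if_neg h1, if_neg hg]

/-- A missing vertex between `3` and `h + 1` keeps the component of the vertex `1` too small for `1`
to matter for the weight. Since `p` does not depend on `1`, the whole piece is matched along it. -/
theorem tame_some_one (hw : IsWeightD n (2 * h) w) (hn : 4 ≤ n) (hg : g ≤ n - 1)
    {p : Finset ℕ → Prop} (hp : ∀ σ, p (toggle σ 1) ↔ p σ) {r : Finset ℕ → Option ℕ}
    (hr : ∀ σ ∈ complexA n 0 g, p σ → r σ = some 1)
    (hj : ∀ σ ∈ complexA n 0 g, p σ → 2 ∈ σ ∧ ∃ j, 3 ≤ j ∧ j ≤ h + 1 ∧ j ∉ σ) :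
    Tame {σ | σ ∈ complexA n 0 g ∧ p σ} r w := by
  apply Tame.of_some 1
  · rintro σ ⟨hσ, h1⟩
    exact hr σ hσ h1
  · rintro σ ⟨hσ, h1⟩
    refine ⟨?_, (hp σ).2 h1⟩
    unfold complexA at hσ ⊢
    simp only [Finset.subset_iff, Finset.mem_Icc, Set.mem_ofPred_eq, mem_toggle] at hσ ⊢
    grind
  · rintro σ ⟨hσ, h1⟩ h3
    obtain ⟨h2, j, hj1, hj2, hj3⟩ := hj σ hσ h1
    exact weightD_insert_one hw (by omega) hσ.1 h3 h2 hj1 hj2 hj3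

/-- For `φ_4`, the component `{1, 2, 3}`, of type `D_3 = A_3`, has weight one, and `{2, 3}`, of type
`A_2`, has weight zero. -/
theorem weightD_of_four_notMem (hw : IsWeightD n 4 w) (hσ : σ ⊆ Finset.Icc 1 n) (h2 : 2 ∈ σ)
    (h3 : 3 ∈ σ) (h4 : 4 ∉ σ) : w σ = weightA 4 (shift 4 σ) + if 1 ∈ σ then 1 else 0 := by
  split_ifs with h1
  · rw [hw.eq_add σ hσ 3 (by omega) _ h4, add_comm]
    · congr 1
    · intro i hi
      rw [Finset.mem_Icc] at hi
      have : i = 1 ∨ i = 2 ∨ i = 3 := by omega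
      rcases this with rfl | rfl | rfl <;> assumption
  · rw [hw.eq_shift σ hσ h1, weightA_eq_of_run (σ := shift 1 σ) (k := 2) (by omega)
      (zero_notMem_shift 1 σ), shift_shift]
    · simp
    · rw [Icc_subset_shift le_rfl]
      intro i hi
      rw [Finset.mem_Icc] at hi
      have : i = 2 ∨ i = 3 := by omega
      rcases this with rfl | rfl <;> assumption
    · simp [mem_shift, h4]

/-- For `d = 4` toggling the vertex `1` changes the weight when `4` is missing, so `1` is left
alone. The two possible initial parts are handled separately, each with its own constant weight
shift. -/
theorem tame_partD_four (hw : IsWeightD n 4 w) (hn : 4 ≤ n) (P : Finset ℕ)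
    (hP : P ⊆ Finset.Icc 1 3) (hP2 : 2 ∈ P) (hP3 : 3 ∈ P) :
    Tame {σ | σ ∈ complexA n 0 g ∧ σ.filter (· ≤ 4) = P} (ruleDEven 4 n g) w := by
  have hP' : ∀ i ∈ P, 1 ≤ i ∧ i ≤ 3 := fun i hi => Finset.mem_Icc.1 (hP hi)
  have hmem : ∀ σ ∈ {σ | σ ∈ complexA n 0 g ∧ σ.filter (· ≤ 4) = P}, ∀ i ≤ 4, (i ∈ σ ↔ i ∈ P) :=
    fun σ hσ => (filter_le_eq_iff fun i hi => by have := hP' i hi; omega).1 hσ.2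
  have h2 : ∀ σ ∈ {σ | σ ∈ complexA n 0 g ∧ σ.filter (· ≤ 4) = P}, 2 ∈ σ :=
    fun σ hσ => (hmem σ hσ 2 (by omega)).2 hP2
  have h3 : ∀ σ ∈ {σ | σ ∈ complexA n 0 g ∧ σ.filter (· ≤ 4) = P}, 3 ∈ σ :=
    fun σ hσ => (hmem σ hσ 3 (by omega)).2 hP3
  have h4 : ∀ σ ∈ {σ | σ ∈ complexA n 0 g ∧ σ.filter (· ≤ 4) = P}, 4 ∉ σ :=
    fun σ hσ h => by have := hP' 4 ((hmem σ hσ 4 le_rfl).1 h); omega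
  by_cases hg : 4 + g ≤ n
  · refine (tame_ruleA (d := 4) (by norm_num) (n - 4) 0 g).of_shift 4 P (if 1 ∈ P then 1 else 0)
      (fun σ hσ => zero_notMem_of_subset_Icc hσ.1) ?_ ?_ ?_
    · intro σ
      rw [shift_mem_complexA_iff (by omega)]
      constructor
      · rintro ⟨⟨h1, h2, h3⟩, h4⟩
        exact ⟨h4, fun i hi => (Finset.mem_Icc.1 (h1 hi)).2, by simp, h3⟩
      · rintro ⟨h1, h2, h3, h4⟩
        refine ⟨⟨fun i hi => Finset.mem_Icc.2 ⟨?_, h2 i hi⟩, by simp, h4⟩, h1⟩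
        by_contra h0
        have h5 : i ∈ P := by
          rw [← h1, Finset.mem_filter]
          exact ⟨hi, by omega⟩
        exact h0 (hP' i h5).1
    · intro σ hσ
      rw [ruleDEven_of_d (partD_eq_d rfl (h2 σ hσ) (h3 σ hσ) (h4 σ hσ))]
    · intro σ hσ
      rw [weightD_of_four_notMem hw hσ.1.1 (h2 σ hσ) (h3 σ hσ) (h4 σ hσ)]
      simp only [hmem σ hσ 1 (by norm_num)]
  · apply Tame.of_isEmpty
    intro σ hσ
    exact h4 σ hσ (hσ.1.2.2 (Finset.mem_Icc.2 (by omega)))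

/-- The bound `max h 3` records that `4 ∈ σ` is already known in this part, which is extra
information only for `h = 2`. -/
theorem tame_partF (hw : IsWeightD n (2 * h) w) (hh : 2 ≤ h) (hn : 4 ≤ n) (hg : g ≤ n - 1) :
    Tame {σ | σ ∈ complexA n 0 g ∧ 1 ∉ σ ∧ Finset.Icc 2 (max h 3 + 1) ⊆ σ}
      (ruleDEven (2 * h) n g) w := by
  have hd2 : 2 * h / 2 = h := Nat.mul_div_cancel_left _ (by norm_num)
  refine (tame_ruleA (d := 2 * h) (by omega) (n - 1) (max h 3) g).of_shift 1 ∅ 0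
      (fun σ hσ => zero_notMem_of_subset_Icc hσ.1) ?_ ?_ ?_
  · intro σ
    rw [shift_mem_complexA_iff (by omega), filter_le_eq_iff (by simp)]
    generalize max h 3 = b
    unfold complexA
    simp only [Finset.subset_iff, Finset.mem_Icc, Set.mem_ofPred_eq]
    constructor
    · rintro ⟨⟨h1, h2, h3⟩, h4, h5⟩
      refine ⟨?_, ?_, ?_, h3⟩ <;> grind
    · rintro ⟨h1, h2, h3, h4⟩
      refine ⟨⟨?_, ?_, ?_⟩, ?_, ?_⟩ <;> grind
  · rintro σ ⟨hσ, h1, h2⟩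
    have hsub : ∀ i, 2 ≤ i → i ≤ 4 → i ∈ σ := fun i h3 h4 =>
      h2 (Finset.mem_Icc.2 ⟨h3, by have := le_max_right h 3; omega⟩)
    rw [ruleDEven_of_f (partD_eq_f (by omega) (hsub 2 (by omega) (by omega))
      (hsub 3 (by omega) (by omega)) (hsub 4 (by omega) (by omega)) h1), hd2, if_pos]
    exact (Finset.Icc_subset_Icc_right (Nat.add_le_add_right (le_max_left h 3) 1)).trans h2
  · rintro σ ⟨hσ, h1, h2⟩
    rw [hw.eq_shift σ hσ.1 h1, add_zero]

/-- If `{2, 3, 4} ⊆ σ`, but `σ` does not contain `{2, …, h + 1}`, then `σ` is matched along the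
vertex `1`, in part (f) or in part (g). -/
theorem ruleDEven_eq_some_one (hh : 2 ≤ h) (hσ : σ ⊆ Finset.Icc 1 n)
    (hg : g ≤ n - 1) (hn : 4 ≤ n) (h2 : 2 ∈ σ) (h3 : 3 ∈ σ)
    (h4 : 4 ∈ σ) (hsub : ¬ Finset.Icc 2 (h + 1) ⊆ σ) : ruleDEven (2 * h) n g σ = some 1 := by
  have hd2 : 2 * h / 2 = h := Nat.mul_div_cancel_left _ (by norm_num)
  by_cases h1 : 1 ∈ σ
  · have hk : ¬ h + 1 ≤ componentSize n σ := fun hk => hsub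
      ((Finset.Icc_subset_Icc_left (by omega)).trans ((le_componentSize_iff hσ).1 hk))
    -- The component has at most `h` vertices, so `q = 0` and `v = 1`: part (g1) removes the vertex
    -- `1`, inverse to the insertion in part (f).
    have hq : quotD (2 * h / 2) (componentSize n σ) = 0 := by
      rw [hd2]
      exact quotD_eq_of_even (by omega) (by simp) (by simp) (by omega)
    have hv : vertexD (2 * h / 2) (componentSize n σ) = 1 := by
      rw [vertexD, hq]; simp
    have hp : partD (2 * h) n σ = .g1 := by
      rw [partD_of_Icc_subset (Icc_one_four_subset h1 h2 h3 h4), hv, if_pos h1]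
    rw [ruleDEven_of_g1 hp, hv, if_pos (by omega)]
  · rw [ruleDEven_of_f (partD_eq_f (by omega) h2 h3 h4 h1), hd2, if_neg hsub]

theorem tame_ruleDEven_two (hw : IsWeightD n 2 w) (hn : 4 ≤ n) :
    Tame (complexA n 0 g) (ruleDEven 2 n g) w := by
  apply Tame.of_split_mem 2 _ (tame_partA le_rfl hw hn)
  apply Tame.of_split_subset (Finset.Icc 1 4) _ (tame_partB hw hn)
  convert tame_partG (h := 1) hw le_rfl using 1
  ext σ
  constructor
  · rintro ⟨⟨h1, h2⟩, h3⟩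
    exact ⟨h1, h3, (Finset.Icc_subset_Icc_right (by norm_num)).trans h3⟩
  · rintro ⟨h1, h2, h3⟩
    exact ⟨⟨h1, h2 (by simp)⟩, h2⟩

theorem tame_four_notMem (hw : IsWeightD n (2 * h) w) (hh : 2 ≤ h) (hn : 4 ≤ n)
    (hg : g ≤ n - 1) :
    Tame {σ | ((σ ∈ complexA n 0 g ∧ 2 ∈ σ) ∧ 3 ∈ σ) ∧ 4 ∉ σ} (ruleDEven (2 * h) n g) w := by
  rcases hh.eq_or_lt with rfl | hh3
  · have hset : ∀ P : Finset ℕ, P ⊆ Finset.Icc 1 3 → 2 ∈ P → 3 ∈ P → ∀ σ ∈ complexA n 0 g,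
        (σ.filter (· ≤ 4) = P ↔ 2 ∈ σ ∧ 3 ∈ σ ∧ 4 ∉ σ ∧ (1 ∈ σ ↔ 1 ∈ P)) := by
      intro P hP h2 h3 σ hσ
      have h0 := zero_notMem_of_subset_Icc hσ.1
      have hP' : ∀ i ∈ P, 1 ≤ i ∧ i ≤ 3 := fun i hi => Finset.mem_Icc.1 (hP hi)
      rw [filter_le_eq_iff fun i hi => by have := hP' i hi; omega]
      constructor
      · intro h
        have h4 := h 4 le_rfl
        have h1 := h 1 (by norm_num)
        have := h 2 (by norm_num)
        have := h 3 (by norm_num)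
        grind
      · rintro ⟨k2, k3, k4, k1⟩ i hi
        have : i = 0 ∨ i = 1 ∨ i = 2 ∨ i = 3 ∨ i = 4 := by omega
        rcases this with rfl | rfl | rfl | rfl | rfl <;> grind
    apply Tame.of_split_mem 1
    · convert tame_partD_four (g := g) hw hn {1, 2, 3} (by decide) (by simp) (by simp) using 1
      ext σ
      constructor
      · rintro ⟨⟨⟨⟨hσ, h2⟩, h3⟩, h4⟩, h1⟩
        exact ⟨hσ, (hset {1, 2, 3} (by decide) (by simp) (by simp) σ hσ).2 ⟨h2, h3, h4, by simp [h1]⟩⟩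
      · rintro ⟨hσ, h⟩
        obtain ⟨h2, h3, h4, h1⟩ := (hset {1, 2, 3} (by decide) (by simp) (by simp) σ hσ).1 h
        exact ⟨⟨⟨⟨hσ, h2⟩, h3⟩, h4⟩, h1.2 (by simp)⟩
    · convert tame_partD_four (g := g) hw hn {2, 3} (by decide) (by simp) (by simp) using 1
      ext σ
      constructor
      · rintro ⟨⟨⟨⟨hσ, h2⟩, h3⟩, h4⟩, h1⟩
        exact ⟨hσ, (hset {2, 3} (by decide) (by simp) (by simp) σ hσ).2 ⟨h2, h3, h4, by simp [h1]⟩⟩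
      · rintro ⟨hσ, h⟩
        obtain ⟨h2, h3, h4, h1⟩ := (hset {2, 3} (by decide) (by simp) (by simp) σ hσ).1 h
        exact ⟨⟨⟨⟨hσ, h2⟩, h3⟩, h4⟩, fun h => by simpa using h1.1 h⟩
  · have := tame_some_one (g := g) hw hn hg (p := fun σ => 2 ∈ σ ∧ 3 ∈ σ ∧ 4 ∉ σ)
      (r := ruleDEven (2 * h) n g) (by intro σ; simp [mem_toggle])
      (fun σ hσ h => ruleDEven_of_e (partD_eq_e (by omega) h.1 h.2.1 h.2.2))
      (fun σ hσ h => ⟨h.1, 4, by omega, by omega, h.2.2⟩)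
    convert this using 1
    ext σ
    simp only [Set.mem_ofPred_eq, and_assoc]

/-- The splitting does not follow the parts literally. Simplices with `2, 3, 4` but not all of `{2,
…, h+1}` are matched along `1` between parts (f) and (g), so they form a piece of their own before
the vertex `1` is tested. -/
theorem tame_ruleDEven_of_two_le (hw : IsWeightD n (2 * h) w) (hh : 2 ≤ h) (hn : 4 ≤ n)
    (hg : g ≤ n - 1) : Tame (complexA n 0 g) (ruleDEven (2 * h) n g) w := by
  apply Tame.of_split_mem 2 _ (tame_partA (by omega) hw hn)
  apply Tame.of_split_mem 3
  · apply Tame.of_split_mem 4 _ (tame_four_notMem hw hh hn hg)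
    apply Tame.of_split_subset (Finset.Icc 2 (h + 1))
    · apply Tame.of_split_mem 1
      · convert tame_partG (g := g) hw (by omega) using 1
        ext σ
        constructor
        · rintro ⟨⟨⟨⟨⟨hσ, h2⟩, h3⟩, h4⟩, h5⟩, h1⟩
          refine ⟨hσ, Icc_one_four_subset h1 h2 h3 h4, fun i hi => ?_⟩
          rw [Finset.mem_Icc] at hi
          by_cases hi1 : i = 1
          · exact hi1 ▸ h1
          · exact h5 (Finset.mem_Icc.2 (by omega))
        · rintro ⟨hσ, h1, h2⟩
          exact ⟨⟨⟨⟨⟨hσ, h1 (by simp)⟩, h1 (by simp)⟩, h1 (by simp)⟩,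
            (Finset.Icc_subset_Icc_left (by omega)).trans h2⟩, h1 (by simp)⟩
      · convert tame_partF (g := g) hw hh hn hg using 1
        ext σ
        constructor
        · rintro ⟨⟨⟨⟨⟨hσ, h2⟩, h3⟩, h4⟩, h5⟩, h1⟩
          refine ⟨hσ, h1, fun i hi => ?_⟩
          rw [Finset.mem_Icc] at hi
          by_cases hi1 : i ≤ h + 1
          · exact h5 (Finset.mem_Icc.2 (by omega))
          · have : i = 2 ∨ i = 3 ∨ i = 4 := by omega
            rcases this with rfl | rfl | rfl <;> assumption
        · rintro ⟨hσ, h1, h2⟩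
          have hsub : ∀ i, 2 ≤ i → i ≤ max h 3 + 1 → i ∈ σ := fun i h3 h4 =>
            h2 (Finset.mem_Icc.2 ⟨h3, h4⟩)
          exact ⟨⟨⟨⟨⟨hσ, hsub 2 (by omega) (by omega)⟩, hsub 3 (by omega) (by omega)⟩,
            hsub 4 (by omega) (by omega)⟩, (Finset.Icc_subset_Icc_right (by omega)).trans h2⟩, h1⟩
    · have := tame_some_one (g := g) hw hn hg
        (p := fun σ => 2 ∈ σ ∧ 3 ∈ σ ∧ 4 ∈ σ ∧ ¬ Finset.Icc 2 (h + 1) ⊆ σ)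
        (r := ruleDEven (2 * h) n g) ?_
        (fun σ hσ h => ruleDEven_eq_some_one hh hσ.1 hg hn h.1 h.2.1 h.2.2.1 h.2.2.2) ?_
      · convert this using 1
        ext σ
        constructor
        · rintro ⟨⟨⟨⟨hσ, h2⟩, h3⟩, h4⟩, h5⟩
          exact ⟨hσ, h2, h3, h4, h5⟩
        · rintro ⟨hσ, h2, h3, h4, h5⟩
          exact ⟨⟨⟨⟨hσ, h2⟩, h3⟩, h4⟩, h5⟩
      · intro σ
        have : Finset.Icc 2 (h + 1) ⊆ toggle σ 1 ↔ Finset.Icc 2 (h + 1) ⊆ σ := by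
          simp only [Finset.subset_iff, Finset.mem_Icc, mem_toggle]
          grind
        rw [this]
        simp [mem_toggle]
      · rintro σ hσ ⟨h2, _, _, hsub⟩
        obtain ⟨j, hj, hjσ⟩ := Finset.not_subset.1 hsub
        rw [Finset.mem_Icc] at hj
        refine ⟨h2, j, ?_, hj.2, hjσ⟩
        by_contra hlt
        obtain rfl : j = 2 := by omega
        exact hjσ h2
  · have := tame_some_one (g := g) hw hn hg (p := fun σ => 2 ∈ σ ∧ 3 ∉ σ)
      (r := ruleDEven (2 * h) n g) (by intro σ; simp [mem_toggle])
      (fun σ hσ h => ruleDEven_of_c (partD_eq_c (by omega) h.1 h.2))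
      (fun σ hσ h => ⟨h.1, 3, by omega, by omega, h.2⟩)
    convert this using 1
    ext σ
    simp only [Set.mem_ofPred_eq, and_assoc]

theorem tame_ruleDEven {d : ℕ} (hd : 2 ≤ d) (heven : Even d) (hw : IsWeightD n d w) (hn : 4 ≤ n)
    (hg : g ≤ n - 1) : Tame (complexA n 0 g) (ruleDEven d n g) w := by
  obtain ⟨h, rfl⟩ := even_iff_two_dvd.1 heven
  rcases (show 1 ≤ h by omega).eq_or_lt with rfl | hh
  · exact tame_ruleDEven_two hw hn
  · exact tame_ruleDEven_of_two_le hw hh hn hg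

end even

/-! ### The critical simplices for odd `d` -/

section critical

variable {n d : ℕ} {w : Finset ℕ → ℕ} {σ : Finset ℕ}

theorem mem_complexA_zero_iff : σ ∈ complexA n 0 0 ↔ σ ⊆ Finset.Icc 1 n :=
  ⟨fun h => h.1, fun h => ⟨h, by simp, by simp⟩⟩

theorem ruleDOdd_eq_none_iff : (σ ∈ complexA n 0 0 ∧ ruleDOdd d n σ = none) ↔
    (∀ i ≤ 1, i ∈ σ ↔ i ∈ (∅ : Finset ℕ)) ∧
      (shift 1 σ ∈ complexA (n - 1) 0 0 ∧ ruleA d (n - 1) 0 0 (shift 1 σ) = none) := by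
  have hs : (∀ i ≤ 1, i ∈ σ ↔ i ∈ (∅ : Finset ℕ)) ↔ 0 ∉ σ ∧ 1 ∉ σ := by
    constructor
    · intro h
      simpa using And.intro (h 0 (by omega)) (h 1 le_rfl)
    · rintro ⟨h0, h1⟩ i hi
      have : i = 0 ∨ i = 1 := by omega
      rcases this with rfl | rfl <;> simp [*]
  rw [hs]
  have hm : 0 ∉ σ → 1 ∉ σ → (shift 1 σ ∈ complexA (n - 1) 0 0 ↔ σ ∈ complexA n 0 0) := by
    intro h0 h1
    rw [mem_complexA_zero_iff, mem_complexA_zero_iff]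
    simp only [Finset.subset_iff, Finset.mem_Icc, mem_shift]
    constructor
    · intro h i hi
      have := @h (i - 1)
      grind
    · intro h i hi
      have := h hi.2
      omega
  constructor
  · rintro ⟨hσ, h⟩
    unfold ruleDOdd at h
    split_ifs at h with h1
    have h0 := zero_notMem_of_subset_Icc hσ.1
    exact ⟨⟨h0, h1⟩, (hm h0 h1).2 hσ, Option.map_eq_none_iff.1 h⟩
  · rintro ⟨⟨h0, h1⟩, hσ, h⟩
    refine ⟨(hm h0 h1).1 hσ, ?_⟩
    rw [ruleDOdd, if_neg h1, h, Option.map_none]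

/-- Only simplices without the vertex `1` can be unmatched. They are type `A_{n-1}` data with `f =
0`, so the residues `0` and `-1` of `n - 1` become `1` and `0` for `n`. -/
theorem card_eq_of_ruleDOdd_eq_none (hd : 3 ≤ d) (hn : 4 ≤ n) (hw : IsWeightD n d w)
    (hσ : σ ∈ complexA n 0 0) (h : ruleDOdd d n σ = none) :
    (∃ m, n = m * d + 1 ∧ σ.card = w σ + m * (d - 2)) ∨
      ∃ m, n = m * d ∧ σ.card = w σ + m * (d - 2) := by
  obtain ⟨h1, h2, h3⟩ := ruleDOdd_eq_none_iff.1 ⟨hσ, h⟩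
  have hc := card_eq_card_shift_add 1 σ
  rw [(filter_le_eq_iff (by simp)).2 h1, Finset.card_empty, add_zero] at hc
  rw [hw.eq_shift σ hσ.1 (by simpa using h1 1 le_rfl), hc]
  rcases card_eq_of_ruleA_eq_none (by omega) (by omega) h2 h3 with ⟨m, hm, _, h⟩ | ⟨m, hm, h⟩
  · exact Or.inl ⟨m, by omega, h⟩
  · exact Or.inr ⟨m, by omega, h⟩

theorem exists_two_ruleDOdd_eq_none (hd : 3 ≤ d) (hn : 4 ≤ n)
    (h : (∃ m, n = m * d + 1) ∨ ∃ m, n = m * d) :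
    ∃ σ₁ σ₂, σ₁ ≠ σ₂ ∧
      ∀ σ, (σ ∈ complexA n 0 0 ∧ ruleDOdd d n σ = none) ↔ σ = σ₁ ∨ σ = σ₂ := by
  refine exists_two_of_shift (m := 1) (P := ∅) (by simp)
    (exists_two_ruleA_eq_none (d := d) (n := n - 1) (f := 0) (by omega) (by omega) (by omega) ?_)
    (fun τ hτ => zero_notMem_of_subset_Icc hτ.1.1) fun σ => ruleDOdd_eq_none_iff
  rcases h with ⟨m, hm⟩ | ⟨m, hm⟩
  · exact Or.inl ⟨m, by omega⟩
  · exact Or.inr ⟨m, by omega⟩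

/-! ### The critical simplices for even `d` -/

/-- The three cases for the critical simplices `σ` of the matching for even `d`. -/
def CriticalData (n d : ℕ) (w : Finset ℕ → ℕ) (σ : Finset ℕ) : Prop :=
  (∃ m, n = m * d ∧ σ.card = w σ + m * (d - 2) ∧ partD d n σ ∈ originsZero n d) ∨
  (∃ m, n = m * d + 1 ∧ σ.card = w σ + m * (d - 2) ∧ partD d n σ = .a) ∨
  (4 ≤ d ∧ ∃ m, n = m * d + d / 2 + 1 ∧ σ.card = w σ + m * (d - 2) + d / 2 ∧
    partD d n σ ∈ originsHalf d)

theorem relabel_mem_complexA_iff (h0 : 0 ∉ σ) (h2 : 2 ∉ σ) (hn : 4 ≤ n) :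
    relabel σ ∈ complexA (n - 1) 0 0 ↔ σ ∈ complexA n 0 0 := by
  rw [mem_complexA_zero_iff, mem_complexA_zero_iff]
  simp only [Finset.subset_iff, Finset.mem_Icc, mem_relabel h0 h2]
  constructor
  · intro h i hi
    have := @h (i - 1)
    have := @h 1
    grind
  · grind

theorem criticalData_a (hd : 2 ≤ d) (hn : 4 ≤ n) (hw : IsWeightD n d w)
    (hσ : σ ∈ complexA n 0 0) (h2 : 2 ∉ σ) (h : ruleDEven d n 0 σ = none) :
    CriticalData n d w σ := by
  have hp : partD d n σ = .a := partD_eq_a h2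
  have h0 := zero_notMem_of_subset_Icc hσ.1
  rw [ruleDEven_of_a hp, Option.map_eq_none_iff] at h
  unfold CriticalData
  rw [hp, hw.eq_relabel σ hσ.1 h2, ← card_relabel h0 h2]
  rcases card_eq_of_ruleA_eq_none hd (by omega) ((relabel_mem_complexA_iff h0 h2 hn).2 hσ) h with
    ⟨m, hm, _, h⟩ | ⟨m, hm, h⟩
  · exact Or.inr (Or.inl ⟨m, by omega, h, rfl⟩)
  · exact Or.inl ⟨m, by omega, h, Or.inl rfl⟩

theorem criticalData_b (hn : 4 ≤ n) (hw : IsWeightD n 2 w) (hσ : σ ∈ complexA n 0 0) (h2 : 2 ∈ σ)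
    (h14 : ¬ Finset.Icc 1 4 ⊆ σ) (h : ruleDEven 2 n 0 σ = none) : CriticalData n 2 w σ := by
  have hp : partD 2 n σ = .b := partD_eq_b rfl h2 h14
  rw [ruleDEven_of_b hp] at h
  split_ifs at h with h1 h5 h3
  · obtain rfl : n = 4 := by omega
    have h3 : 3 ∉ σ := fun h3 => h14
      (Icc_one_four_subset (h1 (by simp)) h2 h3 (h1 (by simp)))
    obtain rfl : σ = {1, 2, 4} := by
      refine Finset.Subset.antisymm (fun i hi => ?_) h1
      have := Finset.mem_Icc.1 (hσ.1 hi)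
      have : i ≠ 3 := fun h => h3 (h ▸ hi)
      simp only [Finset.mem_insert, Finset.mem_singleton]
      omega
    left
    refine ⟨2, rfl, ?_, ?_⟩
    · rw [hw.eq_add _ hσ.1 2 le_rfl (by decide) (by decide)]
      decide
    · rw [hp]
      exact Or.inr (Or.inl ⟨rfl, rfl, rfl⟩)
  · omega

/-- The initial part has two vertices and weight zero, or three vertices and weight one. Either way
it contributes two to the defect, so the ignored vertex `1` is harmless. -/
theorem criticalData_d (hn : 4 ≤ n) (hw : IsWeightD n 4 w) (hσ : σ ∈ complexA n 0 0) (h2 : 2 ∈ σ)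
    (h3 : 3 ∈ σ) (h4 : 4 ∉ σ) (h : ruleDEven 4 n 0 σ = none) : CriticalData n 4 w σ := by
  have hp : partD 4 n σ = .d := partD_eq_d rfl h2 h3 h4
  have h0 := zero_notMem_of_subset_Icc hσ.1
  rw [ruleDEven_of_d hp, Option.map_eq_none_iff] at h
  have hmem : shift 4 σ ∈ complexA (n - 4) 0 0 := by
    rw [shift_mem_complexA_iff (by omega)]
    exact ⟨fun i hi => (Finset.mem_Icc.1 (hσ.1 hi)).2, by simp, by simp⟩
  have hc := card_eq_card_shift_add 4 σ
  have hfil : (σ.filter (· ≤ 4)).card = 2 + if 1 ∈ σ then 1 else 0 := by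
    have : σ.filter (· ≤ 4) = if 1 ∈ σ then {1, 2, 3} else {2, 3} := by
      ext i
      rw [Finset.mem_filter]
      have : i = 0 ∨ i = 1 ∨ i = 2 ∨ i = 3 ∨ i = 4 ∨ 4 < i := by omega
      rcases this with rfl | rfl | rfl | rfl | rfl | hi
      · split_ifs <;> simp [h0]
      · split_ifs with h1 <;> simp [h1]
      · split_ifs <;> simp [h2]
      · split_ifs <;> simp [h3]
      · split_ifs <;> simp [h4]
      · split_ifs <;> simp <;> omega
    rw [this]
    split_ifs <;> rfl
  have hwσ := weightD_of_four_notMem hw hσ.1 h2 h3 h4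
  unfold CriticalData
  rw [hp]
  rcases card_eq_of_ruleA_eq_none (by omega) (by omega) hmem h with ⟨m, hm, _, h⟩ | ⟨m, hm, h⟩
  · exact Or.inl ⟨m + 1, by omega, by omega, Or.inr (Or.inr (Or.inl ⟨rfl, rfl⟩))⟩
  · exact Or.inr (Or.inr ⟨le_rfl, m, by omega, by omega, Or.inl ⟨rfl, rfl⟩⟩)

variable {h : ℕ}

/-- Deleting the absent vertex `1` gives type `A_{n-1}` with `f = max h 3`. The residue `n - 1 ≡ f`
requires `f + 1 < d`, which forces `h ≥ 3` and `f = h`. -/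
theorem criticalData_f (hn : 4 ≤ n) (hh : 2 ≤ h) (hw : IsWeightD n (2 * h) w)
    (hσ : σ ∈ complexA n 0 0) (h1 : 1 ∉ σ) (h2 : 2 ∈ σ) (h3 : 3 ∈ σ) (h4 : 4 ∈ σ)
    (hr : ruleDEven (2 * h) n 0 σ = none) : CriticalData n (2 * h) w σ := by
  have hd2 : 2 * h / 2 = h := Nat.mul_div_cancel_left _ (by norm_num)
  have hp : partD (2 * h) n σ = .f := partD_eq_f (by omega) h2 h3 h4 h1
  have h0 := zero_notMem_of_subset_Icc hσ.1
  rw [ruleDEven_of_f hp, hd2] at hr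
  split_ifs at hr with hsub
  rw [Option.map_eq_none_iff] at hr
  have hmem : shift 1 σ ∈ complexA (n - 1) (max h 3) 0 := by
    rw [shift_mem_complexA_iff (by omega)]
    refine ⟨fun i hi => (Finset.mem_Icc.1 (hσ.1 hi)).2, fun i hi => ?_, by simp⟩
    rw [Finset.mem_Icc] at hi
    by_cases hi1 : i ≤ h + 1
    · exact hsub (Finset.mem_Icc.2 (by omega))
    · have : i = 2 ∨ i = 3 ∨ i = 4 := by omega
      rcases this with rfl | rfl | rfl <;> assumption
  have hc := card_eq_card_shift_add 1 σ
  have hfil : σ.filter (· ≤ 1) = ∅ := by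
    rw [filter_le_eq_iff (by simp)]
    intro i hi
    have : i = 0 ∨ i = 1 := by omega
    rcases this with rfl | rfl <;> simp [*]
  rw [hfil, Finset.card_empty, add_zero] at hc
  unfold CriticalData
  rw [hp, hw.eq_shift σ hσ.1 h1, hd2, hc]
  have horig : h = 2 → n = 4 := by
    rintro rfl
    have := eq_of_ruleA_eq_none_of_pred (d := 4) (by norm_num) hmem hr
    omega
  rcases card_eq_of_ruleA_eq_none (by omega) (by omega) hmem hr with ⟨m, hm, _, h⟩ | ⟨m, hm, h⟩
  · exact Or.inr (Or.inr ⟨by omega, m, by omega, by omega, Or.inr (Or.inl ⟨rfl, by omega⟩)⟩)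
  · refine Or.inl ⟨m, by omega, by omega, Or.inr (Or.inr (Or.inr (Or.inl ⟨rfl, ?_⟩)))⟩
    omega

theorem card_filter_le_of_Icc_subset {a v : ℕ} (hσ : σ ⊆ Finset.Icc 1 n) (hv : v = a + 1)
    (h : Finset.Icc 1 a ⊆ σ) (hvσ : v ∉ σ) : (σ.filter (· ≤ v)).card = a := by
  have : σ.filter (· ≤ v) = Finset.Icc 1 a := by
    ext i
    rw [Finset.mem_filter]
    constructor
    · rintro ⟨h1, h2⟩
      have := Finset.mem_Icc.1 (hσ h1)
      have : i ≠ v := fun h => hvσ (h ▸ h1)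
      rw [Finset.mem_Icc]
      omega
    · intro hi
      refine ⟨h hi, ?_⟩
      rw [Finset.mem_Icc] at hi
      omega
  rw [this, Nat.card_Icc, Nat.add_sub_cancel]

/-- With `q = 2c` the initial component has `cd` vertices and weight `2c`, hence defect `c(d - 2)`.
In (g2.1) this is the whole simplex; in (g2.2) the recursive call with `f = h` adds its defect. -/
theorem criticalData_g_even (hh : 1 ≤ h) (hw : IsWeightD n (2 * h) w) {q : ℕ} (hq : Even q)
    (h4 : 4 ≤ q * h) (hσ : σ ∈ initialSegment n 0 (q * h) ((q + 1) * h + 1))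
    (hr : ruleDEven (2 * h) n 0 σ = none) : CriticalData n (2 * h) w σ := by
  have hd2 : 2 * h / 2 = h := Nat.mul_div_cancel_left _ (by norm_num)
  have hp := partD_of_mem_even hh hq h4 hσ
  obtain ⟨hq1, hv⟩ := quotD_of_mem_even hh hq hσ
  obtain ⟨c, rfl⟩ := even_iff_two_dvd.1 hq
  have hc1 : 1 ≤ c := by
    by_contra h0
    obtain rfl : c = 0 := by omega
    omega
  have e1 : 2 * c * h = c * (2 * h) := by ring
  -- Writing `h = l + 1` removes the truncated subtraction in `d - 2`, so that linear arithmetic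
  -- applies.
  obtain ⟨l, rfl⟩ : ∃ l, h = l + 1 := ⟨h - 1, by omega⟩
  have e2 : 2 * (l + 1) - 2 = 2 * l := by omega
  have e3 : c * (2 * (l + 1)) = c * (2 * l) + 2 * c := by ring
  have hcomp := weightDComp_even hh hq (by omega) (Nat.zero_le (l + 1))
  rw [add_zero] at hcomp
  unfold CriticalData
  split_ifs at hp with g1 g2 g3
  · rw [ruleDEven_of_g1 hp, hv, Nat.sub_zero, if_pos (Finset.mem_Icc.1 (hσ.1.1 g1)).2] at hr
    cases hr
  · have hn : n = 2 * c * (l + 1) := by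
      have := Finset.mem_Icc.1 (hσ.1.1 (hσ.2.1 (Finset.mem_Icc.2
        (show 1 ≤ 2 * c * (l + 1) ∧ 2 * c * (l + 1) ≤ 2 * c * (l + 1) by omega))))
      omega
    have hσn : σ = Finset.Icc 1 n := Finset.Subset.antisymm hσ.1.1 (hn ▸ hσ.2.1)
    have hwσ := hw.eq_add σ hσ.1.1 (2 * c * (l + 1)) (by omega) hσ.2.1 g1
    have hs : shift (2 * c * (l + 1) + 1) σ = ∅ := by
      ext i
      rw [hσn, mem_shift, Finset.mem_Icc]
      simp
      omega
    rw [hs, weightA_empty, hcomp] at hwσ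
    have hcard : σ.card = n := by rw [hσn, Nat.card_Icc, Nat.add_sub_cancel]
    left
    refine ⟨c, by omega, by rw [e2]; omega, ?_⟩
    rw [hp]
    simp [originsZero]
  · rw [ruleDEven_of_g22 hp hq1, hd2, Option.map_eq_none_iff] at hr
    have hwσ := hw.eq_add σ hσ.1.1 (2 * c * (l + 1)) (by omega) hσ.2.1 g1
    rw [hcomp] at hwσ
    have hcard := card_eq_card_shift_add (2 * c * (l + 1) + 1) σ
    rw [card_filter_le_of_Icc_subset hσ.1.1 rfl hσ.2.1 g1] at hcard
    have hb : (2 * c + 1) * (l + 1) + 1 = l + 1 + (2 * c * (l + 1) + 1) := by ring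
    have hmem : shift (2 * c * (l + 1) + 1) σ ∈
        complexA (n - (2 * c * (l + 1) + 1)) (l + 1) 0 := by
      rw [shift_mem_complexA_iff (by omega)]
      refine ⟨fun i hi => (Finset.mem_Icc.1 (hσ.1.1 hi)).2, ?_, by simp⟩
      convert g3 using 2 <;> omega
    rcases card_eq_of_ruleA_eq_none (by omega) (by omega) hmem hr with ⟨m, hm, hl, h⟩ | ⟨m, hm, h⟩
    · right; right
      refine ⟨by omega, c + m, ?_, ?_, ?_⟩
      · rw [hd2, add_mul]; omega
      · rw [hd2, add_mul]; rw [e2] at *; omega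
      · rw [hp]; simp [originsHalf]
    · left
      refine ⟨c + m, ?_, ?_, ?_⟩
      · rw [add_mul]; omega
      · rw [add_mul]; rw [e2] at *; omega
      · rw [hp]; simp [originsZero]
  · rw [ruleDEven_of_g2 hp] at hr
    cases hr

/-- With `q = 2c + 1` the initial component has `qh + 1` vertices and weight `q`, hence defect `c(d
- 2) + h`. A full simplex thus falls into the class of `h + 1`; in (g2.3) the call with `f = h - 2`
leads to this class or to that of `0`. -/
theorem criticalData_g_odd (hw : IsWeightD n (2 * h) w) {q : ℕ} (hq : Odd q)
    (h4 : 4 ≤ q * h + 1) (hσ : σ ∈ initialSegment n 0 (q * h + 1) ((q + 1) * h))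
    (hr : ruleDEven (2 * h) n 0 σ = none) : CriticalData n (2 * h) w σ := by
  have hd2 : 2 * h / 2 = h := Nat.mul_div_cancel_left _ (by norm_num)
  have hh : 2 ≤ h := by
    by_contra hlt
    refine hσ.2.2 ((Finset.Icc_subset_Icc_right ?_).trans hσ.2.1)
    rw [add_mul]
    omega
  have hp := partD_of_mem_odd hq h4 hσ
  obtain ⟨hq1, hv⟩ := quotD_of_mem_odd hq hσ
  obtain ⟨c, rfl⟩ := hq
  obtain ⟨l, rfl⟩ : ∃ l, h = l + 2 := ⟨h - 2, by omega⟩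
  have e2 : 2 * (l + 2) - 2 = 2 * l + 2 := by omega
  have e1 : (2 * c + 1) * (l + 2) = c * (2 * l + 2) + 2 * c + l + 2 := by ring
  have e3 : c * (2 * (l + 2)) = c * (2 * l + 2) + 2 * c := by ring
  have hcomp := weightDComp_odd (h := l + 2) (q := 2 * c + 1) le_rfl (by omega)
  unfold CriticalData
  split_ifs at hp with g1 g2 g3
  · rw [ruleDEven_of_g1 hp, hv, Nat.sub_zero, if_pos (Finset.mem_Icc.1 (hσ.1.1 g1)).2] at hr
    cases hr
  · have hn : n = (2 * c + 1) * (l + 2) + 1 := by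
      have := Finset.mem_Icc.1 (hσ.1.1 (hσ.2.1 (Finset.mem_Icc.2
        (show 1 ≤ (2 * c + 1) * (l + 2) + 1 ∧
          (2 * c + 1) * (l + 2) + 1 ≤ (2 * c + 1) * (l + 2) + 1 by omega))))
      omega
    have hσn : σ = Finset.Icc 1 n := Finset.Subset.antisymm hσ.1.1 (hn ▸ hσ.2.1)
    have hwσ := hw.eq_add σ hσ.1.1 ((2 * c + 1) * (l + 2) + 1) (by omega) hσ.2.1 g1
    have hs : shift ((2 * c + 1) * (l + 2) + 1 + 1) σ = ∅ := by
      ext i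
      rw [hσn, mem_shift, Finset.mem_Icc]
      simp
      omega
    rw [hs, weightA_empty, hcomp] at hwσ
    have hcard : σ.card = n := by rw [hσn, Nat.card_Icc, Nat.add_sub_cancel]
    right; right
    refine ⟨by omega, c, by omega, by rw [e2]; omega, ?_⟩
    rw [hp]
    simp [originsHalf]
  · rw [ruleDEven_of_g23 hp hq1, hd2, Option.map_eq_none_iff] at hr
    have hwσ := hw.eq_add σ hσ.1.1 ((2 * c + 1) * (l + 2) + 1) (by omega) hσ.2.1 g1
    rw [hcomp, add_assoc _ 1 1, one_add_one_eq_two] at hwσ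
    have hcard := card_eq_card_shift_add ((2 * c + 1) * (l + 2) + 2) σ
    rw [card_filter_le_of_Icc_subset hσ.1.1 rfl hσ.2.1 g1] at hcard
    have hb : (2 * c + 1 + 1) * (l + 2) = l + 2 + (2 * c + 1) * (l + 2) := by ring
    have hmem : shift ((2 * c + 1) * (l + 2) + 2) σ ∈
        complexA (n - ((2 * c + 1) * (l + 2) + 2)) (l + 2 - 2) 0 := by
      rw [shift_mem_complexA_iff (by omega)]
      refine ⟨fun i hi => (Finset.mem_Icc.1 (hσ.1.1 hi)).2, ?_, by simp⟩
      convert g3 using 2 <;> omega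
    rcases card_eq_of_ruleA_eq_none (by omega) (by omega) hmem hr with ⟨m, hm, hl, h⟩ | ⟨m, hm, h⟩
    · left
      refine ⟨c + m + 1, ?_, ?_, ?_⟩
      · rw [add_mul, add_mul]; omega
      · rw [add_mul, add_mul]; rw [e2] at *; omega
      · rw [hp]; simp [originsZero]
    · right; right
      refine ⟨by omega, c + m, ?_, ?_, ?_⟩
      · rw [hd2, add_mul]; omega
      · rw [hd2, add_mul]; rw [e2] at *; omega
      · rw [hp]; simp [originsHalf]
  · rw [ruleDEven_of_g2 hp] at hr
    cases hr

theorem criticalData_of_ruleDEven_eq_none (hd : 2 ≤ d) (heven : Even d) (hn : 4 ≤ n)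
    (hw : IsWeightD n d w) (hσ : σ ∈ complexA n 0 0) (hr : ruleDEven d n 0 σ = none) :
    CriticalData n d w σ := by
  obtain ⟨h, rfl⟩ := even_iff_two_dvd.1 heven
  by_cases h2 : 2 ∈ σ
  swap; · exact criticalData_a hd hn hw hσ h2 hr
  have key : Finset.Icc 1 4 ⊆ σ → Finset.Icc 1 (h + 1) ⊆ σ → CriticalData n (2 * h) w σ := by
    intro h14 hh1
    rcases mem_initialSegment_of_quotD (by omega) hσ h14 hh1 rfl with
      ⟨hq, h4, _, hm⟩ | ⟨hq, h4, _, hm⟩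
    · exact criticalData_g_even (by omega) hw hq h4 hm hr
    · exact criticalData_g_odd hw hq h4 hm hr
  -- For `h = 1` only parts (b) and (g) remain; for larger `h` the fixed-vertex pieces are
  -- eliminated and (d), (f) and (g) are left.
  rcases (show 1 ≤ h by omega).eq_or_lt with rfl | hh
  · by_cases h14 : Finset.Icc 1 4 ⊆ σ
    · exact key h14 ((Finset.Icc_subset_Icc_right (by norm_num)).trans h14)
    · exact criticalData_b hn hw hσ h2 h14 hr
  by_cases h3 : 3 ∈ σ
  swap
  · rw [ruleDEven_of_c (partD_eq_c (by omega) h2 h3)] at hr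
    cases hr
  by_cases h4 : 4 ∈ σ
  swap
  · rcases (show 2 ≤ h by omega).eq_or_lt with rfl | hh3
    · exact criticalData_d hn hw hσ h2 h3 h4 hr
    · rw [ruleDEven_of_e (partD_eq_e (by omega) h2 h3 h4)] at hr
      cases hr
  by_cases hsub : Finset.Icc 2 (h + 1) ⊆ σ
  swap
  · rw [ruleDEven_eq_some_one hh hσ.1 (by omega) hn h2 h3 h4 hsub] at hr
    cases hr
  by_cases h1 : 1 ∈ σ
  swap; · exact criticalData_f hn hh hw hσ h1 h2 h3 h4 hr
  refine key (Icc_one_four_subset h1 h2 h3 h4) fun i hi => ?_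
  rw [Finset.mem_Icc] at hi
  by_cases hi1 : i = 1
  · exact hi1 ▸ h1
  · exact hsub (Finset.mem_Icc.2 (by omega))

/-! ### The existence of critical simplices for even `d` -/

theorem exists_critical_a (hd : 2 ≤ d) (hn : 4 ≤ n) (h : (∃ m, n = m * d + 1) ∨ ∃ m, n = m * d) :
    ∃ σ, (σ ∈ complexA n 0 0 ∧ ruleDEven d n 0 σ = none) ∧ partD d n σ = .a := by
  obtain ⟨τ, hτ, hτn⟩ : ∃ τ ∈ complexA (n - 1) 0 0, ruleA d (n - 1) 0 0 τ = none := by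
    refine exists_ruleA_eq_none hd (by omega) (by omega) ?_
    rcases h with ⟨m, hm⟩ | ⟨m, hm⟩
    · exact Or.inl ⟨m, by omega⟩
    · exact Or.inr ⟨m, by omega⟩
  obtain ⟨σ, h0, h2, rfl⟩ := exists_relabel_eq (zero_notMem_of_subset_Icc hτ.1)
  have hp : partD d n σ = .a := partD_eq_a h2
  exact ⟨σ, ⟨(relabel_mem_complexA_iff h0 h2 hn).1 hτ, by rw [ruleDEven_of_a hp, hτn]; rfl⟩, hp⟩

theorem exists_critical_b :
    ∃ σ, (σ ∈ complexA 4 0 0 ∧ ruleDEven 2 4 0 σ = none) ∧ partD 2 4 σ = .b := by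
  have hp : partD 2 4 {1, 2, 4} = .b := partD_eq_b rfl (by simp) (by decide)
  exact ⟨{1, 2, 4}, ⟨mem_complexA_zero_iff.2 (by decide), by rw [ruleDEven_of_b hp]; simp⟩, hp⟩

theorem exists_critical_d (hn : 4 ≤ n) (h : (∃ m, n = m * 4) ∨ ∃ m, n + 1 = m * 4) :
    ∃ σ, (σ ∈ complexA n 0 0 ∧ ruleDEven 4 n 0 σ = none) ∧ partD 4 n σ = .d := by
  obtain ⟨τ, hτ, hτn⟩ : ∃ τ ∈ complexA (n - 4) 0 0, ruleA 4 (n - 4) 0 0 τ = none := by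
    refine exists_ruleA_eq_none (by norm_num) (by omega) (by omega) ?_
    rcases h with ⟨m, hm⟩ | ⟨m, hm⟩
    · exact Or.inl ⟨m - 1, by omega⟩
    · exact Or.inr ⟨m - 1, by omega⟩
  -- Since the vertex `1` is ignored in part (d), `{1, 2, 3}` would serve equally well.
  obtain ⟨σ, h0, hfil, rfl⟩ := exists_shift_eq 4 (P := {2, 3}) (by decide)
    (zero_notMem_of_subset_Icc hτ.1)
  rw [filter_le_eq_iff (by decide)] at hfil
  have hp : partD 4 n σ = .d := partD_eq_d rfl ((hfil 2 (by omega)).2 (by simp))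
    ((hfil 3 (by omega)).2 (by simp)) (fun h => by simpa using (hfil 4 (by omega)).1 h)
  rw [shift_mem_complexA_iff (by omega)] at hτ
  refine ⟨σ, ⟨mem_complexA_zero_iff.2 fun i hi => Finset.mem_Icc.2 ⟨?_, hτ.1 i hi⟩,
    by rw [ruleDEven_of_d hp, hτn]; rfl⟩, hp⟩
  exact Nat.one_le_iff_ne_zero.2 fun h => h0 (h ▸ hi)

theorem exists_critical_f (hn : 4 ≤ n) (hh : 2 ≤ h) (hexists :
      ∃ τ ∈ complexA (n - 1) (max h 3) 0, ruleA (2 * h) (n - 1) (max h 3) 0 τ = none) :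
    ∃ σ, (σ ∈ complexA n 0 0 ∧ ruleDEven (2 * h) n 0 σ = none) ∧ partD (2 * h) n σ = .f := by
  have hd2 : 2 * h / 2 = h := Nat.mul_div_cancel_left _ (by norm_num)
  obtain ⟨τ, hτ, hτn⟩ := hexists
  obtain ⟨σ, h0, hfil, rfl⟩ := exists_shift_eq 1 (P := ∅) (by simp)
    (zero_notMem_of_subset_Icc hτ.1)
  rw [filter_le_eq_iff (by simp)] at hfil
  rw [shift_mem_complexA_iff (by omega)] at hτ
  have hsub : ∀ i, 2 ≤ i → i ≤ max h 3 + 1 → i ∈ σ := fun i h3 h4 =>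
    hτ.2.1 (Finset.mem_Icc.2 ⟨by omega, h4⟩)
  have hp : partD (2 * h) n σ = .f := partD_eq_f (by omega) (hsub 2 (by omega) (by omega))
    (hsub 3 (by omega) (by omega)) (hsub 4 (by omega) (by omega))
    (fun h => by simpa using (hfil 1 (by omega)).1 h)
  refine ⟨σ, ⟨mem_complexA_zero_iff.2 fun i hi => Finset.mem_Icc.2 ⟨?_, hτ.1 i hi⟩, ?_⟩, hp⟩
  · exact Nat.one_le_iff_ne_zero.2 fun h => h0 (h ▸ hi)
  · rw [ruleDEven_of_f hp, hd2, hτn, if_pos]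
    · rfl
    · intro i hi
      rw [Finset.mem_Icc] at hi
      exact hsub i hi.1 (by omega)

theorem exists_critical_f_of_three_le (hn : 4 ≤ n) (hh : 3 ≤ h) (hmod : (∃ m, n = m * (2 * h)) ∨
      ∃ m, n = m * (2 * h) + h + 1) :
    ∃ σ, (σ ∈ complexA n 0 0 ∧ ruleDEven (2 * h) n 0 σ = none) ∧ partD (2 * h) n σ = .f := by
  refine exists_critical_f hn (by omega) ?_
  rw [max_eq_left hh]
  refine exists_ruleA_eq_none (by omega) (by omega) ?_ ?_
  · rcases hmod with ⟨m, hm⟩ | ⟨m, hm⟩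
    · rcases Nat.eq_zero_or_pos m with rfl | hm0
      · omega
      · have := Nat.le_mul_of_pos_left (2 * h) hm0
        omega
    · omega
  · rcases hmod with ⟨m, hm⟩ | ⟨m, hm⟩
    · exact Or.inr ⟨m, by omega⟩
    · exact Or.inl ⟨m, by omega⟩

theorem exists_critical_f_four :
    ∃ σ, (σ ∈ complexA 4 0 0 ∧ ruleDEven 4 4 0 σ = none) ∧ partD 4 4 σ = .f :=
  exists_critical_f (h := 2) le_rfl le_rfl
    ⟨Finset.Icc 1 3, ⟨le_rfl, by simp, by simp⟩, ruleA_of_le (by simp)⟩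

/-- The full simplex works: its component has size `n`, and in both residue classes the vertex `v`
is `n + 1`. -/
theorem exists_critical_g21 (hn : 4 ≤ n) (hh : 1 ≤ h) (hmod : (∃ m, n = m * (2 * h)) ∨
      2 ≤ h ∧ ∃ m, n = m * (2 * h) + h + 1) :
    ∃ σ, (σ ∈ complexA n 0 0 ∧ ruleDEven (2 * h) n 0 σ = none) ∧ partD (2 * h) n σ = .g21 := by
  have hnot : ∀ i, n < i → i ∉ Finset.Icc 1 n := fun i hi h => by
    have := Finset.mem_Icc.1 h
    omega
  have hp : partD (2 * h) n (Finset.Icc 1 n) = .g21 := by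
    rcases hmod with ⟨m, hm⟩ | ⟨hh2, m, hm⟩
    · have e : m * (2 * h) = 2 * m * h := by ring
      rw [e] at hm
      have he : (2 * m + 1) * h = n + h := by rw [hm]; ring
      rw [partD_of_mem_even (q := 2 * m) (g := 0) hh (even_two_mul m) (by omega),
        if_neg (hnot _ (by omega)), if_pos (by omega)]
      refine ⟨mem_complexA_zero_iff.2 le_rfl, by rw [hm], fun hs => ?_⟩
      exact hnot ((2 * m + 1) * h + 1) (by omega) (hs (Finset.mem_Icc.2 (by omega)))
    · have e : m * (2 * h) + h + 1 = (2 * m + 1) * h + 1 := by ring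
      rw [e] at hm
      have he : (2 * m + 1 + 1) * h + 1 = n + h := by rw [hm]; ring
      rw [partD_of_mem_odd (q := 2 * m + 1) (g := 0) ⟨m, rfl⟩ (by omega),
        if_neg (hnot _ (by omega)), if_pos (by omega)]
      refine ⟨mem_complexA_zero_iff.2 le_rfl, by rw [hm], fun hs => ?_⟩
      exact hnot ((2 * m + 1 + 1) * h) (by omega) (hs (Finset.mem_Icc.2 (by omega)))
  exact ⟨_, ⟨mem_complexA_zero_iff.2 le_rfl, ruleDEven_of_g21 hp⟩, hp⟩

end critical

/-! ### The action of a Coxeter group of type `D` by signed permutations -/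

/-- The simple reflections of type `D` as signed permutations: the vertex `i ≥ 2` exchanges `i - 1`
and `i`, and the vertex `1` exchanges `1` and `-2`. -/
def act (i : ℕ) (x : ℤ) : ℤ :=
  if i = 1 then
    if x = 1 then -2 else if x = -2 then 1 else if x = 2 then -1 else if x = -1 then 2 else x
  else
    if x = i then i - 1 else if x = i - 1 then i else if x = -i then -(i - 1)
    else if x = -(i - 1) then -i else x

theorem act_act {i : ℕ} (hi : 1 ≤ i) (x : ℤ) : act i (act i x) = x := by
  unfold act; grind (splits := 30)

theorem act_neg {i : ℕ} (hi : 1 ≤ i) (x : ℤ) : act i (-x) = - act i x := by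
  unfold act; grind (splits := 30)

theorem act_comm {i j : ℕ} (hi : 1 ≤ i) (hj : 1 ≤ j) (h : ¬ AdjD i j) (x : ℤ) :
    act i (act j x) = act j (act i x) := by
  unfold act AdjD at *; grind (splits := 30)

theorem act_braid_succ {i : ℕ} (hi : 2 ≤ i) (x : ℤ) :
    act i (act (i + 1) (act i x)) = act (i + 1) (act i (act (i + 1) x)) := by
  unfold act; grind (splits := 30)

theorem act_braid_one_three (x : ℤ) :
    act 1 (act 3 (act 1 x)) = act 3 (act 1 (act 3 x)) := by
  unfold act; grind (splits := 30)

theorem act_braid {i j : ℕ} (h : AdjD i j) (x : ℤ) :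
    act i (act j (act i x)) = act j (act i (act j x)) := by
  rcases h with ⟨rfl, rfl⟩ | ⟨h, rfl⟩ | ⟨rfl, rfl⟩ | ⟨h, rfl⟩
  · exact act_braid_one_three x
  · exact act_braid_succ h x
  · exact (act_braid_one_three x).symm
  · exact (act_braid_succ h x).symm

theorem abs_act_le {i m : ℕ} (hi : 1 ≤ i) (hm : 2 ≤ m) (him : i ≤ m) {x : ℤ} (hx : |x| ≤ m) :
    |act i x| ≤ m := by
  rw [abs_le] at *
  unfold act; grind (splits := 30)

theorem act_zero {i : ℕ} (hi : 1 ≤ i) : act i 0 = 0 := by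
  unfold act; grind

/-- Only one pair of opposite pairs changes its order under a simple reflection. -/
theorem eq_or_eq_neg_of_act_lt_act {i : ℕ} (hi : 1 ≤ i) {x y x' y' : ℤ} (hx : x ≠ 0) (hy : y ≠ 0)
    (hxy : x < y) (hne : x ≠ -y) (h : act i y < act i x) (hx' : x' ≠ 0) (hy' : y' ≠ 0)
    (hxy' : x' < y') (hne' : x' ≠ -y') (h' : act i y' < act i x') :
    (x' = x ∧ y' = y) ∨ (x' = -y ∧ y' = -x) := by
  -- All pairs of nonzero, non-opposite letters inverted by `act i`: one pair and its negative, for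
  -- `i = 1` and for `i ≥ 2`.
  have key : ∀ x y : ℤ, x ≠ 0 → y ≠ 0 → x < y → x ≠ -y → act i y < act i x →
      (i = 1 ∧ ((x = -1 ∧ y = 2) ∨ (x = -2 ∧ y = 1))) ∨
      (2 ≤ i ∧ ((x = i - 1 ∧ y = i) ∨ (x = -i ∧ y = -(i - 1)))) := by
    intro x y hx hy hxy hne h
    unfold act at h; grind (splits := 30)
  have h1 := key x y hx hy hxy hne h
  have h2 := key x' y' hx' hy' hxy' hne' h'
  omega

section signedPerm

variable {n : ℕ} {W : Type*} [Group W]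

/-- A simple reflection of type `D` as a permutation of the integers. -/
def actPerm (i : Finset.Icc 1 n) : Equiv.Perm ℤ where
  toFun := act i
  invFun := act i
  left_inv := act_act (Finset.mem_Icc.1 i.2).1
  right_inv := act_act (Finset.mem_Icc.1 i.2).1

theorem typeD_apply (i j : Finset.Icc 1 n) : typeD n i j =
    if (i : ℕ) = (j : ℕ) then 1 else if AdjD i j then 3 else 2 := rfl

theorem isLiftable_actPerm : (typeD n).IsLiftable (actPerm (n := n)) := by
  rintro ⟨i, hi⟩ ⟨j, hj⟩
  rw [Finset.mem_Icc] at hi hj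
  ext x
  simp only [typeD_apply]
  split_ifs with h1 h2
  · obtain rfl := h1
    simp [actPerm, act_act hi.1]
  · simp only [actPerm, pow_succ, pow_zero, one_mul, Equiv.Perm.mul_apply, Equiv.coe_fn_mk,
      Equiv.Perm.one_apply]
    rw [act_braid h2, act_act hj.1, act_act hi.1, act_act hj.1]
  · simp only [actPerm, pow_succ, pow_zero, one_mul, Equiv.Perm.mul_apply, Equiv.coe_fn_mk,
      Equiv.Perm.one_apply]
    rw [act_comm hi.1 hj.1 h2, act_act hi.1, act_act hj.1]

variable (cs : CoxeterSystem (typeD n) W)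

/-- The homomorphism from a Coxeter group of type `D` to the group of signed permutations. -/
noncomputable def signedPerm : W →* Equiv.Perm ℤ := cs.lift ⟨actPerm, isLiftable_actPerm⟩

/-- The simple reflection with index `i` (the identity if `i` is not a vertex). -/
def gen (i : ℕ) : W := if h : i ∈ Finset.Icc 1 n then cs.simple ⟨i, h⟩ else 1

theorem gen_of_mem {i : ℕ} (h : i ∈ Finset.Icc 1 n) : gen cs i = cs.simple ⟨i, h⟩ := dif_pos h

theorem gen_mul_gen_self (i : ℕ) : gen cs i * gen cs i = 1 := by
  unfold gen
  split_ifs <;> simp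

theorem gen_mul_cancel_left (i : ℕ) (w : W) : gen cs i * (gen cs i * w) = w := by
  rw [← mul_assoc, gen_mul_gen_self, one_mul]

theorem signedPerm_gen_mul {i : ℕ} (h1 : 1 ≤ i) (hn : i ≤ n) (w : W) (x : ℤ) :
    signedPerm cs (gen cs i * w) x = act i (signedPerm cs w x) := by
  rw [map_mul, Equiv.Perm.mul_apply, gen_of_mem cs (Finset.mem_Icc.2 ⟨h1, hn⟩), signedPerm,
    cs.lift_apply_simple isLiftable_actPerm]
  rfl

theorem gen_comm {i j : ℕ} (h : ¬ AdjD i j) : gen cs i * gen cs j = gen cs j * gen cs i := by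
  by_cases hij : i = j
  · rw [hij]
  unfold gen
  split_ifs with h1 h2
  · have := cs.simple_mul_simple_pow ⟨i, h1⟩ ⟨j, h2⟩
    rw [typeD_apply, if_neg hij, if_neg h] at this
    rw [pow_two] at this
    rw [← mul_inv_eq_one, mul_inv_rev, cs.inv_simple, cs.inv_simple, this]
  all_goals simp only [one_mul, mul_one]

theorem gen_braid {i j : ℕ} (hi : i ∈ Finset.Icc 1 n) (hj : j ∈ Finset.Icc 1 n) (h : AdjD i j) :
    gen cs i * gen cs j * gen cs i = gen cs j * gen cs i * gen cs j := by
  have hij : i ≠ j := by unfold AdjD at h; omega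
  rw [gen_of_mem cs hi, gen_of_mem cs hj]
  have := cs.simple_mul_simple_pow ⟨i, hi⟩ ⟨j, hj⟩
  rw [typeD_apply, if_neg hij, if_pos h] at this
  rw [← mul_inv_eq_one, mul_inv_rev, mul_inv_rev, cs.inv_simple, cs.inv_simple]
  simpa only [pow_succ, pow_zero, one_mul, mul_assoc] using this

/-! ### Parabolic subgroups -/

theorem gen_mem_parabolic {i : ℕ} {σ : Finset ℕ} (hi : i ∈ σ) : gen cs i ∈ parabolic cs σ := by
  unfold gen
  split_ifs with h
  · exact Subgroup.subset_closure ⟨⟨i, h⟩, hi, rfl⟩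
  · exact one_mem _

theorem parabolic_mono {σ τ : Finset ℕ} (h : σ ⊆ τ) : parabolic cs σ ≤ parabolic cs τ :=
  Subgroup.closure_mono (Set.image_mono fun _ hs => h hs)

/-- The generators are involutions, so left multiplication by generators suffices and the inverse
case reduces to it. -/
theorem parabolic_induction {σ : Finset ℕ} {p : W → Prop} (one : p 1)
    (mul : ∀ i ∈ σ, 1 ≤ i → i ≤ n → ∀ w ∈ parabolic cs σ, p w → p (gen cs i * w)) :
    ∀ w ∈ parabolic cs σ, p w := by
  intro w hw
  induction hw using Subgroup.closure_induction_left with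
  | one => exact one
  | mul_left x hx y hy ih =>
    obtain ⟨s, hs, rfl⟩ := hx
    have h := Finset.mem_Icc.1 s.2
    have := mul s hs h.1 h.2 y hy ih
    rwa [gen_of_mem cs s.2] at this
  | inv_mul_cancel x hx y hy ih =>
    obtain ⟨s, hs, rfl⟩ := hx
    have h := Finset.mem_Icc.1 s.2
    have := mul s hs h.1 h.2 y hy ih
    rwa [gen_of_mem cs s.2, ← cs.inv_simple] at this

theorem top_induction {p : W → Prop} (one : p 1)
    (mul : ∀ i, 1 ≤ i → i ≤ n → ∀ w, p w → p (gen cs i * w)) (w : W) : p w := by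
  induction w using cs.simple_induction_left with
  | one => exact one
  | mul_simple_left w s ih =>
    have h := Finset.mem_Icc.1 s.2
    have := mul s h.1 h.2 w ih
    rwa [gen_of_mem cs s.2] at this

theorem signedPerm_neg (w : W) (x : ℤ) : signedPerm cs w (-x) = - signedPerm cs w x := by
  induction w using top_induction cs generalizing x with
  | one => simp
  | mul i h1 hn w ih => rw [signedPerm_gen_mul cs h1 hn, ih, act_neg h1, signedPerm_gen_mul cs h1 hn]

theorem signedPerm_ne_zero (w : W) {x : ℤ} (hx : x ≠ 0) : signedPerm cs w x ≠ 0 := by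
  have h0 : signedPerm cs w 0 = 0 := by
    have := signedPerm_neg cs w 0
    rw [neg_zero] at this
    omega
  rw [← h0]
  exact (signedPerm cs w).injective.ne hx

theorem abs_signedPerm_le {σ : Finset ℕ} {m : ℕ} (hm : 2 ≤ m) (hσ : ∀ i ∈ σ, i ≤ m) {w : W}
    (hw : w ∈ parabolic cs σ) {x : ℤ} (hx : |x| ≤ m) : |signedPerm cs w x| ≤ m := by
  refine parabolic_induction cs (p := fun w => |signedPerm cs w x| ≤ m) (by simpa) ?_ w hw
  intro i hi h1 hn w _ ih
  rw [signedPerm_gen_mul cs h1 hn]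
  exact abs_act_le h1 hm (hσ i hi) ih

/-! ### The number of inversions of a signed permutation -/

/-- The inversions of a signed permutation of type `D`. -/
noncomputable def inversions (w : W) : Finset (ℤ × ℤ) :=
  (Finset.Icc (-n : ℤ) n ×ˢ Finset.Icc (-n : ℤ) n).filter fun p =>
    p.1 ≠ 0 ∧ |p.1| < p.2 ∧ signedPerm cs w p.2 < signedPerm cs w p.1

theorem mem_inversions {w : W} {a b : ℤ} : (a, b) ∈ inversions cs w ↔
    a ≠ 0 ∧ |a| < b ∧ b ≤ n ∧ signedPerm cs w b < signedPerm cs w a := by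
  rw [inversions, Finset.mem_filter, Finset.mem_product, Finset.mem_Icc, Finset.mem_Icc]
  constructor
  · rintro ⟨h1, h2, h3, h4⟩
    exact ⟨h2, h3, h1.2.2, h4⟩
  · rintro ⟨h1, h2, h3, h4⟩
    have := abs_lt.1 h2
    exact ⟨⟨⟨by omega, by omega⟩, by omega, h3⟩, h1, h2, h4⟩

theorem signedPerm_ne_neg (w : W) {a b : ℤ} (h : |a| < b) :
    signedPerm cs w a ≠ - signedPerm cs w b := by
  rw [← signedPerm_neg]
  intro h'
  have := (signedPerm cs w).injective h'
  have := abs_lt.1 h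
  omega

/-- A simple reflection reverses the order of one pair of values and of the opposite pair. The
condition `|a| < b` selects only one of the two, so at most one inversion is new. -/
theorem card_inversions_gen_mul_le {i : ℕ} (h1 : 1 ≤ i) (hn : i ≤ n) (w : W) :
    (inversions cs (gen cs i * w)).card ≤ (inversions cs w).card + 1 := by
  have hcard : (inversions cs (gen cs i * w) \ inversions cs w).card ≤ 1 := by
    rw [Finset.card_le_one]
    rintro ⟨a, b⟩ hab ⟨a', b'⟩ hab'
    rw [Finset.mem_sdiff, mem_inversions, mem_inversions, signedPerm_gen_mul cs h1 hn,
      signedPerm_gen_mul cs h1 hn] at hab hab'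
    obtain ⟨⟨ha, hb, hbn, h2⟩, h3⟩ := hab
    obtain ⟨⟨ha', hb', hbn', h2'⟩, h3'⟩ := hab'
    have hlt : ∀ a b : ℤ, a ≠ 0 → |a| < b → b ≤ n → ¬ (a ≠ 0 ∧ |a| < b ∧ b ≤ n ∧
        signedPerm cs w b < signedPerm cs w a) → signedPerm cs w a < signedPerm cs w b := by
      intro a b h1 h2 h3 h4
      have := abs_lt.1 h2
      have : signedPerm cs w a ≠ signedPerm cs w b :=
        (signedPerm cs w).injective.ne (by omega)
      have : ¬ signedPerm cs w b < signedPerm cs w a := fun h => h4 ⟨h1, h2, h3, h⟩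
      omega
    have hb0 := abs_lt.1 hb
    have hb0' := abs_lt.1 hb'
    rcases eq_or_eq_neg_of_act_lt_act h1 (signedPerm_ne_zero cs w ha)
      (signedPerm_ne_zero cs w (by omega)) (hlt a b ha hb hbn h3) (signedPerm_ne_neg cs w hb) h2
      (signedPerm_ne_zero cs w ha') (signedPerm_ne_zero cs w (by omega))
      (hlt a' b' ha' hb' hbn' h3') (signedPerm_ne_neg cs w hb') h2' with ⟨e1, e2⟩ | ⟨e1, e2⟩
    · rw [(signedPerm cs w).injective e1, (signedPerm cs w).injective e2]
    · rw [← signedPerm_neg] at e1 e2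
      have e1 := (signedPerm cs w).injective e1
      have e2 := (signedPerm cs w).injective e2
      omega
  have := Finset.card_le_card_sdiff_add_card (s := inversions cs (gen cs i * w))
    (t := inversions cs w)
  omega

theorem card_inversions_one : (inversions cs 1).card = 0 := by
  rw [Finset.card_eq_zero, Finset.eq_empty_iff_forall_notMem]
  rintro ⟨a, b⟩ h
  rw [mem_inversions] at h
  have := abs_lt.1 h.2.1
  have := h.2.2.2
  simp at this
  omega

theorem card_inversions_le_length (w : W) : (inversions cs w).card ≤ cs.length w := by
  obtain ⟨ω, hω, rfl⟩ := cs.exists_isReduced w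
  rw [hω.eq]
  clear hω
  induction ω with
  | nil => rw [cs.wordProd_nil, card_inversions_one]; simp
  | cons s ω ih =>
    have h := Finset.mem_Icc.1 s.2
    have := card_inversions_gen_mul_le cs h.1 h.2 (cs.wordProd ω)
    rw [gen_of_mem cs s.2] at this
    rw [cs.wordProd_cons, List.length_cons]
    exact this.trans (by omega)

/-- Let `c` be the image of `m`, and let `a` be the letter sent to `act i c`. The pair `(a, m)`
becomes an inversion; `|a| ≤ m` because `w` preserves the letters of absolute value at most `m`. No
inversion is lost, since the only reversed pair of values, up to sign, is that of `a` and `m`. -/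
theorem card_inversions_lt_gen_mul {i m : ℕ} (h1 : 1 ≤ i) (hn : i ≤ n) (hm : 2 ≤ m) (hmn : m ≤ n)
    (him : i ≤ m) {σ : Finset ℕ} (hσ : ∀ j ∈ σ, j ≤ m) {w : W} (hw : w ∈ parabolic cs σ)
    (hlt : act i (signedPerm cs w m) < signedPerm cs w m) :
    (inversions cs w).card < (inversions cs (gen cs i * w)).card := by
  have hm0 : (m : ℤ) ≠ 0 := by omega
  set c := signedPerm cs w m with hc
  have hc0 : c ≠ 0 := signedPerm_ne_zero cs w hm0
  have hcm : |c| ≤ m := abs_signedPerm_le cs hm hσ hw (by simp)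
  obtain ⟨a, ha⟩ := (signedPerm cs w).surjective (act i c)
  have hact0 : act i c ≠ 0 := fun h => by
    have := act_act h1 c
    rw [h, act_zero h1] at this
    exact hc0 this.symm
  have hneg : act i c ≠ -c := by
    intro h
    unfold act at h
    grind (splits := 30)
  have ham : |a| ≤ m := by
    have h2 : a = signedPerm cs w⁻¹ (act i c) := by
      rw [← ha, ← Equiv.Perm.mul_apply, ← map_mul, inv_mul_cancel, map_one, Equiv.Perm.one_apply]
    rw [h2]
    exact abs_signedPerm_le cs hm hσ (inv_mem hw) (abs_act_le h1 hm him hcm)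
  have ha0 : a ≠ 0 := by
    rintro rfl
    have := signedPerm_neg cs w 0
    rw [neg_zero] at this
    omega
  have ham' : |a| < m := by
    refine lt_of_le_of_ne ham fun h => ?_
    rcases abs_choice a with h' | h'
    · rw [h'] at h
      rw [h, ← hc] at ha
      omega
    · rw [h'] at h
      rw [show a = -m by omega, signedPerm_neg, ← hc] at ha
      omega
  apply Finset.card_lt_card
  rw [Finset.ssubset_iff_of_subset]
  · refine ⟨(a, m), ?_, ?_⟩
    · rw [mem_inversions, signedPerm_gen_mul cs h1 hn, signedPerm_gen_mul cs h1 hn, ha, ← hc,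
        act_act h1]
      exact ⟨ha0, ham', by omega, hlt⟩
    · rw [mem_inversions, ha, ← hc]
      rintro ⟨_, _, _, h⟩
      omega
  · rintro ⟨a', b'⟩ hab
    rw [mem_inversions] at hab ⊢
    obtain ⟨ha', hb', hbn', h2⟩ := hab
    refine ⟨ha', hb', hbn', ?_⟩
    rw [signedPerm_gen_mul cs h1 hn, signedPerm_gen_mul cs h1 hn]
    by_contra hcon
    have hb0 := abs_lt.1 hb'
    have hne : act i (signedPerm cs w a') ≠ act i (signedPerm cs w b') := fun h => by
      have := (signedPerm cs w).injective ((Function.Involutive.injective (act_act h1)) h)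
      omega
    rcases eq_or_eq_neg_of_act_lt_act h1 hact0 hc0 hlt hneg (by rw [act_act h1]; exact hlt)
      (signedPerm_ne_zero cs w (show b' ≠ 0 by omega)) (signedPerm_ne_zero cs w ha') h2
      (fun h => signedPerm_ne_neg cs w hb' (by omega)) (by omega) with ⟨e1, e2⟩ | ⟨e1, e2⟩
    · rw [← ha] at e1
      rw [hc] at e2
      have e1 := (signedPerm cs w).injective e1
      have e2 := (signedPerm cs w).injective e2
      subst e1 e2
      have := abs_lt.1 ham'
      simp at hb'
      omega
    · rw [hc, ← signedPerm_neg] at e1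
      have e1 := (signedPerm cs w).injective e1
      omega

end signedPerm

/-! ### Coset representatives -/

section Factor

variable {n : ℕ} {W : Type*} [Group W] (cs : CoxeterSystem (typeD n) W)

/-- The shortest element that sends the letter `m` to the letter `m - k ≥ 1`. -/
def repUp (m : ℕ) : ℕ → W
  | 0 => 1
  | k + 1 => gen cs (m - k) * repUp m k

/-- The shortest element that sends the letter `m` to the letter `-(k + 1)`. -/
def repDown (m : ℕ) : ℕ → W
  | 0 => gen cs 1 * repUp cs m (m - 2)
  | k + 1 => gen cs (k + 2) * repDown m k

/-- The shortest element that sends the letter `m` to the letter `c`. -/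
def rep (m : ℕ) (c : ℤ) : W :=
  if 0 < c then repUp cs m (m - c).toNat else repDown cs m (-c - 1).toNat

/-- The length of `rep cs m c`. -/
def repLength (m : ℕ) (c : ℤ) : ℕ :=
  if 0 < c then (m - c).toNat else (m - c - 2).toNat

theorem rep_self {m : ℕ} (hm : 1 ≤ m) : rep cs m m = 1 := by
  rw [rep, if_pos (by omega), sub_self]
  rfl

theorem lt_act_cases {i : ℕ} (hi : 1 ≤ i) {c : ℤ} (hc : c ≠ 0) (h : c < act i c) :
    (2 ≤ i ∧ c = i - 1 ∧ act i c = i) ∨ (2 ≤ i ∧ c = -i ∧ act i c = -(i - 1)) ∨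
      (i = 1 ∧ c = -1 ∧ act i c = 2) ∨ (i = 1 ∧ c = -2 ∧ act i c = 1) := by
  unfold act at *; grind (splits := 30)

/-- `rep` is defined along one chosen route, but any raising generator may be split off. Routes
diverge only at the letter `-2`, which both `1` and `2` raise, and there the two generators commute.
-/
theorem rep_eq_gen_mul_rep {m i : ℕ} (hm : 2 ≤ m) (hi : 1 ≤ i) (him : i ≤ m) {c : ℤ} (hc : c ≠ 0)
    (h : c < act i c) : rep cs m c = gen cs i * rep cs m (act i c) := by
  rcases lt_act_cases hi hc h with ⟨h2, h3, h4⟩ | ⟨h2, h3, h4⟩ | ⟨h2, h3, h4⟩ | ⟨h2, h3, h4⟩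
  · rw [h4, h3, rep, if_pos (by omega), rep, if_pos (by omega),
      show ((m : ℤ) - (i - 1)).toNat = (m - i) + 1 by omega,
      show ((m : ℤ) - i).toNat = m - i by omega, repUp, show m - (m - i) = i by omega]
  · obtain ⟨k, rfl⟩ := Nat.exists_eq_add_of_le' h2
    rw [h4, h3, rep, if_neg (by omega), rep, if_neg (by omega),
      show (-(-((k + 2 : ℕ) : ℤ)) - 1).toNat = k + 1 by omega,
      show (-(-(((k + 2 : ℕ) : ℤ) - 1)) - 1).toNat = k by omega, repDown]
  · rw [h4, h3, h2, rep, if_neg (by omega), rep, if_pos (by omega),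
      show (-(-1 : ℤ) - 1).toNat = 0 by omega, show ((m : ℤ) - 2).toNat = m - 2 by omega, repDown]
  · rw [h4, h3, h2, rep, if_neg (by omega), rep, if_pos (by omega),
      show (-(-2 : ℤ) - 1).toNat = 0 + 1 by omega,
      show ((m : ℤ) - 1).toNat = (m - 2) + 1 by omega, repDown, repDown, repUp,
      show m - (m - 2) = 2 by omega, ← mul_assoc, ← mul_assoc, gen_comm cs (i := 1) (j := 0 + 2)]
    unfold AdjD; omega

theorem repLength_eq_succ {m i : ℕ} (hm : 2 ≤ m) (hi : 1 ≤ i) (him : i ≤ m) {c : ℤ} (hc : c ≠ 0)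
    (h : c < act i c) : repLength m c = repLength m (act i c) + 1 := by
  unfold repLength
  rcases lt_act_cases hi hc h with ⟨h2, h3, h4⟩ | ⟨h2, h3, h4⟩ | ⟨h2, h3, h4⟩ | ⟨h2, h3, h4⟩ <;>
    rw [h4] <;> split_ifs <;> omega

/-- This makes the braid relation usable in `IsOrbit.exists_gen_mul_rep`: after `j`, the vertex `i`
raises the letter further. -/
theorem eq_of_act_eq_of_adjD {i j : ℕ} (hi : 1 ≤ i) (hj : 1 ≤ j) (hij : AdjD i j) {c : ℤ}
    (hc : c ≠ 0) (hic : act i c = c) (hjc : c < act j c) : act j c < act i (act j c) := by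
  unfold act AdjD at *; grind (splits := 30)

/-- `O` is the orbit of the letter `m` under the parabolic subgroup of type `A`, and the vertices
in `σ` are those in `A` that fix `m`. -/
structure IsOrbit (m : ℕ) (A σ : Finset ℕ) (O : Finset ℤ) : Prop where
  two_le : 2 ≤ m
  subset_Icc : A ⊆ Finset.Icc 1 m
  subset : σ ⊆ A
  act_eq_iff : ∀ i ∈ A, act i m = m ↔ i ∈ σ
  ne_zero : ∀ c ∈ O, c ≠ 0
  le : ∀ c ∈ O, c ≤ m
  self_mem : (m : ℤ) ∈ O
  act_mem : ∀ i ∈ A, ∀ c ∈ O, act i c ∈ O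
  exists_lt : ∀ c ∈ O, c ≠ m → ∃ i ∈ A, c < act i c

/-- The parabolic subgroup `W_σ` is finite, and the length of its elements is the number of
inversions. -/
def IsFiniteParabolic (σ : Finset ℕ) : Prop :=
  Finite (parabolic cs σ) ∧ ∀ w ∈ parabolic cs σ, cs.length w = (inversions cs w).card

namespace IsOrbit

variable {m : ℕ} {A σ : Finset ℕ} {O : Finset ℤ} (h : IsOrbit m A σ O)
include h

theorem one_le {i : ℕ} (hi : i ∈ A) : 1 ≤ i := (Finset.mem_Icc.1 (h.subset_Icc hi)).1

theorem le_m {i : ℕ} (hi : i ∈ A) : i ≤ m := (Finset.mem_Icc.1 (h.subset_Icc hi)).2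

theorem strong_induction {p : ℤ → Prop}
    (step : ∀ c ∈ O, (∀ c' ∈ O, c < c' → p c') → p c) : ∀ c ∈ O, p c := by
  intro c hc
  induction hk : ((m : ℤ) - c).toNat using Nat.strong_induction_on generalizing c with
  | _ k ih =>
    refine step c hc fun c' hc' hlt => ih _ ?_ c' hc' rfl
    have := h.le c' hc'
    omega

/-- Induction downwards from `m`: every other letter of the orbit is raised by some vertex of `A`,
and the orbit is bounded above by `m`. -/
theorem induction {p : ℤ → Prop} (self : p m)
    (step : ∀ c ∈ O, ∀ i ∈ A, c < act i c → p (act i c) → p c) : ∀ c ∈ O, p c := by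
  refine h.strong_induction fun c hc ih => ?_
  by_cases hcm : c = m
  · rwa [hcm]
  · obtain ⟨i, hi, hlt⟩ := h.exists_lt c hc hcm
    exact step c hc i hi hlt (ih _ (h.act_mem i hi c hc) hlt)

theorem rep_mem : ∀ c ∈ O, rep cs m c ∈ parabolic cs A := by
  have := h.two_le
  refine h.induction ?_ fun c hc i hi hlt ih => ?_
  · rw [rep_self cs (by omega)]
    exact one_mem _
  · rw [rep_eq_gen_mul_rep cs h.two_le (h.one_le hi) (h.le_m hi) (h.ne_zero c hc) hlt]
    exact mul_mem (gen_mem_parabolic cs hi) ih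

theorem signedPerm_apply_self {u : W} (hu : u ∈ parabolic cs σ) : signedPerm cs u m = m := by
  refine parabolic_induction cs (p := fun u => signedPerm cs u m = m) (by simp) ?_ u hu
  intro i hi h1 hn w _ ih
  rw [signedPerm_gen_mul cs h1 hn, ih]
  exact (h.act_eq_iff i (h.subset hi)).2 hi

theorem signedPerm_rep_mul (hmn : m ≤ n) {u : W} (hu : u ∈ parabolic cs σ) :
    ∀ c ∈ O, signedPerm cs (rep cs m c * u) m = c := by
  have := h.two_le
  refine h.induction ?_ fun c hc i hi hlt ih => ?_
  · rw [rep_self cs (by omega), one_mul, h.signedPerm_apply_self cs hu]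
  · rw [rep_eq_gen_mul_rep cs h.two_le (h.one_le hi) (h.le_m hi) (h.ne_zero c hc) hlt, mul_assoc,
      signedPerm_gen_mul cs (h.one_le hi) ((h.le_m hi).trans hmn), ih, act_act (h.one_le hi)]

/-- A generator fixing `c` passes through the representative and comes out in the stabilizer. If it
commutes with the first letter `j` of the representative, move it past; if not, `s_i s_j s_i = s_j
s_i s_j` turns it into `s_j` acting on a higher letter. At `c = m` it already belongs to `σ`. -/
theorem exists_gen_mul_rep (hmn : m ≤ n) : ∀ c ∈ O, ∀ i ∈ A, act i c = c →
    ∃ u ∈ parabolic cs σ, gen cs i * rep cs m c = rep cs m c * u := by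
  have hm := h.two_le
  refine h.strong_induction fun c hc ih i hi hic => ?_
  by_cases hcm : c = m
  · subst hcm
    refine ⟨gen cs i, gen_mem_parabolic cs ((h.act_eq_iff i hi).1 hic), ?_⟩
    rw [rep_self cs (by omega), mul_one, one_mul]
  obtain ⟨j, hj, hlt⟩ := h.exists_lt c hc hcm
  have hc' := h.act_mem j hj c hc
  rw [rep_eq_gen_mul_rep cs hm (h.one_le hj) (h.le_m hj) (h.ne_zero c hc) hlt]
  by_cases hij : AdjD i j
  · have hlt' := eq_of_act_eq_of_adjD (h.one_le hi) (h.one_le hj) hij (h.ne_zero c hc) hic hlt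
    have hc'' := h.act_mem i hi _ hc'
    obtain ⟨u, hu, e⟩ := ih _ hc'' (hlt.trans hlt') j hj (by
      rw [← act_braid hij, hic])
    refine ⟨u, hu, ?_⟩
    rw [rep_eq_gen_mul_rep cs hm (h.one_le hi) (h.le_m hi) (h.ne_zero _ hc') hlt', mul_assoc,
      mul_assoc, ← e, ← mul_assoc, ← mul_assoc, ← mul_assoc, ← mul_assoc,
      gen_braid cs (Finset.mem_Icc.2 ⟨h.one_le hi, (h.le_m hi).trans hmn⟩)
        (Finset.mem_Icc.2 ⟨h.one_le hj, (h.le_m hj).trans hmn⟩) hij]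
  · obtain ⟨u, hu, e⟩ := ih _ hc' hlt i hi (by
      rw [act_comm (h.one_le hi) (h.one_le hj) hij, hic])
    refine ⟨u, hu, ?_⟩
    rw [← mul_assoc, gen_comm cs hij, mul_assoc, e, mul_assoc]

/-- Multiplying a factored element by a generator lowers, raises or fixes the letter `c`. The first
two cases change the representative; the third moves the generator into the stabilizer. -/
theorem exists_eq_rep_mul (hmn : m ≤ n) : ∀ w ∈ parabolic cs A,
    ∃ c ∈ O, ∃ u ∈ parabolic cs σ, w = rep cs m c * u := by
  have hm := h.two_le
  refine parabolic_induction cs ?_ ?_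
  · exact ⟨m, h.self_mem, 1, one_mem _, by rw [rep_self cs (by omega), one_mul]⟩
  · rintro i hi h1 - w - ⟨c, hc, u, hu, rfl⟩
    rcases lt_trichotomy (act i c) c with hlt | heq | hlt
    · refine ⟨act i c, h.act_mem i hi c hc, u, hu, ?_⟩
      rw [rep_eq_gen_mul_rep cs hm h1 (h.le_m hi) (h.ne_zero _ (h.act_mem i hi c hc))
        (by rwa [act_act h1]), act_act h1, mul_assoc]
    · obtain ⟨u', hu', e⟩ := h.exists_gen_mul_rep cs hmn c hc i hi heq
      exact ⟨c, hc, u' * u, mul_mem hu' hu, by rw [← mul_assoc, e, mul_assoc]⟩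
    · refine ⟨act i c, h.act_mem i hi c hc, u, hu, ?_⟩
      rw [rep_eq_gen_mul_rep cs hm h1 (h.le_m hi) (h.ne_zero c hc) hlt, mul_assoc,
        gen_mul_cancel_left]

theorem length_rep_le (hmn : m ≤ n) : ∀ c ∈ O, cs.length (rep cs m c) ≤ repLength m c := by
  have hm := h.two_le
  refine h.induction ?_ fun c hc i hi hlt ih => ?_
  · rw [rep_self cs (by omega), cs.length_one]
    exact Nat.zero_le _
  · rw [rep_eq_gen_mul_rep cs hm (h.one_le hi) (h.le_m hi) (h.ne_zero c hc) hlt,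
      repLength_eq_succ hm (h.one_le hi) (h.le_m hi) (h.ne_zero c hc) hlt,
      gen_of_mem cs (Finset.mem_Icc.2 ⟨h.one_le hi, (h.le_m hi).trans hmn⟩)]
    refine (cs.length_mul_le _ _).trans ?_
    rw [cs.length_simple]
    omega

theorem card_inversions_add_le (hmn : m ≤ n) {u : W} (hu : u ∈ parabolic cs σ) : ∀ c ∈ O,
    (inversions cs u).card + repLength m c ≤ (inversions cs (rep cs m c * u)).card := by
  have hm := h.two_le
  refine h.induction ?_ fun c hc i hi hlt ih => ?_
  · rw [rep_self cs (by omega), one_mul, repLength, if_pos (by omega), sub_self]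
    exact le_rfl
  · have hc' := h.act_mem i hi c hc
    have := card_inversions_lt_gen_mul cs (h.one_le hi) ((h.le_m hi).trans hmn) hm hmn (h.le_m hi)
      (σ := A) (fun j hj => h.le_m hj) (w := rep cs m (act i c) * u)
      (mul_mem (h.rep_mem cs _ hc') (parabolic_mono cs h.subset hu))
      (by rwa [h.signedPerm_rep_mul cs hmn hu _ hc', act_act (h.one_le hi)])
    rw [rep_eq_gen_mul_rep cs hm (h.one_le hi) (h.le_m hi) (h.ne_zero c hc) hlt, mul_assoc,
      repLength_eq_succ hm (h.one_le hi) (h.le_m hi) (h.ne_zero c hc) hlt]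
    omega

/-- A squeeze: the inversions of the product number at least `repLength m c` plus those of `u`, and
at most its length; that length is at most `repLength m c + ℓ(u)`, and `ℓ(u)` equals the number of
inversions of `u`. -/
theorem length_rep_mul (hmn : m ≤ n) (hσ : IsFiniteParabolic cs σ) {u : W}
    (hu : u ∈ parabolic cs σ) {c : ℤ} (hc : c ∈ O) :
    cs.length (rep cs m c * u) = repLength m c + cs.length u ∧
      cs.length (rep cs m c * u) = (inversions cs (rep cs m c * u)).card := by
  have h1 := h.card_inversions_add_le cs hmn hu c hc
  have h2 := h.length_rep_le cs hmn c hc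
  have h3 := card_inversions_le_length cs (rep cs m c * u)
  have h4 := cs.length_mul_le (rep cs m c) u
  have h5 := hσ.2 u hu
  omega

/-- Uniqueness: the image of `m` under the product is `c`, which determines the representative, and
then `u` by cancellation. -/
theorem bijective_rep_mul (hmn : m ≤ n) : Function.Bijective
    (fun p : O × parabolic cs σ => (⟨rep cs m p.1 * p.2, mul_mem (h.rep_mem cs _ p.1.2)
      (parabolic_mono cs h.subset p.2.2)⟩ : parabolic cs A)) := by
  constructor
  · rintro ⟨⟨c, hc⟩, ⟨u, hu⟩⟩ ⟨⟨c', hc'⟩, ⟨u', hu'⟩⟩ e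
    have e : rep cs m c * u = rep cs m c' * u' := congrArg Subtype.val e
    have h1 := h.signedPerm_rep_mul cs hmn hu c hc
    rw [e, h.signedPerm_rep_mul cs hmn hu' c' hc'] at h1
    subst h1
    have := mul_left_cancel e
    subst this
    rfl
  · rintro ⟨w, hw⟩
    obtain ⟨c, hc, u, hu, rfl⟩ := h.exists_eq_rep_mul cs hmn w hw
    exact ⟨⟨⟨c, hc⟩, ⟨u, hu⟩⟩, rfl⟩

theorem isFiniteParabolic (hmn : m ≤ n) (hσ : IsFiniteParabolic cs σ) :
    IsFiniteParabolic cs A := by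
  have := hσ.1
  refine ⟨Finite.of_surjective _ (h.bijective_rep_mul cs hmn).2, fun w hw => ?_⟩
  obtain ⟨c, hc, u, hu, rfl⟩ := h.exists_eq_rep_mul cs hmn w hw
  exact (h.length_rep_mul cs hmn hσ hu hc).2

theorem poincare_eq (hmn : m ≤ n) (hσ : IsFiniteParabolic cs σ) :
    poincare cs A = (∑ c ∈ O, X ^ repLength m c) * poincare cs σ := by
  have := hσ.1
  have := Fintype.ofFinite (parabolic cs σ)
  have e := finsum_comp_equiv (Equiv.ofBijective _ (h.bijective_rep_mul cs hmn))
    (f := fun w : parabolic cs A => (X ^ cs.length (w : W) : ℚ[X]))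
  rw [poincare, poincare, ← e, finsum_eq_sum_of_fintype, finsum_eq_sum_of_fintype,
    Fintype.sum_prod_type, ← Finset.sum_coe_sort O (fun c => (X ^ repLength m c : ℚ[X])),
    Finset.sum_mul_sum]
  refine Finset.sum_congr rfl fun c _ => Finset.sum_congr rfl fun u _ => ?_
  rw [← pow_add, ← (h.length_rep_mul cs hmn hσ u.2 c.2).1]
  rfl

end IsOrbit

end Factor

/-! ### The orbits of the largest letter -/

theorem Icc_subset_of_gap_eq_zero {σ : Finset ℕ} {m : ℕ} (h : gap σ m = 0) :
    Finset.Icc 1 m ⊆ σ := by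
  intro i hi
  rw [Finset.mem_Icc] at hi
  exact mem_of_gap_lt (i := m) (by omega) hi.2

section Orbits

variable {m : ℕ} {A : Finset ℕ} (hm : 2 ≤ m) (hA : A ⊆ Finset.Icc 1 m)
include hm hA

/-- The last missing vertex `j` prevents letters from dropping below `j`. The vertex `1` could
bypass this only by exchanging `2` and `-1`, hence the exception for `j = 2`. -/
theorem isOrbit_of_gap (hj : 1 ≤ gap A m) (h : gap A m = 2 → 1 ∉ A) :
    IsOrbit m A (A.filter fun i => act i m = m) (Finset.Icc (gap A m : ℤ) m) := by
  have h0 := zero_notMem_of_subset_Icc hA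
  have hjA := gap_notMem h0 m
  have hjm := gap_le A m
  refine ⟨hm, hA, Finset.filter_subset _ _, fun i hi => ?_, fun c hc => ?_, fun c hc => ?_, ?_,
    fun i hi c hc => ?_, fun c hc hcm => ?_⟩
  · simp [hi]
  · rw [Finset.mem_Icc] at hc; omega
  · rw [Finset.mem_Icc] at hc; omega
  · rw [Finset.mem_Icc]; omega
  · rw [Finset.mem_Icc] at hc ⊢
    have h1 := Finset.mem_Icc.1 (hA hi)
    have h2 : i ≠ gap A m := fun h => hjA (h ▸ hi)
    have h3 : i = 1 → gap A m ≠ 2 := fun h' h'' => h h'' (h' ▸ hi)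
    unfold act
    split_ifs <;> omega
  · rw [Finset.mem_Icc] at hc
    lift c to ℕ using by omega
    refine ⟨c + 1, mem_of_gap_lt (i := m) (by omega) (by omega), ?_⟩
    unfold act
    split_ifs <;> omega

/-- Here the vertex `1` plays the role of the missing `2`: from the letter `2` the orbit continues
to `-1` and stops there. -/
theorem isOrbit_of_gap_eq_two (hj : gap A m = 2) (h : 1 ∈ A) :
    IsOrbit m A (A.filter fun i => act i m = m) (insert (-1) (Finset.Icc 2 (m : ℤ))) := by
  have h0 := zero_notMem_of_subset_Icc hA
  have hjA := gap_notMem h0 m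
  rw [hj] at hjA
  refine ⟨hm, hA, Finset.filter_subset _ _, fun i hi => ?_, fun c hc => ?_, fun c hc => ?_, ?_,
    fun i hi c hc => ?_, fun c hc hcm => ?_⟩
  · simp [hi]
  · rw [Finset.mem_insert, Finset.mem_Icc] at hc; omega
  · rw [Finset.mem_insert, Finset.mem_Icc] at hc; omega
  · rw [Finset.mem_insert, Finset.mem_Icc]; omega
  · rw [Finset.mem_insert, Finset.mem_Icc] at hc ⊢
    have h1 := Finset.mem_Icc.1 (hA hi)
    have h2 : i ≠ 2 := fun h => hjA (h ▸ hi)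
    unfold act
    split_ifs <;> omega
  · rw [Finset.mem_insert, Finset.mem_Icc] at hc
    rcases hc with rfl | hc
    · exact ⟨1, h, by simp [act]⟩
    · lift c to ℕ using by omega
      refine ⟨c + 1, mem_of_gap_lt (i := m) (by omega) (by omega), ?_⟩
      unfold act
      split_ifs <;> omega

theorem isOrbit_of_gap_eq_zero (hj : gap A m = 0) :
    IsOrbit m A (A.filter fun i => act i m = m)
      (Finset.Icc 1 (m : ℤ) ∪ Finset.Icc (-m : ℤ) (-1)) := by
  have hsub := Icc_subset_of_gap_eq_zero hj
  refine ⟨hm, hA, Finset.filter_subset _ _, fun i hi => ?_, fun c hc => ?_, fun c hc => ?_, ?_,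
    fun i hi c hc => ?_, fun c hc hcm => ?_⟩
  · simp [hi]
  · rw [Finset.mem_union, Finset.mem_Icc, Finset.mem_Icc] at hc; omega
  · rw [Finset.mem_union, Finset.mem_Icc, Finset.mem_Icc] at hc; omega
  · rw [Finset.mem_union, Finset.mem_Icc]; omega
  · rw [Finset.mem_union, Finset.mem_Icc, Finset.mem_Icc] at hc ⊢
    have h1 := Finset.mem_Icc.1 (hA hi)
    unfold act
    split_ifs <;> omega
  · rw [Finset.mem_union, Finset.mem_Icc, Finset.mem_Icc] at hc
    rcases hc with hc | hc
    · lift c to ℕ using by omega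
      refine ⟨c + 1, hsub (Finset.mem_Icc.2 (by omega)), ?_⟩
      unfold act
      split_ifs <;> omega
    · obtain ⟨k, rfl⟩ : ∃ k : ℕ, c = -k := ⟨(-c).toNat, by omega⟩
      by_cases hk : k = 1
      · subst hk
        exact ⟨1, hsub (Finset.mem_Icc.2 (by omega)), by simp [act]⟩
      · refine ⟨k, hsub (Finset.mem_Icc.2 (by omega)), ?_⟩
        unfold act
        split_ifs <;> omega

end Orbits

theorem sum_repLength_Icc {j m : ℕ} (hj : 1 ≤ j) :
    ∑ c ∈ Finset.Icc (j : ℤ) m, (X : ℚ[X]) ^ repLength m c =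
      ∑ i ∈ Finset.range (m + 1 - j), X ^ i := by
  refine Finset.sum_nbij' (fun c => (m - c).toNat) (fun k => m - k) ?_ ?_ ?_ ?_ ?_
  · intro c hc; rw [Finset.mem_Icc] at hc; rw [Finset.mem_range]; omega
  · intro c hc; rw [Finset.mem_range] at hc; rw [Finset.mem_Icc]; omega
  · intro c hc; rw [Finset.mem_Icc] at hc; omega
  · intro c hc; rw [Finset.mem_range] at hc; omega
  · intro c hc
    rw [Finset.mem_Icc] at hc
    rw [repLength, if_pos (by omega)]

theorem sum_repLength_insert {m : ℕ} (hm : 2 ≤ m) :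
    ∑ c ∈ insert (-1) (Finset.Icc 2 (m : ℤ)), (X : ℚ[X]) ^ repLength m c =
      ∑ i ∈ Finset.range m, X ^ i := by
  have := sum_repLength_Icc (j := 2) (m := m) (by omega)
  rw [Nat.cast_two] at this
  rw [Finset.sum_insert (by simp), this, show m = (m + 1 - 2) + 1 by omega, Finset.sum_range_succ,
    add_comm, repLength, if_neg (by omega)]
  congr 2
  omega

/-- The letter `-k` has length `(m - 1) + (k - 1)`, so the negative letters contribute the same
geometric sum shifted by `m - 1`. -/
theorem sum_repLength_union {m : ℕ} (hm : 2 ≤ m) :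
    ∑ c ∈ Finset.Icc 1 (m : ℤ) ∪ Finset.Icc (-m : ℤ) (-1), (X : ℚ[X]) ^ repLength m c =
      (∑ i ∈ Finset.range m, X ^ i) * (1 + X ^ (m - 1)) := by
  have := sum_repLength_Icc (j := 1) (m := m) le_rfl
  rw [Nat.cast_one, Nat.add_sub_cancel] at this
  rw [Finset.sum_union, this, mul_add, mul_one, Finset.sum_mul]
  · congr 1
    refine Finset.sum_nbij' (fun c => (-c - 1).toNat) (fun k => -k - 1) ?_ ?_ ?_ ?_ ?_
    · intro c hc; rw [Finset.mem_Icc] at hc; rw [Finset.mem_range]; omega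
    · intro c hc; rw [Finset.mem_range] at hc; rw [Finset.mem_Icc]; omega
    · intro c hc; rw [Finset.mem_Icc] at hc; omega
    · intro c hc; rw [Finset.mem_range] at hc; omega
    · intro c hc
      rw [Finset.mem_Icc] at hc
      rw [repLength, if_neg (by omega), ← pow_add]
      congr 1
      omega
  · rw [Finset.disjoint_left]
    intro c hc hc'
    rw [Finset.mem_Icc] at hc hc'
    omega

/-! ### Multiplicities of cyclotomic polynomials -/

theorem prime_cyclotomic {d : ℕ} (hd : 0 < d) : Prime (cyclotomic d ℚ) :=
  (cyclotomic.irreducible_rat hd).prime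

theorem cyclotomic_dvd_iff {d i : ℕ} (hd : 0 < d) :
    cyclotomic d ℚ ∣ cyclotomic i ℚ ↔ d = i := by
  refine ⟨fun h => ?_, fun h => h ▸ dvd_rfl⟩
  by_contra hne
  exact (prime_cyclotomic hd).not_isUnit
    ((cyclotomic.isCoprime_rat hne).isUnit_of_dvd' dvd_rfl h)

theorem multiplicity_cyclotomic_mul {d : ℕ} (hd : 0 < d) {p q : ℚ[X]} (hp : p ≠ 0) (hq : q ≠ 0) :
    multiplicity (cyclotomic d ℚ) (p * q) =
      multiplicity (cyclotomic d ℚ) p + multiplicity (cyclotomic d ℚ) q :=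
  multiplicity_mul (prime_cyclotomic hd)
    (FiniteMultiplicity.of_prime_left (prime_cyclotomic hd) (mul_ne_zero hp hq))

theorem geom_sum_ne_zero_rat {k : ℕ} (hk : 1 ≤ k) :
    (∑ i ∈ Finset.range k, X ^ i : ℚ[X]) ≠ 0 := by
  intro h
  have := congrArg (eval 1) h
  simp [eval_finsetSum] at this
  omega

/-- The geometric sum is the product of the `φ_i` over the divisors `i ≠ 1` of `k`, each occurring
once. -/
theorem multiplicity_cyclotomic_geom_sum {d k : ℕ} (hd : 2 ≤ d) (hk : 1 ≤ k) :
    multiplicity (cyclotomic d ℚ) (∑ i ∈ Finset.range k, X ^ i) = if d ∣ k then 1 else 0 := by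
  have key : ∀ s : Finset ℕ, d ∉ s →
      multiplicity (cyclotomic d ℚ) (∏ i ∈ s, cyclotomic i ℚ) = 0 := by
    intro s hs
    rw [multiplicity_eq_zero]
    intro h
    obtain ⟨i, hi, h⟩ := (prime_cyclotomic (by omega)).exists_mem_finset_dvd h
    exact hs ((cyclotomic_dvd_iff (by omega)).1 h ▸ hi)
  rw [← prod_cyclotomic_eq_geom_sum hk]
  split_ifs with h
  · have hmem : d ∈ k.divisors.erase 1 :=
      Finset.mem_erase.2 ⟨by omega, Nat.mem_divisors.2 ⟨h, by omega⟩⟩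
    rw [← Finset.mul_prod_erase _ _ hmem, multiplicity_cyclotomic_mul (by omega)
      (cyclotomic_ne_zero d ℚ) (Finset.prod_ne_zero_iff.2 fun i _ => cyclotomic_ne_zero i ℚ),
      key _ (Finset.notMem_erase _ _), multiplicity_self]
  · exact key _ fun h' => h (Nat.dvd_of_mem_divisors (Finset.mem_of_mem_erase h'))

theorem one_add_X_pow_ne_zero (k : ℕ) : (1 + X ^ k : ℚ[X]) ≠ 0 := by
  intro h
  have := congrArg (eval 1) h
  norm_num at this

/-- From `(1 + X^k)[k] = [2k]`; written additively to avoid truncated subtraction. -/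
theorem multiplicity_cyclotomic_one_add {d k : ℕ} (hd : 2 ≤ d) (hk : 1 ≤ k) :
    multiplicity (cyclotomic d ℚ) (1 + X ^ k) + (if d ∣ k then 1 else 0) =
      if d ∣ 2 * k then 1 else 0 := by
  rw [← multiplicity_cyclotomic_geom_sum hd hk,
    ← multiplicity_cyclotomic_geom_sum hd (show 1 ≤ 2 * k by omega),
    ← multiplicity_cyclotomic_mul (by omega) (one_add_X_pow_ne_zero k) (geom_sum_ne_zero_rat hk)]
  congr 1
  rw [two_mul, Finset.sum_range_add, add_mul, one_mul, Finset.mul_sum]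
  congr 1
  exact Finset.sum_congr rfl fun i _ => by rw [pow_add]

/-! ### The weight of a simplex -/

section Weight

variable {n : ℕ} {W : Type*} [Group W] (cs : CoxeterSystem (typeD n) W)

theorem parabolic_empty : parabolic cs ∅ = ⊥ := by simp [parabolic]

theorem isFiniteParabolic_empty : IsFiniteParabolic cs ∅ := by
  unfold IsFiniteParabolic
  rw [parabolic_empty]
  refine ⟨inferInstance, fun w hw => ?_⟩
  rw [Subgroup.mem_bot] at hw
  rw [hw, card_inversions_one, cs.length_one]

theorem poincare_empty : poincare cs ∅ = 1 := by
  rw [poincare, parabolic_empty, finsum_eq_single _ (1 : (⊥ : Subgroup W)) fun w hw =>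
    absurd (Subsingleton.elim w 1) hw]
  simp

theorem exists_isOrbit {m : ℕ} {A : Finset ℕ} (hm : 2 ≤ m) (hA : A ⊆ Finset.Icc 1 m) :
    ∃ O, IsOrbit m A (A.filter fun i => act i m = m) O := by
  by_cases h1 : gap A m = 0
  · exact ⟨_, isOrbit_of_gap_eq_zero hm hA h1⟩
  by_cases h2 : gap A m = 2 ∧ 1 ∈ A
  · exact ⟨_, isOrbit_of_gap_eq_two hm hA h2.1 h2.2⟩
  · exact ⟨_, isOrbit_of_gap hm hA (by omega) fun h h' => h2 ⟨h, h'⟩⟩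

/-- The vertices `1` and `2` both move the letter `2`, so the stabilizer is trivial. From `m = 3`
on, `m` is the only vertex up to `m` that moves the letter `m`; hence the inductions start at `2`.
-/
theorem filter_act_two {A : Finset ℕ} (hA : A ⊆ Finset.Icc 1 2) :
    (A.filter fun i => act i (2 : ℕ) = (2 : ℕ)) = ∅ := by
  rw [Finset.filter_eq_empty_iff]
  intro i hi
  have := Finset.mem_Icc.1 (hA hi)
  have : i = 1 ∨ i = 2 := by omega
  rcases this with rfl | rfl <;> simp [act]

theorem filter_act_self {m : ℕ} {A : Finset ℕ} (hm : 3 ≤ m) (hA : A ⊆ Finset.Icc 1 m) :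
    (A.filter fun i => act i m = m) = A.erase m := by
  ext i
  rw [Finset.mem_filter, Finset.mem_erase, and_comm, and_congr_left_iff]
  intro hi
  have := Finset.mem_Icc.1 (hA hi)
  unfold act
  constructor <;> intro h <;> grind

theorem erase_subset_Icc {m : ℕ} {A : Finset ℕ} (hA : A ⊆ Finset.Icc 1 m) :
    A.erase m ⊆ Finset.Icc 1 (m - 1) := by
  intro i hi
  rw [Finset.mem_erase] at hi
  have := Finset.mem_Icc.1 (hA hi.2)
  rw [Finset.mem_Icc]
  omega

theorem isFiniteParabolic_of_subset {m : ℕ} (hm : 2 ≤ m) (hmn : m ≤ n) {A : Finset ℕ}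
    (hA : A ⊆ Finset.Icc 1 m) : IsFiniteParabolic cs A := by
  induction m, hm using Nat.le_induction generalizing A with
  | base =>
    obtain ⟨O, hO⟩ := exists_isOrbit le_rfl hA
    refine hO.isFiniteParabolic cs hmn ?_
    rw [filter_act_two hA]
    exact isFiniteParabolic_empty cs
  | succ m hm ih =>
    obtain ⟨O, hO⟩ := exists_isOrbit (by omega) hA
    refine hO.isFiniteParabolic cs hmn ?_
    rw [filter_act_self (by omega) hA]
    exact ih (by omega) (erase_subset_Icc hA)

theorem complexK_eq (hn : 2 ≤ n) : complexK cs = complexA n 0 0 := by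
  ext σ
  rw [mem_complexA_zero_iff]
  exact ⟨fun h => h.1, fun h => ⟨h, (isFiniteParabolic_of_subset cs hn le_rfl h).1⟩⟩

theorem poincare_ne_zero {A : Finset ℕ} (h : Finite (parabolic cs A)) : poincare cs A ≠ 0 := by
  have := Fintype.ofFinite (parabolic cs A)
  intro h'
  have := congrArg (eval 1) h'
  rw [poincare, finsum_eq_sum_of_fintype] at this
  simp [eval_finsetSum] at this

theorem weight_empty {d : ℕ} (hd : 0 < d) : weight cs d ∅ = 0 := by
  rw [weight, poincare_empty, multiplicity_eq_zero]
  exact (prime_cyclotomic hd).not_dvd_one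

/-- The contribution of the largest vertex to the weight. -/
theorem weight_eq_add {d m : ℕ} (hd : 2 ≤ d) (hm : 3 ≤ m) (hmn : m ≤ n) {A : Finset ℕ}
    (hA : A ⊆ Finset.Icc 1 m) {O : Finset ℤ}
    (hO : IsOrbit m A (A.filter fun i => act i m = m) O) {p : ℚ[X]} (hp : p ≠ 0)
    (hs : ∑ c ∈ O, X ^ repLength m c = p) :
    weight cs d A = multiplicity (cyclotomic d ℚ) p + weight cs d (A.erase m) := by
  rw [filter_act_self hm hA] at hO
  have hfin := isFiniteParabolic_of_subset cs (show 2 ≤ m - 1 by omega) (by omega)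
    (erase_subset_Icc hA)
  rw [weight, hO.poincare_eq cs hmn hfin, hs,
    multiplicity_cyclotomic_mul (by omega) hp (poincare_ne_zero cs hfin.1)]
  rfl

theorem weight_of_subset_two {d : ℕ} (hn : 2 ≤ n) {A : Finset ℕ}
    (hA : A ⊆ Finset.Icc 1 2) {O : Finset ℤ}
    (hO : IsOrbit 2 A (A.filter fun i => act i (2 : ℕ) = (2 : ℕ)) O) {p : ℚ[X]}
    (hs : ∑ c ∈ O, X ^ repLength 2 c = p) :
    weight cs d A = multiplicity (cyclotomic d ℚ) p := by
  rw [filter_act_two hA] at hO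
  rw [weight, hO.poincare_eq cs hn (isFiniteParabolic_empty cs), hs, poincare_empty, mul_one]

variable {d m : ℕ} {A : Finset ℕ}

theorem weight_eq_of_gap (hd : 2 ≤ d) (hm : 3 ≤ m) (hmn : m ≤ n) (hA : A ⊆ Finset.Icc 1 m)
    (hj : 1 ≤ gap A m) (h : gap A m = 2 → 1 ∉ A) :
    weight cs d A = (if d ∣ m - gap A m + 1 then 1 else 0) + weight cs d (A.erase m) := by
  have := gap_le A m
  rw [weight_eq_add cs hd hm hmn hA (isOrbit_of_gap (by omega) hA hj h)
    (geom_sum_ne_zero_rat (by omega)) (sum_repLength_Icc hj),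
    multiplicity_cyclotomic_geom_sum hd (by omega), show m + 1 - gap A m = m - gap A m + 1 by omega]

theorem weight_eq_of_gap_eq_two (hd : 2 ≤ d) (hm : 3 ≤ m) (hmn : m ≤ n) (hA : A ⊆ Finset.Icc 1 m)
    (hj : gap A m = 2) (h : 1 ∈ A) :
    weight cs d A = (if d ∣ m then 1 else 0) + weight cs d (A.erase m) := by
  rw [weight_eq_add cs hd hm hmn hA (isOrbit_of_gap_eq_two (by omega) hA hj h)
    (geom_sum_ne_zero_rat (by omega)) (sum_repLength_insert (by omega)),
    multiplicity_cyclotomic_geom_sum hd (by omega)]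

/-- Passing from `D_m` to `D_{m+1}` multiplies by `[m+1](1 + X^m)`. This contributes the indicators
of `d ∣ m + 1` and `d ∣ 2m`, minus that of `d ∣ m`: the degree `m` is replaced by `m + 1`, and `2m`
is new. -/
theorem weight_Icc (hd : 2 ≤ d) (hm : 2 ≤ m) (hmn : m ≤ n) :
    weight cs d (Finset.Icc 1 m) = weightDComp d m := by
  have hgap : ∀ m, gap (Finset.Icc 1 m) m = 0 := fun m =>
    gap_eq (by omega) (by simp) fun t h1 h2 => Finset.mem_Icc.2 (by omega)
  induction m, hm using Nat.le_induction with
  | base =>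
    rw [weight_of_subset_two cs hmn (Finset.Subset.refl _)
      (isOrbit_of_gap_eq_zero le_rfl (Finset.Subset.refl _) (hgap 2))
      (sum_repLength_union le_rfl), multiplicity_cyclotomic_mul (by omega)
      (geom_sum_ne_zero_rat (by omega)) (one_add_X_pow_ne_zero _),
      multiplicity_cyclotomic_geom_sum hd (by omega)]
    have h1 := multiplicity_cyclotomic_one_add (k := 2 - 1) hd le_rfl
    rw [if_neg (fun h => by have := Nat.le_of_dvd (by omega) h; omega), add_zero] at h1
    rw [h1, weightDComp, add_comm]
    simp only [Nat.reduceSub, Finset.Icc_self, mul_one, Finset.filter_singleton]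
    split_ifs <;> simp
  | succ m hm ih =>
    rw [weight_eq_add cs hd (by omega) hmn (Finset.Subset.refl _)
      (isOrbit_of_gap_eq_zero (by omega) (Finset.Subset.refl _) (hgap (m + 1)))
      (mul_ne_zero (geom_sum_ne_zero_rat (by omega)) (one_add_X_pow_ne_zero _))
      (sum_repLength_union (by omega)), multiplicity_cyclotomic_mul (by omega)
      (geom_sum_ne_zero_rat (by omega)) (one_add_X_pow_ne_zero _),
      multiplicity_cyclotomic_geom_sum hd (by omega), Nat.add_sub_cancel]
    have h1 := multiplicity_cyclotomic_one_add (k := m) hd (by omega)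
    have h2 : (Finset.Icc 1 (m + 1)).erase (m + 1) = Finset.Icc 1 m := by
      ext i
      simp only [Finset.mem_erase, Finset.mem_Icc]
      omega
    have h3 : ((Finset.Icc 1 m).filter fun i => d ∣ 2 * i).card =
        ((Finset.Icc 1 (m - 1)).filter fun i => d ∣ 2 * i).card + if d ∣ 2 * m then 1 else 0 := by
      rw [show Finset.Icc 1 m = insert m (Finset.Icc 1 (m - 1)) by
        ext i; simp only [Finset.mem_insert, Finset.mem_Icc]; omega, Finset.filter_insert]
      split_ifs
      · rw [Finset.card_insert_of_notMem (by simp; omega)]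
      · rfl
    rw [h2, ih (by omega), weightDComp, weightDComp, Nat.add_sub_cancel, h3]
    omega

end Weight

/-! ### Removing the largest vertex in the combinatorial weights. -/

theorem gap_erase_of_lt {A : Finset ℕ} {m i : ℕ} (h0 : 0 ∉ A) (hi : i < m) :
    gap (A.erase m) i = gap A i :=
  gap_eq (gap_le A i) (fun h => gap_notMem h0 i (Finset.mem_of_mem_erase h))
    fun _ h1 h2 => Finset.mem_erase.2 ⟨by omega, mem_of_gap_lt h1 h2⟩

theorem weightA_eq_add_erase {d : ℕ} (hd : 2 ≤ d) {A : Finset ℕ} {m : ℕ}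
    (hA : A ⊆ Finset.Icc 1 m) :
    weightA d A = (if d ∣ m - gap A m + 1 then 1 else 0) + weightA d (A.erase m) := by
  have h0 := zero_notMem_of_subset_Icc hA
  have h1 : ((A.erase m).filter fun i => d ∣ i - gap (A.erase m) i + 1) =
      (A.erase m).filter fun i => d ∣ i - gap A i + 1 := by
    refine Finset.filter_congr fun i hi => ?_
    rw [Finset.mem_erase] at hi
    have := Finset.mem_Icc.1 (hA hi.2)
    rw [gap_erase_of_lt h0 (by omega)]
  rw [weightA, weightA, h1]
  by_cases hm : m ∈ A
  · rw [← Finset.insert_erase hm, Finset.filter_insert, Finset.insert_erase hm]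
    split_ifs
    · rw [Finset.card_insert_of_notMem (by simp), add_comm]
    · rw [zero_add]
  -- If `m` is missing, it is its own gap, and the indicator asks whether `d` divides `1`.
  · rw [Finset.erase_eq_of_notMem hm, gap_eq le_rfl hm (fun t h1 h2 => by omega), Nat.sub_self,
      if_neg (fun h => by have := Nat.le_of_dvd (by omega) h; omega), zero_add]

theorem shift_erase {k m : ℕ} (A : Finset ℕ) (h : k < m) :
    shift k (A.erase m) = (shift k A).erase (m - k) := by
  ext i
  simp only [mem_shift, Finset.mem_erase]
  grind

theorem shift_subset_Icc {k m : ℕ} {A : Finset ℕ} (hA : A ⊆ Finset.Icc 1 m) :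
    shift k A ⊆ Finset.Icc 1 (m - k) := by
  intro i hi
  rw [mem_shift] at hi
  have := Finset.mem_Icc.1 (hA hi.2)
  rw [Finset.mem_Icc]
  omega

theorem weightA_shift_eq_add_erase {d : ℕ} (hd : 2 ≤ d) {A : Finset ℕ} {m k : ℕ}
    (hA : A ⊆ Finset.Icc 1 m) (hk : k ∉ A) (hkm : k < m) :
    weightA d (shift k A) =
      (if d ∣ m - gap A m + 1 then 1 else 0) + weightA d (shift k (A.erase m)) := by
  have h1 := gap_le A m
  have h2 := le_gap hkm.le hk
  rw [weightA_eq_add_erase hd (shift_subset_Icc hA), ← shift_erase A hkm,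
    gap_shift (zero_notMem_of_subset_Icc hA) hk, Nat.sub_add_cancel hkm.le,
    show m - k - (gap A m - k) = m - gap A m by omega]

theorem relabel_subset_Icc {m : ℕ} {A : Finset ℕ} (hm : 2 ≤ m) (hA : A ⊆ Finset.Icc 1 m)
    (h2 : 2 ∉ A) : relabel A ⊆ Finset.Icc 1 (m - 1) := by
  intro i hi
  rw [mem_relabel (zero_notMem_of_subset_Icc hA) h2] at hi
  rw [Finset.mem_Icc]
  rcases hi with ⟨rfl, _⟩ | ⟨h, h'⟩
  · omega
  · have := Finset.mem_Icc.1 (hA h')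
    omega

theorem relabel_erase {m : ℕ} {A : Finset ℕ} (h0 : 0 ∉ A) (h2 : 2 ∉ A) (hm : 3 ≤ m) :
    relabel (A.erase m) = (relabel A).erase (m - 1) := by
  ext i
  rw [Finset.mem_erase, mem_relabel h0 h2, mem_relabel (fun h => h0 (Finset.mem_of_mem_erase h))
    (fun h => h2 (Finset.mem_of_mem_erase h))]
  simp only [Finset.mem_erase]
  grind

/-- The predecessor of a run of vertices after the relabeling. -/
theorem gap_relabel {m : ℕ} {A : Finset ℕ} (h0 : 0 ∉ A) (h2 : 2 ∉ A) (hm : 2 ≤ m) :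
    gap (relabel A) (m - 1) = if gap A m = 2 ∧ 1 ∈ A then 0 else gap A m - 1 := by
  have h3 := le_gap hm h2
  have h4 := gap_le A m
  have h5 := gap_notMem h0 m
  have h6 : ∀ t, gap A m < t → t ≤ m → t ∈ A := fun t => mem_of_gap_lt
  split_ifs with h
  · refine gap_eq (by omega) ?_ fun t ht1 ht2 => ?_
    · rw [mem_relabel h0 h2]; omega
    · rw [mem_relabel h0 h2]
      by_cases ht : t = 1
      · exact Or.inl ⟨ht, h.2⟩
      · exact Or.inr ⟨by omega, h6 _ (by omega) (by omega)⟩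
  · refine gap_eq (by omega) ?_ fun t ht1 ht2 => ?_
    · rw [mem_relabel h0 h2, Nat.sub_add_cancel (by omega)]
      rintro (⟨h7, h8⟩ | h7)
      · exact h ⟨by omega, h8⟩
      · exact h5 h7.2
    · rw [mem_relabel h0 h2]
      exact Or.inr ⟨by omega, h6 _ (by omega) (by omega)⟩

/-! ### The three weight formulas. -/

section IsWeightD

variable {n : ℕ} {W : Type*} [Group W] (cs : CoxeterSystem (typeD n) W) {d : ℕ}

/-- Both sides satisfy the same recursion when the largest vertex is removed: the gap is positive,
and the exceptional orbit needs the vertex `1`. -/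
theorem weight_eq_weightA_shift (hd : 2 ≤ d) {m : ℕ} (hm : 2 ≤ m) (hmn : m ≤ n) {A : Finset ℕ}
    (hA : A ⊆ Finset.Icc 1 m) (h1 : 1 ∉ A) : weight cs d A = weightA d (shift 1 A) := by
  induction m, hm using Nat.le_induction generalizing A with
  | base =>
    have h3 := gap_le A 2
    have h4 := le_gap (show 1 ≤ 2 by omega) h1
    have h5 : shift 1 (A.erase 2) = ∅ := by
      rw [Finset.eq_empty_iff_forall_notMem]
      intro i hi
      rw [mem_shift, Finset.mem_erase] at hi
      have := Finset.mem_Icc.1 (hA hi.2.2)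
      omega
    rw [weightA_shift_eq_add_erase hd hA h1 (by omega), h5, weightA_empty, add_zero,
      weight_of_subset_two cs hmn hA (isOrbit_of_gap le_rfl hA h4 fun _ => h1)
      (sum_repLength_Icc h4), multiplicity_cyclotomic_geom_sum hd (by omega),
      show 2 + 1 - gap A 2 = 2 - gap A 2 + 1 by omega]
  | succ m hm ih =>
    rw [weight_eq_of_gap cs hd (by omega) hmn hA (le_gap (by omega) h1) fun _ => h1,
      weightA_shift_eq_add_erase hd hA h1 (by omega),
      ih (by omega) (erase_subset_Icc hA) fun h => h1 (Finset.mem_of_mem_erase h)]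

/-- The exceptional orbit `{-1, 2, …, m}` has `m` letters, which matches the relabeled run, now
joined to the vertex `1` and with predecessor `0`. -/
theorem weight_eq_weightA_relabel (hd : 2 ≤ d) {m : ℕ} (hm : 2 ≤ m) (hmn : m ≤ n) {A : Finset ℕ}
    (hA : A ⊆ Finset.Icc 1 m) (h2 : 2 ∉ A) : weight cs d A = weightA d (relabel A) := by
  induction m, hm using Nat.le_induction generalizing A with
  | base =>
    have hgap : gap A 2 = 2 := gap_eq le_rfl h2 fun t h1 h2 => by omega
    by_cases h1 : 1 ∈ A
    · have h0 := zero_notMem_of_subset_Icc hA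
      have hg := gap_relabel h0 h2 (le_refl 2)
      rw [if_pos ⟨hgap, h1⟩] at hg
      have hE : (relabel A).erase (2 - 1) = ∅ := by
        have := erase_subset_Icc (relabel_subset_Icc le_rfl hA h2)
        rw [Finset.Icc_eq_empty (by omega)] at this
        exact Finset.subset_empty.1 this
      rw [weightA_eq_add_erase hd (relabel_subset_Icc le_rfl hA h2), hg, hE, weightA_empty,
        weight_of_subset_two cs hmn hA (isOrbit_of_gap_eq_two le_rfl hA hgap h1)
        (sum_repLength_insert le_rfl), multiplicity_cyclotomic_geom_sum hd (by omega)]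
      rfl
    · have : A = ∅ := by
        rw [Finset.eq_empty_iff_forall_notMem]
        intro i hi
        have := Finset.mem_Icc.1 (hA hi)
        have : i = 1 ∨ i = 2 := by omega
        rcases this with rfl | rfl
        · exact h1 hi
        · exact h2 hi
      rw [this, weight_empty cs (by omega), relabel, Finset.image_empty, weightA_empty]
  | succ m hm ih =>
    have h0 := zero_notMem_of_subset_Icc hA
    have h3 := le_gap (show 2 ≤ m + 1 by omega) h2
    have h4 := gap_le A (m + 1)
    have ih := ih (by omega) (erase_subset_Icc hA) fun h => h2 (Finset.mem_of_mem_erase h)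
    rw [weightA_eq_add_erase hd (relabel_subset_Icc (by omega) hA h2),
      gap_relabel h0 h2 (by omega), ← relabel_erase h0 h2 (by omega), ← ih]
    by_cases h : gap A (m + 1) = 2 ∧ 1 ∈ A
    · rw [if_pos h, weight_eq_of_gap_eq_two cs hd (by omega) hmn hA h.1 h.2]
      rfl
    · rw [if_neg h, weight_eq_of_gap cs hd (by omega) hmn hA (by omega) fun h' h'' => h ⟨h', h''⟩,
        show m + 1 - 1 - (gap A (m + 1) - 1) = m + 1 - gap A (m + 1) by omega]

theorem weight_eq_add_weightA (hd : 2 ≤ d) {k m : ℕ} (hk : 2 ≤ k) (hkm : k ≤ m) (hmn : m ≤ n)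
    {A : Finset ℕ} (hA : A ⊆ Finset.Icc 1 m) (hkA : Finset.Icc 1 k ⊆ A) (hkA' : k + 1 ∉ A) :
    weight cs d A = weightDComp d k + weightA d (shift (k + 1) A) := by
  induction m, hkm using Nat.le_induction generalizing A with
  | base =>
    have h1 : shift (k + 1) A = ∅ := by
      have := shift_subset_Icc (k := k + 1) hA
      rw [Finset.Icc_eq_empty (by omega)] at this
      exact Finset.subset_empty.1 this
    rw [h1, weightA_empty, add_zero, hA.antisymm hkA, weight_Icc cs hd hk hmn]
  | succ m hkm ih =>
    have hE := erase_subset_Icc hA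
    -- In this case the vertex just added to the range is `k + 1` itself, which `A` lacks.
    by_cases h : m = k
    · subst h
      rw [Finset.erase_eq_of_notMem hkA'] at hE
      exact ih (by omega) hE hkA hkA'
    · have hg := le_gap (show k + 1 ≤ m + 1 by omega) hkA'
      rw [weight_eq_of_gap cs hd (by omega) hmn hA (by omega) (by omega),
        weightA_shift_eq_add_erase hd hA hkA' (by omega), ih (by omega) hE ?_
        fun h => hkA' (Finset.mem_of_mem_erase h), add_left_comm]
      intro i hi
      have := Finset.mem_Icc.1 hi
      exact Finset.mem_erase.2 ⟨by omega, hkA hi⟩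

theorem isWeightD_weight (hd : 2 ≤ d) (hn : 2 ≤ n) : IsWeightD n d (weight cs d) where
  eq_shift _ hσ h1 := weight_eq_weightA_shift cs hd hn le_rfl hσ h1
  eq_relabel _ hσ h2 := weight_eq_weightA_relabel cs hd hn le_rfl hσ h2
  eq_add _ hσ k hk hkσ hkσ' := weight_eq_add_weightA cs hd hk
    (Finset.mem_Icc.1 (hσ (hkσ (Finset.mem_Icc.2 (by omega))))).2 le_rfl hσ hkσ hkσ'

end IsWeightD

/-! ### Residues modulo `d` and values of the defect. -/

theorem modEq_iff_exists_eq_mul_add {n d r : ℕ} (hr : r < d) :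
    n ≡ r [MOD d] ↔ ∃ m, n = m * d + r := by
  constructor
  · intro h
    rw [Nat.ModEq, Nat.mod_eq_of_lt hr] at h
    exact ⟨n / d, by rw [← h, mul_comm, Nat.div_add_mod]⟩
  · rintro ⟨m, rfl⟩
    rw [Nat.ModEq, Nat.mul_add_mod_self_right]

theorem complexD_eq {n : ℕ} {W : Type*} [Group W] (cs : CoxeterSystem (typeD n) W) (hn : 2 ≤ n)
    (g : ℕ) : complexD cs g = complexA n 0 g := by
  ext σ
  rw [complexD, Set.mem_ofPred_eq, complexK_eq cs hn, mem_complexA_zero_iff]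
  simp [complexA]

section Defect

variable {n d : ℕ} {W : Type*} [Group W] (cs : CoxeterSystem (typeD n) W) {σ : Finset ℕ} {m : ℕ}

theorem defect_eq_of_card (hd : 2 ≤ d) (h : σ.card = weight cs d σ + m * (d - 2)) :
    defect cs d σ = m * (d - 2) := by
  rw [defect, h]
  push_cast [Nat.cast_sub hd]
  ring

theorem defect_eq_of_eq_mul (hd : 2 ≤ d) (hn : n = m * d)
    (h : σ.card = weight cs d σ + m * (d - 2)) : defect cs d σ = n - 2 * (n / d : ℚ) := by
  have hd0 : (d : ℚ) ≠ 0 := by positivity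
  rw [defect_eq_of_card cs hd h, show (n : ℚ) = m * d by exact_mod_cast hn]
  field_simp

theorem defect_eq_of_eq_mul_add_one (hd : 2 ≤ d) (hn : n = m * d + 1)
    (h : σ.card = weight cs d σ + m * (d - 2)) :
    defect cs d σ = n - 2 * ((n - 1) / d : ℚ) - 1 := by
  have hd0 : (d : ℚ) ≠ 0 := by positivity
  rw [defect_eq_of_card cs hd h, show (n : ℚ) = m * d + 1 by exact_mod_cast hn]
  field_simp
  ring

theorem defect_eq_of_eq_mul_add_half (hd : 2 ≤ d) (heven : Even d) (hn : n = m * d + d / 2 + 1)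
    (h : σ.card = weight cs d σ + m * (d - 2) + d / 2) :
    defect cs d σ = n - 2 * ((n - 1) / d : ℚ) := by
  obtain ⟨k, rfl⟩ := even_iff_two_dvd.1 heven
  rw [Nat.mul_div_cancel_left _ (by norm_num)] at hn h
  have hk : (k : ℚ) ≠ 0 := by
    have : k ≠ 0 := by omega
    exact_mod_cast this
  rw [defect, h, show (n : ℚ) = m * (2 * k : ℕ) + k + 1 by exact_mod_cast hn]
  push_cast [Nat.cast_sub hd]
  field_simp
  ring

end Defect

/-- The assertions on the matching for odd `d`. -/
theorem matchingDOdd_spec {W : Type*} [Group W] {n d : ℕ} (hn : 4 ≤ n) (hd : 3 ≤ d) (hodd : Odd d)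
    (cs : CoxeterSystem (typeD n) W) :
    (n ≡ 0 [MOD d] →
      {σ | IsCritical (complexK cs) (matchingDOdd cs d) σ}.ncard = 2 ∧
      ∀ σ, IsCritical (complexK cs) (matchingDOdd cs d) σ →
        defect cs d σ = n - 2 * (n / d : ℚ)) ∧
    (n ≡ 1 [MOD d] →
      {σ | IsCritical (complexK cs) (matchingDOdd cs d) σ}.ncard = 2 ∧
      ∀ σ, IsCritical (complexK cs) (matchingDOdd cs d) σ →
        defect cs d σ = n - 2 * ((n - 1) / d : ℚ) - 1) ∧
    (¬ n ≡ 0 [MOD d] → ¬ n ≡ 1 [MOD d] →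
      ∀ σ, ¬ IsCritical (complexK cs) (matchingDOdd cs d) σ) := by
  have hw := isWeightD_weight cs (show 2 ≤ d by omega) (show 2 ≤ n by omega)
  have hcrit : ∀ σ, IsCritical (complexK cs) (matchingDOdd cs d) σ ↔
      σ ∈ complexA n 0 0 ∧ ruleDOdd d n σ = none := by
    rw [matchingDOdd, complexK_eq cs (by omega)]
    exact (tame_ruleDOdd (by omega) hodd hn hw).isCritical_iff
  have h0 : n ≡ 0 [MOD d] ↔ ∃ m, n = m * d := modEq_iff_exists_eq_mul_add (by omega)
  have h1 : n ≡ 1 [MOD d] ↔ ∃ m, n = m * d + 1 := modEq_iff_exists_eq_mul_add (by omega)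
  have h01 : n ≡ 0 [MOD d] → ¬ n ≡ 1 [MOD d] := by
    intro h h'
    have := Nat.ModEq.eq_of_lt_of_lt (h.symm.trans h') (by omega) (by omega)
    omega
  have hncard : (∃ m, n = m * d + 1) ∨ (∃ m, n = m * d) →
      {σ | IsCritical (complexK cs) (matchingDOdd cs d) σ}.ncard = 2 := by
    intro h
    obtain ⟨σ₁, σ₂, hne, hσ⟩ := exists_two_ruleDOdd_eq_none hd hn h
    rw [show {σ | IsCritical (complexK cs) (matchingDOdd cs d) σ} = {σ₁, σ₂} by
      ext σ; exact (hcrit σ).trans (hσ σ)]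
    exact Set.ncard_pair hne
  refine ⟨fun h => ⟨hncard (.inr (h0.1 h)), fun σ hσ => ?_⟩,
    fun h => ⟨hncard (.inl (h1.1 h)), fun σ hσ => ?_⟩, fun h h' σ hσ => ?_⟩ <;>
  obtain ⟨hσK, hr⟩ := (hcrit σ).1 hσ <;>
  rcases card_eq_of_ruleDOdd_eq_none hd hn hw hσK hr with ⟨m, hm, hc⟩ | ⟨m, hm, hc⟩
  · exact absurd (h1.2 ⟨m, hm⟩) (h01 h)
  · exact defect_eq_of_eq_mul cs (by omega) hm hc
  · exact defect_eq_of_eq_mul_add_one cs (by omega) hm hc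
  · exact absurd h (h01 (h0.2 ⟨m, hm⟩))
  · exact h' (h1.2 ⟨m, hm⟩)
  · exact h (h0.2 ⟨m, hm⟩)

/-- The assertions on the matching for even `d`. -/
theorem matchingDEven_spec {W : Type*} [Group W] {n d : ℕ} (hn : 4 ≤ n) (hd : 2 ≤ d)
    (heven : Even d) (cs : CoxeterSystem (typeD n) W) :
    (n ≡ 0 [MOD d] →
      (∀ σ, IsCritical (complexK cs) (matchingDEven cs d 0) σ →
        defect cs d σ = n - 2 * (n / d : ℚ) ∧ partD d n σ ∈ originsZero n d) ∧
      ∀ p ∈ originsZero n d, p ≠ .g22 → p ≠ .g23 →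
        ∃ σ, IsCritical (complexK cs) (matchingDEven cs d 0) σ ∧ partD d n σ = p) ∧
    (n ≡ 1 [MOD d] →
      (∀ σ, IsCritical (complexK cs) (matchingDEven cs d 0) σ →
        defect cs d σ = n - 2 * ((n - 1) / d : ℚ) - 1 ∧ partD d n σ = .a) ∧
      ∃ σ, IsCritical (complexK cs) (matchingDEven cs d 0) σ) ∧
    (4 ≤ d → n ≡ d / 2 + 1 [MOD d] →
      (∀ σ, IsCritical (complexK cs) (matchingDEven cs d 0) σ →
        defect cs d σ = n - 2 * ((n - 1) / d : ℚ) ∧ partD d n σ ∈ originsHalf d) ∧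
      ∀ p ∈ originsHalf d, p ≠ .g22 → p ≠ .g23 →
        ∃ σ, IsCritical (complexK cs) (matchingDEven cs d 0) σ ∧ partD d n σ = p) ∧
    (¬ n ≡ 0 [MOD d] → ¬ n ≡ 1 [MOD d] → ¬ (4 ≤ d ∧ n ≡ d / 2 + 1 [MOD d]) →
      ∀ σ, ¬ IsCritical (complexK cs) (matchingDEven cs d 0) σ) := by
  have hw := isWeightD_weight cs (show 2 ≤ d by omega) (show 2 ≤ n by omega)
  have hcrit : ∀ σ, IsCritical (complexK cs) (matchingDEven cs d 0) σ ↔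
      σ ∈ complexA n 0 0 ∧ ruleDEven d n 0 σ = none := by
    rw [matchingDEven, complexD_eq cs (by omega), complexK_eq cs (by omega)]
    exact (tame_ruleDEven (by omega) heven hw hn (by omega)).isCritical_iff
  have hdata : ∀ σ, IsCritical (complexK cs) (matchingDEven cs d 0) σ →
      CriticalData n d (weight cs d) σ := fun σ hσ =>
    criticalData_of_ruleDEven_eq_none hd heven hn hw ((hcrit σ).1 hσ).1 ((hcrit σ).1 hσ).2
  -- Separates the three cases: `0`, `1` and `d / 2 + 1` are distinct residues for `d ≥ 4`. For `d =
  -- 2` the last is congruent to `0`, hence the restriction on `d`.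
  have hunique : ∀ r r', r < d → r' < d → n ≡ r [MOD d] → n ≡ r' [MOD d] → r = r' :=
    fun r r' hr hr' h h' => Nat.ModEq.eq_of_lt_of_lt (h.symm.trans h') hr hr'
  have h0 : n ≡ 0 [MOD d] ↔ ∃ m, n = m * d := modEq_iff_exists_eq_mul_add (by omega)
  have h1 : n ≡ 1 [MOD d] ↔ ∃ m, n = m * d + 1 := modEq_iff_exists_eq_mul_add (by omega)
  have h2 : 4 ≤ d → (n ≡ d / 2 + 1 [MOD d] ↔ ∃ m, n = m * d + d / 2 + 1) := fun hd4 =>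
    modEq_iff_exists_eq_mul_add (by omega)
  simp only [hcrit] at hdata ⊢
  refine ⟨fun h => ⟨fun σ hσ => ?_, fun p hp hp2 hp3 => ?_⟩, fun h => ⟨fun σ hσ => ?_, ?_⟩,
    fun hd4 h => ⟨fun σ hσ => ?_, fun p hp hp2 hp3 => ?_⟩, fun h h' h'' σ hσ => ?_⟩
  · rcases hdata σ hσ with ⟨m, hm, hc, hp⟩ | ⟨m, hm, hc, hp⟩ | ⟨hd4, m, hm, hc, hp⟩
    · exact ⟨defect_eq_of_eq_mul cs hd hm hc, hp⟩
    · have := hunique 0 1 (by omega) (by omega) h (h1.2 ⟨m, hm⟩)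
      omega
    · have := hunique 0 (d / 2 + 1) (by omega) (by omega) h ((h2 hd4).2 ⟨m, hm⟩)
      omega
  · rw [h0] at h
    obtain ⟨k, rfl⟩ := even_iff_two_dvd.1 heven
    rcases hp with rfl | ⟨rfl, rfl, hk⟩ | ⟨rfl, hk⟩ | ⟨rfl, hk⟩ | rfl | rfl | rfl
    · exact exists_critical_a hd hn (.inr h)
    · rw [hk]
      exact exists_critical_b
    · rw [hk] at h ⊢
      exact exists_critical_d hn (.inl h)
    · rcases hk with hk | ⟨rfl, hk⟩
      · exact exists_critical_f_of_three_le hn (by omega) (.inl h)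
      · rw [hk]
        exact exists_critical_f_four
    · exact exists_critical_g21 hn (by omega) (.inl h)
    · exact absurd rfl hp2
    · exact absurd rfl hp3
  · rcases hdata σ hσ with ⟨m, hm, hc, hp⟩ | ⟨m, hm, hc, hp⟩ | ⟨hd4, m, hm, hc, hp⟩
    · have := hunique 0 1 (by omega) (by omega) (h0.2 ⟨m, hm⟩) h
      omega
    · exact ⟨defect_eq_of_eq_mul_add_one cs hd hm hc, hp⟩
    · have := hunique 1 (d / 2 + 1) (by omega) (by omega) h ((h2 hd4).2 ⟨m, hm⟩)
      omega
  · obtain ⟨σ, hσ, _⟩ := exists_critical_a hd hn (.inl (h1.1 h))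
    exact ⟨σ, hσ⟩
  · rcases hdata σ hσ with ⟨m, hm, hc, hp⟩ | ⟨m, hm, hc, hp⟩ | ⟨hd4, m, hm, hc, hp⟩
    · have := hunique 0 (d / 2 + 1) (by omega) (by omega) (h0.2 ⟨m, hm⟩) h
      omega
    · have := hunique 1 (d / 2 + 1) (by omega) (by omega) (h1.2 ⟨m, hm⟩) h
      omega
    · exact ⟨defect_eq_of_eq_mul_add_half cs hd heven hm hc, hp⟩
  · rw [h2 hd4] at h
    obtain ⟨k, rfl⟩ := even_iff_two_dvd.1 heven
    rw [Nat.mul_div_cancel_left _ (by norm_num)] at h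
    rcases hp with ⟨rfl, hk⟩ | ⟨rfl, hk⟩ | rfl | rfl | rfl
    · obtain rfl : k = 2 := by omega
      obtain ⟨m, hm⟩ := h
      exact exists_critical_d hn (.inr ⟨m + 1, by omega⟩)
    · exact exists_critical_f_of_three_le hn (by omega) (.inr h)
    · exact exists_critical_g21 hn (by omega) (.inr ⟨by omega, h⟩)
    · exact absurd rfl hp2
    · exact absurd rfl hp3
  · rcases hdata σ hσ with ⟨m, hm, hc, hp⟩ | ⟨m, hm, hc, hp⟩ | ⟨hd4, m, hm, hc, hp⟩
    · exact h (h0.2 ⟨m, hm⟩)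
    · exact h' (h1.2 ⟨m, hm⟩)
    · exact h'' ⟨hd4, (h2 hd4).2 ⟨m, hm⟩⟩

end PreciseMatching

theorem lemma7p1 {W : Type*} [Group W] (n d : ℕ) (hn : 4 ≤ n) (hd : 2 ≤ d)
    (cs : CoxeterSystem (typeD n) W) :
    -- the matching on `K^D_n` for `d` odd
    (Odd d →
      IsMatching (complexK cs) (matchingDOdd cs d) ∧
      (∀ σ, IsCritical (complexK cs) (matchingDOdd cs d) σ ↔
        σ ∈ complexK cs ∧ ruleDOdd d n σ = none) ∧
      IsAcyclic (matchingDOdd cs d) ∧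
      IsWeighted (weight cs d) (matchingDOdd cs d) ∧
      (n ≡ 0 [MOD d] →
        {σ | IsCritical (complexK cs) (matchingDOdd cs d) σ}.ncard = 2 ∧
        ∀ σ, IsCritical (complexK cs) (matchingDOdd cs d) σ →
          defect cs d σ = n - 2 * (n / d : ℚ)) ∧
      (n ≡ 1 [MOD d] →
        {σ | IsCritical (complexK cs) (matchingDOdd cs d) σ}.ncard = 2 ∧
        ∀ σ, IsCritical (complexK cs) (matchingDOdd cs d) σ →
          defect cs d σ = n - 2 * ((n - 1) / d : ℚ) - 1) ∧
      (¬ n ≡ 0 [MOD d] → ¬ n ≡ 1 [MOD d] →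
        ∀ σ, ¬ IsCritical (complexK cs) (matchingDOdd cs d) σ) ∧
      (∃ c : ℚ, ∀ σ, IsCritical (complexK cs) (matchingDOdd cs d) σ → defect cs d σ = c) ∧
      IsPrecise (complexK cs) (weight cs d) (matchingDOdd cs d)) ∧
    -- the matching for `d` even: on each `K^D_{n,g}`, and then on `K^D_n = K^D_{n,0}`
    (Even d →
      (∀ g ≤ n - 1,
        IsMatching (complexD cs g) (matchingDEven cs d g) ∧
        (∀ σ, IsCritical (complexD cs g) (matchingDEven cs d g) σ ↔
          σ ∈ complexD cs g ∧ ruleDEven d n g σ = none) ∧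
        IsAcyclic (matchingDEven cs d g) ∧
        IsWeighted (weight cs d) (matchingDEven cs d g)) ∧
      (n ≡ 0 [MOD d] →
        (∀ σ, IsCritical (complexK cs) (matchingDEven cs d 0) σ →
          defect cs d σ = n - 2 * (n / d : ℚ) ∧ partD d n σ ∈ originsZero n d) ∧
        ∀ p ∈ originsZero n d, p ≠ .g22 → p ≠ .g23 →
          ∃ σ, IsCritical (complexK cs) (matchingDEven cs d 0) σ ∧ partD d n σ = p) ∧
      (n ≡ 1 [MOD d] →
        (∀ σ, IsCritical (complexK cs) (matchingDEven cs d 0) σ →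
          defect cs d σ = n - 2 * ((n - 1) / d : ℚ) - 1 ∧ partD d n σ = .a) ∧
        ∃ σ, IsCritical (complexK cs) (matchingDEven cs d 0) σ) ∧
      (4 ≤ d → n ≡ d / 2 + 1 [MOD d] →
        (∀ σ, IsCritical (complexK cs) (matchingDEven cs d 0) σ →
          defect cs d σ = n - 2 * ((n - 1) / d : ℚ) ∧ partD d n σ ∈ originsHalf d) ∧
        ∀ p ∈ originsHalf d, p ≠ .g22 → p ≠ .g23 →
          ∃ σ, IsCritical (complexK cs) (matchingDEven cs d 0) σ ∧ partD d n σ = p) ∧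
      (¬ n ≡ 0 [MOD d] → ¬ n ≡ 1 [MOD d] → ¬ (4 ≤ d ∧ n ≡ d / 2 + 1 [MOD d]) →
        ∀ σ, ¬ IsCritical (complexK cs) (matchingDEven cs d 0) σ) ∧
      (∃ c : ℚ, ∀ σ, IsCritical (complexK cs) (matchingDEven cs d 0) σ →
        defect cs d σ = c) ∧
      IsPrecise (complexK cs) (weight cs d) (matchingDEven cs d 0)) := by
  have hw := isWeightD_weight cs hd (show 2 ≤ n by omega)
  constructor
  · intro hodd
    have hd3 : 3 ≤ d := by
      rcases hd.eq_or_lt with rfl | h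
      · exact absurd hodd (by decide)
      · exact h
    have htame : Tame (complexK cs) (ruleDOdd d n) (weight cs d) := by
      rw [complexK_eq cs (by omega)]
      exact tame_ruleDOdd hd hodd hn hw
    obtain ⟨h0, h1, h2⟩ := matchingDOdd_spec hn hd3 hodd cs
    have hconst : ∃ c : ℚ, ∀ σ, IsCritical (complexK cs) (matchingDOdd cs d) σ →
        defect cs d σ = c := by
      by_cases hn0 : n ≡ 0 [MOD d]
      · exact ⟨_, (h0 hn0).2⟩
      by_cases hn1 : n ≡ 1 [MOD d]
      · exact ⟨_, (h1 hn1).2⟩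
      exact ⟨0, fun σ hσ => absurd hσ (h2 hn0 hn1 σ)⟩
    refine ⟨htame.isMatching, htame.isCritical_iff, htame.isAcyclic, htame.isWeighted, h0, h1, h2,
      hconst, ?_⟩
    obtain ⟨c, hc⟩ := hconst
    exact htame.isPrecise c hc
  · intro heven
    have htame : ∀ g ≤ n - 1, Tame (complexD cs g) (ruleDEven d n g) (weight cs d) := by
      intro g hg
      rw [complexD_eq cs (by omega)]
      exact tame_ruleDEven hd heven hw hn hg
    have hK : complexD cs 0 = complexK cs := by
      rw [complexD_eq cs (by omega), complexK_eq cs (by omega)]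
    obtain ⟨h0, h1, h2, h3⟩ := matchingDEven_spec hn hd heven cs
    have hconst : ∃ c : ℚ, ∀ σ, IsCritical (complexK cs) (matchingDEven cs d 0) σ →
        defect cs d σ = c := by
      by_cases hn0 : n ≡ 0 [MOD d]
      · exact ⟨_, fun σ hσ => ((h0 hn0).1 σ hσ).1⟩
      by_cases hn1 : n ≡ 1 [MOD d]
      · exact ⟨_, fun σ hσ => ((h1 hn1).1 σ hσ).1⟩
      by_cases hn2 : 4 ≤ d ∧ n ≡ d / 2 + 1 [MOD d]
      · exact ⟨_, fun σ hσ => ((h2 hn2.1 hn2.2).1 σ hσ).1⟩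
      -- Without critical simplices any constant will do.
      exact ⟨0, fun σ hσ => absurd hσ (h3 hn0 hn1 hn2 σ)⟩
    refine ⟨fun g hg => ⟨(htame g hg).isMatching, (htame g hg).isCritical_iff,
      (htame g hg).isAcyclic, (htame g hg).isWeighted⟩, h0, h1, h2, h3, hconst, ?_⟩
    obtain ⟨c, hc⟩ := hconst
    have := htame 0 (by omega)
    rw [matchingDEven, hK] at *
    exact this.isPrecise c hc
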